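/- Let $q$ be a prime power and $V=\mathbf F_q^n$. Let $G=\mathrm{GCl}_n(q)$ be one of the groups $\mathrm{GL}_n(q)$, $\mathrm{Sp}_n(q)$, $\mathrm{GO}_n^{(\pm)}(q)$, $\mathrm{GU}_n(q)$, that is, respectively, the group of all linear automorphisms of $V$, or of those preserving a nondegenerate alternating form on $V$, a quadratic form $Q$ on $V$ whose polar form $Q(u+v)-Q(u)-Q(v)$ is nondegenerate, or a nondegenerate hermitian form on $V$ with respect to a field automorphism of $\mathbf F_q$ of order $2$ (in which case $q$ is a square). Let $\mathrm{SCl}_n(q)$ be, respectively, $\mathrm{SL}_n(q)$, $\mathrm{Sp}_n(q)$, $\Omega_n^{(\pm)}(q)=\mathrm{SO}_n^{(\pm)}(q)'$, $\mathrm{SU}_n(q)$. Here $\mathrm{SO}$ and $\mathrm{SU}$ are the subgroups of determinant $1$ in $\mathrm{GO}$ and $\mathrm{GU}$, and $'$ denotes the derived subgroup. The degree of $g\in\mathrm{GL}_n(q)$ is $\deg g=\operatorname{rank}(g-1)$. Let $\mathfrak M$ be the set of nontrivial elements of $\mathrm{SCl}_n(q)$ whose degree is minimal among all nontrivial elements of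 $\mathrm{SCl}_n(q)$. Put $\kappa=2$ if $G$ is orthogonal and $q$ is even, and $\kappa=1$ otherwise. There are absolute constants $C,K>0$ and $N$ such that the following holds for every such $G$ with $n\ge N$. Let $d$ be an integer with $2\le d\le n$ and $q^d>Cn$. Then there is a subset $\mathcal C_d\subseteq G$, invariant under conjugation by $G$, such that: 1. for every $\alpha\in G^{\mathrm{ab}}$, the fibre $\mathcal C_{d;\alpha}$ of $\mathcal C_d$ over $\alpha$ (the set of elements of $\mathcal C_d$ that map to $\alpha$ under $G\to G^{\mathrm{ab}}$) satisfies $$\frac{|\mathcal C_{d;\alpha}|}{|G|}\ \ge\ \exp\!\left(-K\,d^2\log q-K\,\frac{n\log n}{d}\right);$$ 2. $g^{\kappa(q^d-1)}\in\mathfrak M$ for every $g\in\mathcal C_d$. -/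

import Mathlib

noncomputable section

namespace FiniteClassical

universe u v

/-- The data defining a classical group on the `F`-vector space `V`: nothing (linear case), a
nondegenerate alternating form, a quadratic form whose polar form
`Q (u + v) - Q u - Q v` is nondegenerate, or a nondegenerate hermitian form with respect to an
automorphism `θ` of `F` of order exactly two. -/
inductive ClassicalForm (F : Type u) [Field F] (V : Type v) [AddCommGroup V] [Module F V] :
    Type (max u v)
  | linear
  | symplectic (f : V →ₗ[F] V →ₗ[F] F) (alt : ∀ x, f x x = 0) (nondeg : f.Nondegenerate)
  | orthogonal (Q : QuadraticForm F V) (nondeg : (QuadraticMap.polarBilin Q).Nondegenerate)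
  | unitary (θ : F →+* F) (invol : ∀ a, θ (θ a) = a) (ne_id : θ ≠ RingHom.id F)
      (f : V →ₛₗ[θ] V →ₗ[F] F) (herm : ∀ x y, θ (f x y) = f y x) (nondeg : f.Nondegenerate)

variable {F : Type u} [Field F] {V : Type v} [AddCommGroup V] [Module F V]

/-- The linear automorphisms of `V` that preserve a function `φ` of two vectors. -/
def isometriesOf {X : Type u} (φ : V → V → X) : Subgroup (V ≃ₗ[F] V) where
  carrier := {g | ∀ x y, φ (g x) (g y) = φ x y}
  one_mem' := fun _ _ => rfl
  mul_mem' := fun {a b} ha hb x y => (ha (b x) (b y)).trans (hb x y)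
  inv_mem' := fun {a} ha x y => by
    have h := ha (a⁻¹ x) (a⁻¹ y)
    have e : ∀ z, a (a⁻¹ z) = z := fun z => a.apply_symm_apply z
    rw [e, e] at h
    exact h.symm

/-- The linear automorphisms of `V` that preserve the quadratic form `Q`. -/
def orthogonalGroup (Q : QuadraticForm F V) : Subgroup (V ≃ₗ[F] V) where
  carrier := {g | ∀ x, Q (g x) = Q x}
  one_mem' := fun _ => rfl
  mul_mem' := fun {a b} ha hb x => (ha (b x)).trans (hb x)
  inv_mem' := fun {a} ha x => by
    have h := ha (a⁻¹ x)
    have e : ∀ z, a (a⁻¹ z) = z := fun z => a.apply_symm_apply z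
    rw [e] at h
    exact h.symm

/-- The linear automorphisms of `V` of determinant one. -/
def detOne (F : Type u) [Field F] (V : Type v) [AddCommGroup V] [Module F V] :
    Subgroup (V ≃ₗ[F] V) :=
  (LinearEquiv.det : (V ≃ₗ[F] V) →* Fˣ).ker

/-- The full classical group: `GL`, `Sp`, `GO` or `GU`. -/
def GCl : ClassicalForm F V → Subgroup (V ≃ₗ[F] V)
  | .linear => ⊤
  | .symplectic f _ _ => isometriesOf fun x y => f x y
  | .orthogonal Q _ => orthogonalGroup Q
  | .unitary _ _ _ f _ _ => isometriesOf fun x y => f x y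

/-- The special classical group: `SL`, `Sp`, `Ω = SO'` or `SU`. -/
def SCl : ClassicalForm F V → Subgroup (V ≃ₗ[F] V)
  | .linear => detOne F V
  | .symplectic f _ _ => isometriesOf fun x y => f x y
  | .orthogonal Q _ => ⁅orthogonalGroup Q ⊓ detOne F V, orthogonalGroup Q ⊓ detOne F V⁆
  | .unitary _ _ _ f _ _ => (isometriesOf fun x y => f x y) ⊓ detOne F V

/-- The degree of `g` is the rank of `g - 1`. -/
def degree (g : V ≃ₗ[F] V) : ℕ :=
  Module.finrank F (LinearMap.range ((g : V →ₗ[F] V) - LinearMap.id))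

/-- The elements of the special group that have the minimal degree among its nontrivial
elements. -/
def minimalDegreeSet (Γ : ClassicalForm F V) : Set (V ≃ₗ[F] V) :=
  {g | g ∈ SCl Γ ∧ g ≠ 1 ∧ ∀ h ∈ SCl Γ, h ≠ 1 → degree g ≤ degree h}

/-- `2` for orthogonal groups in characteristic two, and `1` for all other groups. -/
def kappa : ClassicalForm F V → ℕ
  | .orthogonal _ _ => if ringChar F = 2 then 2 else 1
  | _ => 1

end FiniteClassical

end

/-!
Write `q` for the order of `F`, and let `E` be the field with `q ^ d` elements. The set of the
theorem consists of all elements whose power with exponent `κ (q ^ d - 1)` has minimal degree, so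
it is invariant under conjugation, and the task is to find many such elements in every fibre over
the abelianisation.

The space `V` is decomposed into `t` copies of `E` and a small rest `U` (for the general linear
group), or into `t` copies of `E`, `t` further copies dual to them under the form, all of them
totally singular, and a rest `U` (for the groups of forms): see `BlockDecomposition` and
`PolarSpace.Splitting`. A tuple `τ` of units of `E` acts on the blocks by multiplication, and on the
dual blocks by the contragredient multiplication; this is the torus element `D.torus (τ, ψ τ)`, and
its power with exponent `q ^ d - 1` is trivial. It is multiplied with an element `w` of the group
that is supported on `U`, has order dividing `N = (q - 1) q ^ 2`, has a prescribed class in the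
abelianisation, and has a power `w ^ (κ (q ^ d - 1))` of minimal degree. The product then has the
required power, and by the choice of `w` it lies in the required fibre.

To count the conjugates of these products, let the entries of `τ` be generators of `E` over `F`
that are pairwise not conjugate over `F`, not conjugate to the entries of `ψ τ`, and not of order
dividing `N`. An element of the centralizer is then determined by its action on the blocks, where it
commutes with `E`, and by its action on `U`, so that the centralizer has at most
`q ^ (d t) * q ^ ((dim U) ^ 2)` elements. The eigenvalues of order not dividing `N` determine `τ` up
to at most `n ^ t` choices. Summing over the conjugacy classes yields
`BlockDecomposition.card_mul_card_le` and, for the fibres,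
`BlockDecomposition.card_mul_card_le_card_fiber`. About `q ^ d / d` classes of generators are
available, so the proportion in each fibre is at least `(q ^ d / (6 d))_t` divided by
`q ^ (d t) * q ^ ((dim U) ^ 2) * n ^ t`, where `(x)_t` is a falling factorial. As `t` is at most
`n / d` and `dim U` is of the order of `d`, the estimate `exp_le_div_of_descFactorial_le` gives the
bound.

It remains to find `w` on a rest of bounded dimension, for which the abelianisation has to be
understood.

* In the linear, symplectic and unitary cases there are transvections in `SCl`, and they have degree
  one. The element `w` is the product of a transvection, whose class is trivial, and a commuting
  element of order dividing `q - 1`: a dilatation for `GL`, nothing for `Sp`, and a quasi-reflection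
  along a vector `a` with `f a a = 1` for `GU`. These represent every class since the groups are
  generated by dilatations, transvections and quasi-reflections; see `fibreBound_linear`,
  `fibreBound_symplectic` and `fibreBound_unitary`.
* In an orthogonal group the degree modulo two is a homomorphism, because the group is generated by
  reflections and a reflection changes the degree by exactly one (`degree_refl_mul`,
  `cast_degree_mul`). Hence `Ω` contains no element of degree one, and the Siegel transformations,
  which are commutators of degree two, have minimal degree. The classes of two reflections generate
  the abelianisation (`exists_of_eq_refl_pow`), so `w` is the product of a unipotent element of the
  derived subgroup and reflections in hyperbolic planes orthogonal to it
  (`exists_rep_orthogonal`). In even characteristic the reflections disappear only from even powers,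
  whence `κ = 2`; the unipotent element is then taken of order four with a Siegel transformation as
  its square (`exists_unipotent_orthogonal`).
-/

namespace FiniteClassical

open Polynomial

/-! ### Counting elements through centralizers -/

/-- If a finite family `x` of group elements has all its conjugates in `A`, all its centralizers of
order at most `c`, and meets each conjugacy class at most `k` times, then `A` is large: the fibres
of `(τ, h) ↦ h * x τ * h⁻¹` have at most `c * k` elements. -/
theorem card_mul_card_le_card_mul {G T : Type*} [Group G] [Finite G] [Finite T] (x : T → G)
    (A : Set G) (hA : ∀ τ h, h * x τ * h⁻¹ ∈ A) (c k : ℕ)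
    (hc : ∀ τ, Nat.card {y : G // y * x τ = x τ * y} ≤ c)
    (hk : ∀ τ, Nat.card {τ' : T // IsConj (x τ') (x τ)} ≤ k) :
    Nat.card T * Nat.card G ≤ Nat.card A * (c * k) := by
  classical
  have := Fintype.ofFinite G
  have := Fintype.ofFinite T
  have hfib : ∀ b : G, ∀ τ : T,
      (Finset.univ.filter fun h : G => h * x τ * h⁻¹ = b).card ≤ c := by
    intro b τ
    rcases (Finset.univ.filter fun h : G => h * x τ * h⁻¹ = b).eq_empty_or_nonempty with h0 | ⟨h1, h1m⟩
    · rw [h0]; simp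
    · refine le_trans ?_ (hc τ)
      rw [Nat.card_eq_fintype_card, Fintype.card_subtype]
      refine Finset.card_le_card_of_injOn (fun h => h1⁻¹ * h) ?_ ?_
      · intro h hh
        simp only [Finset.coe_filter, Finset.mem_univ, true_and, Set.mem_ofPred_eq,
          Finset.mem_filter] at hh h1m ⊢
        have e : h * x τ = b * h := by rw [← hh]; group
        have e1 : h1⁻¹ * b = x τ * h1⁻¹ := by rw [← h1m]; group
        calc h1⁻¹ * h * x τ = (h1⁻¹ * b) * h := by rw [mul_assoc, e, mul_assoc]
          _ = x τ * (h1⁻¹ * h) := by rw [e1, mul_assoc]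
      · intro a _ b _ hab
        exact mul_left_cancel hab
  have key := Finset.card_le_mul_card_image_of_maps_to (s := (Finset.univ : Finset (T × G)))
    (t := A.toFinite.toFinset) (f := fun p => p.2 * x p.1 * p.2⁻¹)
    (fun p _ => by simpa using hA p.1 p.2) (c * k) (by
      intro b _
      rcases (Finset.univ.filter fun p : T × G => p.2 * x p.1 * p.2⁻¹ = b).eq_empty_or_nonempty
        with h0 | ⟨⟨τ0, h0⟩, hm⟩
      · rw [h0]; simp
      · simp only [Finset.mem_filter, Finset.mem_univ, true_and] at hm
        have h2 := Finset.card_le_mul_card_image_of_maps_to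
          (s := Finset.univ.filter fun p : T × G => p.2 * x p.1 * p.2⁻¹ = b)
          (t := Finset.univ.filter fun τ' => IsConj (x τ') (x τ0)) (f := Prod.fst)
          (by
            rintro ⟨τ, h⟩ hp
            simp only [Finset.mem_filter, Finset.mem_univ, true_and] at hp ⊢
            rw [isConj_iff]
            refine ⟨h0⁻¹ * h, ?_⟩
            have : h0⁻¹ * b * h0 = x τ0 := by rw [← hm]; group
            rw [← this, ← hp]; group) c
          (by
            intro τ _
            refine le_trans ?_ (hfib b τ)
            refine Finset.card_le_card_of_injOn Prod.snd ?_ ?_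
            · rintro ⟨τ', h⟩ hp
              simp only [Finset.coe_filter, Finset.mem_filter, Finset.mem_univ, true_and,
                Set.mem_ofPred_eq] at hp ⊢
              rw [← hp.1, hp.2]
            · rintro ⟨τ1, h1⟩ hp1 ⟨τ2, h2⟩ hp2 h12
              simp only [Finset.coe_filter, Finset.mem_filter, Finset.mem_univ, true_and,
                Set.mem_ofPred_eq] at hp1 hp2 h12
              rw [hp1.2, hp2.2, h12])
        refine h2.trans (Nat.mul_le_mul_left c ?_)
        have := hk τ0
        rwa [Nat.card_eq_fintype_card, Fintype.card_subtype] at this)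
  rw [Finset.card_univ, Fintype.card_prod, ← Nat.card_eq_fintype_card, ← Nat.card_eq_fintype_card]
    at key
  rwa [Nat.card_coe_set_eq, Set.ncard_eq_toFinset_card A A.toFinite, mul_comm (Finset.card _)]

section Centralizer

variable {F : Type*} [Field F] {E : Type*} [Field E] [Algebra F E]
  {V : Type*} [AddCommGroup V] [Module F V]

theorem aeval_apply_of_commute {x y : V →ₗ[F] V} (h : y * x = x * y) (p : F[X]) (v : V) :
    aeval x p (y v) = y (aeval x p v) := by
  have hc : Commute y (aeval x p) := by
    induction p using Polynomial.induction_on' with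
    | add p q hp hq => rw [map_add]; exact hp.add_right hq
    | monomial n a =>
      rw [aeval_monomial]
      exact Commute.mul_right (Algebra.commutes a y).symm (Commute.pow_right h n)
  exact (DFunLike.congr_fun hc.eq v).symm

/-- A map that acts on `ι (J → E)` by multiplication with `τ` lets a polynomial act there by
multiplication with its values at the `τ i`. -/
theorem aeval_apply_torus {J : Type*} {ι : (J → E) →ₗ[F] V} {x : V →ₗ[F] V} {τ : J → E}
    (hx : ∀ m, x (ι m) = ι (τ * m)) (p : F[X]) (m : J → E) :
    aeval x p (ι m) = ι (fun i => aeval (τ i) p * m i) := by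
  induction p using Polynomial.induction_on' with
  | add p q hp hq =>
    rw [map_add, LinearMap.add_apply, hp, hq, ← map_add]
    congr 1; ext i; simp [add_mul]
  | monomial n a =>
    have hpow : ∀ k : ℕ, (x ^ k) (ι m) = ι (τ ^ k * m) := by
      intro k
      induction k with
      | zero => simp
      | succ k ih => rw [pow_succ', Module.End.mul_apply, ih, hx, pow_succ', mul_assoc]
    rw [aeval_monomial, Module.End.mul_apply, hpow, Module.algebraMap_end_apply, ← map_smul]
    congr 1; ext i; simp [aeval_monomial, Algebra.smul_def, mul_assoc]

/-- An upper bound for the number of elements of a set `S` that commute with `x`. Here `x` acts on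
`ι (Fin t → E)` by multiplication with generators `τ i` of `E`, each of the `t` blocks is the kernel
of a polynomial in `x`, and elements of `S` are determined by their restrictions to
`ι (Fin t → E)` and to the fixed space `U` of a power of `x`. -/
theorem card_commuting_le [Finite F] [Finite E] [FiniteDimensional F V] {t : ℕ}
    {ι : (Fin t → E) →ₗ[F] V} {x : V ≃ₗ[F] V} {τ : Fin t → E}
    (hx : ∀ m, x (ι m) = ι (τ * m)) (hgen : ∀ i z, ∃ p : F[X], aeval (τ i) p = z)
    {μ : Fin t → F[X]} (hμ : ∀ i, aeval (τ i) (μ i) = 0)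
    (hker : ∀ i v, aeval (x : V →ₗ[F] V) (μ i) v = 0 → ∃ z : E, v = ι (Pi.single i z))
    {U : Submodule F V} {N : ℕ} (hU : ∀ v, v ∈ U ↔ (x ^ N) v = v)
    {S : Set (V ≃ₗ[F] V)} (hcomm : ∀ y ∈ S, y * x = x * y)
    (hdet : ∀ y₁ ∈ S, ∀ y₂ ∈ S, (∀ m, y₁ (ι m) = y₂ (ι m)) → (∀ u ∈ U, y₁ u = y₂ u) → y₁ = y₂) :
    Nat.card S ≤ Nat.card E ^ t * Nat.card F ^ (Module.finrank F U) ^ 2 := by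
  classical
  set k := Module.finrank F U
  let b := Module.finBasis F U
  have hcommL : ∀ y ∈ S, (y : V →ₗ[F] V) * (x : V →ₗ[F] V) = (x : V →ₗ[F] V) * (y : V →ₗ[F] V) := by
    intro y hy
    have := hcomm y hy
    ext v
    exact DFunLike.congr_fun this v
  have h1 : ∀ y ∈ S, ∀ i, ∃ z : E, y (ι (Pi.single i 1)) = ι (Pi.single i z) := by
    intro y hy i
    apply hker
    have := aeval_apply_of_commute (hcommL y hy) (μ i) (ι (Pi.single i 1))
    rw [LinearEquiv.coe_coe] at this
    rw [this, aeval_apply_torus (x := (x : V →ₗ[F] V)) hx]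
    have e : (fun j => aeval (τ j) (μ i) * (Pi.single i 1 : Fin t → E) j) = 0 := by
      ext j
      rcases eq_or_ne j i with rfl | hj
      · simp [hμ]
      · simp [hj]
    rw [e]; simp
  have h2 : ∀ y ∈ S, ∀ u : U, y u ∈ U := by
    intro y hy u
    rw [hU]
    have hp : x ^ N * y = y * x ^ N := ((Commute.pow_right (hcomm y hy : Commute y x) N).eq).symm
    have := DFunLike.congr_fun hp (u : V)
    rw [LinearEquiv.mul_apply, LinearEquiv.mul_apply, (hU u).1 u.2] at this
    exact this
  choose z hz using h1
  let Ψ : S → (Fin t → E) × (Fin k → U) := fun y =>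
    (fun i => z y.1 y.2 i, fun j => ⟨y.1 (b j), h2 y.1 y.2 (b j)⟩)
  have hinj : Function.Injective Ψ := by
    rintro ⟨y₁, hy₁⟩ ⟨y₂, hy₂⟩ h
    simp only [Ψ, Prod.mk.injEq] at h
    obtain ⟨ha, hb⟩ := h
    have hU' : ∀ u ∈ U, y₁ u = y₂ u := by
      have : (y₁ : V →ₗ[F] V).comp U.subtype = (y₂ : V →ₗ[F] V).comp U.subtype := by
        apply b.ext
        intro j
        have := congrFun hb j
        simpa using congrArg Subtype.val this
      intro u hu
      exact DFunLike.congr_fun this ⟨u, hu⟩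
    have hsingle : ∀ i (e : E), y₁ (ι (Pi.single i e)) = y₂ (ι (Pi.single i e)) := by
      intro i e
      obtain ⟨p, rfl⟩ := hgen i e
      have e1 : ι (Pi.single i (aeval (τ i) p)) = aeval (x : V →ₗ[F] V) p (ι (Pi.single i 1)) := by
        rw [aeval_apply_torus (x := (x : V →ₗ[F] V)) hx]
        congr 1
        ext j
        rcases eq_or_ne j i with rfl | hj
        · simp
        · simp [hj]
      have c1 := aeval_apply_of_commute (hcommL y₁ hy₁) p (ι (Pi.single i 1))
      have c2 := aeval_apply_of_commute (hcommL y₂ hy₂) p (ι (Pi.single i 1))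
      simp only [LinearEquiv.coe_coe] at c1 c2
      rw [e1, ← c1, ← c2, hz y₁ hy₁, hz y₂ hy₂, congrFun ha i]
    have hM : ∀ m, y₁ (ι m) = y₂ (ι m) := by
      intro m
      rw [← Finset.univ_sum_single m, map_sum, map_sum, map_sum]
      exact Finset.sum_congr rfl fun i _ => hsingle i (m i)
    exact Subtype.ext (hdet y₁ hy₁ y₂ hy₂ hM hU')
  have := Module.finite_of_finite F (M := U)
  refine (Nat.card_le_card_of_injective Ψ hinj).trans (le_of_eq ?_)
  rw [Nat.card_prod, Nat.card_fun, Nat.card_fun, Nat.card_fin, Nat.card_fin,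
    Module.natCard_eq_pow_finrank (K := F) (V := U), ← pow_mul, sq]

theorem aeval_charpoly_torus_eq_zero [FiniteDimensional F V] {J : Type*}
    {ι : (J → E) →ₗ[F] V} (hι : Function.Injective ι) {x : V ≃ₗ[F] V} {τ : J → E}
    (hx : ∀ m, x (ι m) = ι (τ * m)) (i : J) : aeval (τ i) (x : V →ₗ[F] V).charpoly = 0 := by
  classical
  have h := LinearMap.aeval_self_charpoly (x : V →ₗ[F] V)
  have h1 := aeval_apply_torus (x := (x : V →ₗ[F] V)) hx (x : V →ₗ[F] V).charpoly (Pi.single i 1)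
  rw [h, LinearMap.zero_apply] at h1
  have := congrFun (hι (h1.symm.trans (map_zero ι).symm)) i
  simpa using this

/-- In a family of elements that act on `ι (Fin t → E)` by multiplication with distinct tuples, few
members are conjugate to each other, since the entries of the tuple are roots of the characteristic
polynomial. -/
theorem card_conj_torus_le [FiniteDimensional F V] [Finite E] {t : ℕ}
    {ι : (Fin t → E) →ₗ[F] V} (hι : Function.Injective ι) {T : Type*}
    (G : Subgroup (V ≃ₗ[F] V)) (x : T → G) (τ : T → Fin t → E) (hτ : Function.Injective τ)
    (hx : ∀ s m, (x s : V ≃ₗ[F] V) (ι m) = ι (τ s * m)) (s : T) :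
    Nat.card {s' : T // IsConj (x s') (x s)} ≤ Module.finrank F V ^ t := by
  classical
  set χ := ((x s : V ≃ₗ[F] V) : V →ₗ[F] V).charpoly
  have hroot : ∀ s', IsConj (x s') (x s) → ∀ i, τ s' i ∈ χ.rootSet E := by
    intro s' hs i
    obtain ⟨h, hh⟩ := isConj_iff.1 hs
    have hχ : χ = ((x s' : V ≃ₗ[F] V) : V →ₗ[F] V).charpoly := by
      have e : ((x s : V ≃ₗ[F] V) : V →ₗ[F] V)
          = (h : V ≃ₗ[F] V).conj ((x s' : V ≃ₗ[F] V) : V →ₗ[F] V) := by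
        rw [← hh]; ext v; rfl
      simp only [χ]
      rw [e, LinearEquiv.charpoly_conj]
    rw [mem_rootSet]
    refine ⟨(LinearMap.charpoly_monic _).ne_zero, ?_⟩
    rw [hχ]
    exact aeval_charpoly_torus_eq_zero hι (hx s') i
  let Ψ : {s' : T // IsConj (x s') (x s)} → (Fin t → χ.rootSet E) :=
    fun s' i => ⟨τ s'.1 i, hroot s'.1 s'.2 i⟩
  have hinj : Function.Injective Ψ := by
    intro a b hab
    refine Subtype.ext (hτ (funext fun i => ?_))
    exact congrArg Subtype.val (congrFun hab i)
  refine (Nat.card_le_card_of_injective Ψ hinj).trans ?_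
  rw [Nat.card_fun, Nat.card_fin]
  refine Nat.pow_le_pow_left ?_ t
  rw [← LinearMap.charpoly_natDegree ((x s : V ≃ₗ[F] V) : V →ₗ[F] V), Nat.card_coe_set_eq]
  exact ncard_rootSet_le _ _

end Centralizer

end FiniteClassical

namespace FiniteClassical

open Polynomial

/-! ### Generators of a finite field in general position -/

section TorusParameters

variable {F : Type*} [Field F] {E : Type*} [Field E] [Algebra F E]

theorem pow_card_pow_finrank [Finite E] (z : E) : z ^ Nat.card F ^ Module.finrank F E = z := by
  have := Fintype.ofFinite E
  rw [← Module.natCard_eq_pow_finrank (K := F) (V := E), Nat.card_eq_fintype_card]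
  exact FiniteField.pow_card z

/-- An element that does not generate `E` lies in a subfield of degree at most half of that
of `E`. -/
theorem exists_pow_eq_one_of_natDegree_minpoly_lt [Finite F] [Finite E] {z : E} (hz : z ≠ 0)
    (h : (minpoly F z).natDegree ≠ Module.finrank F E) :
    ∃ j, 1 ≤ j ∧ 2 * j ≤ Module.finrank F E ∧ z ^ (Nat.card F ^ j - 1) = 1 := by
  have hint : IsIntegral F z := IsIntegral.of_finite F z
  set K := IntermediateField.adjoin F {z}
  have hK : Module.finrank F K = (minpoly F z).natDegree :=
    IntermediateField.adjoin.finrank hint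
  set e := (minpoly F z).natDegree
  have he : 1 ≤ e := minpoly.natDegree_pos hint
  have hmul : Module.finrank F K * Module.finrank K E = Module.finrank F E :=
    Module.finrank_mul_finrank F K E
  rw [hK] at hmul
  refine ⟨e, he, ?_, ?_⟩
  · have h0 : Module.finrank K E ≠ 0 := Module.finrank_pos.ne'
    have h1 : Module.finrank K E ≠ 1 := by
      intro h1; rw [h1, mul_one] at hmul; exact h hmul
    have h2 : 2 ≤ Module.finrank K E := by omega
    calc 2 * e = e * 2 := mul_comm _ _
      _ ≤ e * Module.finrank K E := Nat.mul_le_mul_left e h2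
      _ = _ := hmul
  · have hp := pow_card_pow_finrank (F := F)
      (⟨z, IntermediateField.mem_adjoin_simple_self F z⟩ : K)
    rw [hK] at hp
    have hp' : z ^ Nat.card F ^ e = z := congrArg Subtype.val hp
    have h1 : 1 ≤ Nat.card F ^ e := Nat.one_le_pow _ _ Nat.card_pos
    have : z ^ (Nat.card F ^ e - 1) * z = 1 * z := by
      rw [← pow_succ, Nat.sub_add_cancel h1, hp', one_mul]
    exact mul_right_cancel₀ hz this

theorem exists_pow_of_aeval_minpoly [Finite F] [Finite E] {z w : E} (h : aeval w (minpoly F z) = 0) :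
    ∃ k < Module.finrank F E, w = z ^ Nat.card F ^ k := by
  have := Fintype.ofFinite F
  have hint : IsIntegral F z := IsIntegral.of_finite F z
  have hc : IsConjRoot F z w := (isConjRoot_iff_aeval_eq_zero hint).2 h
  obtain ⟨σ, hσ⟩ := isConjRoot_iff_exists_algEquiv.1 hc.symm
  obtain ⟨⟨k, hk⟩, rfl⟩ := (FiniteField.bijective_frobeniusAlgEquivOfAlgebraic_pow F E).2 σ
  refine ⟨k, hk, ?_⟩
  rw [← hσ, AlgEquiv.coe_pow, FiniteField.coe_frobeniusAlgEquivOfAlgebraic_iterate,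
    Nat.card_eq_fintype_card]

/-- If the inverse of `z ^ s` is a conjugate of `z`, then `z` has small multiplicative order. Here
`z ↦ z ^ s` is the identity of `E` or extends the automorphism of order two of `F`. -/
theorem exists_pow_add_one_eq_one_of_conj [Finite F] [Finite E] {s : ℕ} (hs : s = 1 ∨ s ^ 2 = Nat.card F)
    (hinj : ∀ z : E, z ^ s = 1 → z = 1) {z : E} (hz : z ≠ 0)
    (h : aeval (z ^ s)⁻¹ (minpoly F z) = 0) :
    ∃ j ≤ Module.finrank F E,
      ((if s = 1 then Nat.card F else s) ^ j) ^ 2 ≤ Nat.card F ^ Module.finrank F E ∧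
      z ^ ((if s = 1 then Nat.card F else s) ^ j + 1) = 1 := by
  obtain ⟨k, hk, hzk⟩ := exists_pow_of_aeval_minpoly h
  set d := Module.finrank F E
  set q := Nat.card F
  have hq : 1 < q := Finite.one_lt_card
  have hzs : z ^ s ≠ 0 := pow_ne_zero _ hz
  have h1 : z ^ (q ^ k + s) = 1 := by
    rw [pow_add, ← hzk, inv_mul_cancel₀ hzs]
  -- the same relation, carried over by the `(d - k)`-th power of the Frobenius map
  have h2 : z ^ (s * q ^ (d - k) + 1) = 1 := by
    have e : (z ^ (q ^ k + s)) ^ q ^ (d - k) = z ^ (s * q ^ (d - k) + 1) := by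
      rw [← pow_mul, add_mul, ← pow_add, Nat.add_sub_cancel' hk.le, pow_add, pow_add, pow_one,
        pow_card_pow_finrank, mul_comm]
    rw [← e, h1, one_pow]
  rcases hs with hs | hs
  · subst hs
    simp only [if_true]
    rcases le_or_gt (2 * k) d with hkd | hkd
    · refine ⟨k, hk.le, ?_, h1⟩
      rw [← pow_mul, mul_comm]
      exact Nat.pow_le_pow_right hq.le hkd
    · refine ⟨d - k, Nat.sub_le _ _, ?_, by simpa using h2⟩
      rw [← pow_mul, mul_comm]
      exact Nat.pow_le_pow_right hq.le (by omega)
  · have hs1 : s ≠ 1 := by rintro rfl; omega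
    have hs0 : 1 ≤ s := by
      rcases Nat.eq_zero_or_pos s with rfl | h
      · simp at hs; omega
      · exact h
    rw [if_neg hs1]
    have hd1 : 0 < d := Module.finrank_pos
    have hle : ∀ j, j ≤ d → (s ^ j) ^ 2 ≤ q ^ d := by
      intro j hj
      rw [← pow_mul, mul_comm, pow_mul, hs]
      exact Nat.pow_le_pow_right hq.le hj
    rcases Nat.eq_zero_or_pos k with rfl | hk0
    · exact ⟨1, hd1, hle 1 hd1, by rw [pow_one, add_comm]; simpa using h1⟩
    rcases le_or_gt (2 * k - 1) d with hkd | hkd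
    · refine ⟨2 * k - 1, hkd, hle _ hkd, hinj _ ?_⟩
      rw [← pow_mul, add_mul, one_mul, ← pow_succ, Nat.sub_add_cancel (by omega), pow_mul, hs]
      exact h1
    · refine ⟨2 * (d - k) + 1, by omega, hle _ (by omega), ?_⟩
      rw [pow_succ s, pow_mul s, hs, mul_comm]
      exact h2

theorem card_filter_pow_eq_one_le [DecidableEq E] [Fintype E] {k : ℕ} (hk : 0 < k) :
    (Finset.univ.filter fun z : E => z ^ k = 1).card ≤ k := by
  refine le_trans (Finset.card_le_card (t := (nthRoots k (1 : E)).toFinset) ?_)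
    ((Multiset.toFinset_card_le _).trans (card_nthRoots k 1))
  intro z hz
  simp only [Finset.mem_filter, Finset.mem_univ, true_and] at hz
  simp [mem_nthRoots hk, hz]

theorem eight_mul_add_sq_le {Y d : ℕ} (h2 : 2 ^ d ≤ Y) (hY : 2 ^ 16 ≤ Y) : (8 * d + 12) ^ 2 ≤ Y := by
  rcases le_or_gt d 16 with h | h
  · refine le_trans ?_ hY
    calc (8 * d + 12) ^ 2 ≤ (8 * 16 + 12) ^ 2 := Nat.pow_le_pow_left (by omega) 2
      _ ≤ 2 ^ 16 := by norm_num
  · refine le_trans ?_ h2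
    clear h2 hY
    induction d, h using Nat.le_induction with
    | base => norm_num
    | succ d hd ih =>
      rw [pow_succ 2 d]
      have : 17 ≤ d := hd
      nlinarith

theorem exists_finset_generators_half [Finite F] [Finite E] [DecidableEq E] {s : ℕ} (hs : s = 1 ∨ s ^ 2 = Nat.card F)
    (hinj : ∀ z : E, z ^ s = 1 → z = 1)
    (hY : 2 ^ 16 ≤ Nat.card F ^ Module.finrank F E) :
    ∃ A : Finset E, Nat.card F ^ Module.finrank F E ≤ 2 * A.card ∧ (0 : E) ∉ A ∧
      (∀ z ∈ A, (minpoly F z).natDegree = Module.finrank F E) ∧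
      ∀ z ∈ A, aeval (z ^ s)⁻¹ (minpoly F z) ≠ 0 := by
  classical
  have := Fintype.ofFinite E
  set d := Module.finrank F E
  set q := Nat.card F
  set Y := q ^ d
  set r := if s = 1 then q else s
  have hq : 1 < q := Finite.one_lt_card
  set m := Nat.sqrt Y
  have hm : m * m ≤ Y := Nat.sqrt_le Y
  let B₁ := (Finset.range (d + 1)).biUnion fun j =>
    if 1 ≤ j ∧ (q ^ j) ^ 2 ≤ Y then Finset.univ.filter fun z : E => z ^ (q ^ j - 1) = 1 else ∅
  let B₂ := (Finset.range (d + 1)).biUnion fun j =>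
    if (r ^ j) ^ 2 ≤ Y then Finset.univ.filter fun z : E => z ^ (r ^ j + 1) = 1 else ∅
  have hB₁ : B₁.card ≤ (d + 1) * (m + 1) := by
    refine (Finset.card_biUnion_le_card_mul _ _ (m + 1) ?_).trans (by rw [Finset.card_range])
    intro j _
    split_ifs with h
    · have h1 : 1 < q ^ j := Nat.one_lt_pow (by omega) hq
      have h3 : q ^ j ≤ m := Nat.le_sqrt'.2 h.2
      exact (card_filter_pow_eq_one_le (by omega)).trans (by omega)
    · simp
  have hB₂ : B₂.card ≤ (d + 1) * (m + 1) := by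
    refine (Finset.card_biUnion_le_card_mul _ _ (m + 1) ?_).trans (by rw [Finset.card_range])
    intro j _
    split_ifs with h
    · have h3 : r ^ j ≤ m := Nat.le_sqrt'.2 h
      exact (card_filter_pow_eq_one_le (by omega)).trans (by omega)
    · simp
  refine ⟨Finset.univ \ (insert 0 (B₁ ∪ B₂)), ?_, ?_, ?_, ?_⟩
  · have h1 : (insert 0 (B₁ ∪ B₂)).card ≤ 2 * ((d + 1) * (m + 1)) + 1 := by
      refine (Finset.card_insert_le _ _).trans ?_
      have := Finset.card_union_le B₁ B₂
      omega
    have h2 := Finset.card_sdiff_add_card_eq_card (Finset.subset_univ (insert 0 (B₁ ∪ B₂)))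
    have h3 : (Finset.univ : Finset E).card = Y := by
      rw [Finset.card_univ, ← Nat.card_eq_fintype_card, Module.natCard_eq_pow_finrank (K := F)]
    have h4 : (8 * d + 12) ^ 2 ≤ Y :=
      eight_mul_add_sq_le (Nat.pow_le_pow_left hq d) hY
    have h5 : 8 * d + 12 ≤ m := Nat.le_sqrt'.2 h4
    have h6 : (8 * d + 12) * m ≤ m * m := Nat.mul_le_mul_right m h5
    nlinarith
  · simp
  · intro z hz
    simp only [Finset.mem_sdiff, Finset.mem_univ, true_and, Finset.mem_insert, Finset.mem_union,
      not_or] at hz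
    by_contra h
    obtain ⟨j, hj1, hj2, hj3⟩ := exists_pow_eq_one_of_natDegree_minpoly_lt hz.1 h
    refine hz.2.1 (Finset.mem_biUnion.2 ⟨j, Finset.mem_range.2 (by omega), ?_⟩)
    rw [if_pos ⟨hj1, by rw [← pow_mul, mul_comm]; exact Nat.pow_le_pow_right hq.le hj2⟩]
    simpa using hj3
  · intro z hz h
    simp only [Finset.mem_sdiff, Finset.mem_univ, true_and, Finset.mem_insert, Finset.mem_union,
      not_or] at hz
    obtain ⟨j, hj1, hj2, hj3⟩ := exists_pow_add_one_eq_one_of_conj hs hinj hz.1 h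
    refine hz.2.2 (Finset.mem_biUnion.2 ⟨j, Finset.mem_range.2 (by omega), ?_⟩)
    rw [if_pos hj2]
    exact Finset.mem_filter.2 ⟨Finset.mem_univ _, hj3⟩

theorem card_rootSet_minpoly_le [Finite E] (z : E) :
    ((minpoly F z).rootSet E).toFinite.toFinset.card ≤ Module.finrank F E := by
  rw [← Set.ncard_eq_toFinset_card]
  exact (ncard_rootSet_le _ _).trans (minpoly.natDegree_le z)

theorem mem_rootSet_minpoly [Finite E] {z w : E} :
    w ∈ ((minpoly F z).rootSet E).toFinite.toFinset ↔ aeval w (minpoly F z) = 0 := by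
  rw [Set.Finite.mem_toFinset, mem_rootSet]
  exact ⟨fun h => h.2, fun h => ⟨minpoly.ne_zero (IsIntegral.of_finite F z), h⟩⟩

theorem aeval_minpoly_comm [Finite E] {z w : E} (h : aeval w (minpoly F z) = 0) :
    aeval z (minpoly F w) = 0 :=
  ((isConjRoot_iff_aeval_eq_zero (IsIntegral.of_finite F z)).2 h).symm.aeval_eq_zero

/-- There are about `|E| / (6 d)` generators of `E` such that no two of them, and none of them and
the image of one of them under `z ↦ (z ^ s)⁻¹`, are conjugate over `F`. -/
theorem exists_finset_generators [Finite F] [Finite E] {s : ℕ} (hs : s = 1 ∨ s ^ 2 = Nat.card F)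
    (hinj : ∀ z w : E, z ^ s = w ^ s → z = w)
    (hY : 2 ^ 16 ≤ Nat.card F ^ Module.finrank F E) (r : ℕ)
    (hr : 6 * Module.finrank F E * r ≤ Nat.card F ^ Module.finrank F E) :
    ∃ R : Finset E, R.card = r ∧
      (∀ a ∈ R, a ≠ 0 ∧ (minpoly F a).natDegree = Module.finrank F E) ∧
      (∀ a ∈ R, ∀ b ∈ R, a ≠ b → aeval b (minpoly F a) ≠ 0) ∧
      ∀ a ∈ R, ∀ b ∈ R, aeval (b ^ s)⁻¹ (minpoly F a) ≠ 0 := by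
  classical
  have := Fintype.ofFinite E
  obtain ⟨A, hA, hA0, hA1, hA2⟩ := exists_finset_generators_half hs
    (fun z h => hinj z 1 (by rw [h, one_pow])) hY
  set d := Module.finrank F E
  have hψ : Function.Injective fun z : E => (z ^ s)⁻¹ := fun z w h => hinj z w (inv_injective h)
  suffices h : ∀ r, 3 * d * r ≤ A.card → ∃ R ⊆ A, R.card = r ∧
      (∀ a ∈ R, ∀ b ∈ R, a ≠ b → aeval b (minpoly F a) ≠ 0) ∧
      ∀ a ∈ R, ∀ b ∈ R, aeval (b ^ s)⁻¹ (minpoly F a) ≠ 0 by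
    obtain ⟨R, hRA, hc, h1, h2⟩ := h r (by nlinarith)
    exact ⟨R, hc, fun a ha => ⟨fun h => hA0 (h ▸ hRA ha), hA1 a (hRA ha)⟩, h1, h2⟩
  clear hr r
  intro r
  induction r with
  | zero => intro _; exact ⟨∅, by simp⟩
  | succ r ih =>
    intro hr
    obtain ⟨R, hRA, hRc, hR1, hR2⟩ := ih (by nlinarith)
    let rt : E → Finset E := fun z => ((minpoly F z).rootSet E).toFinite.toFinset
    let B := R.biUnion fun a => (rt a ∪ rt (a ^ s)⁻¹) ∪
      Finset.univ.filter fun z => (z ^ s)⁻¹ ∈ rt a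
    have hd : 0 < d := Module.finrank_pos
    have hB : B.card ≤ r * (3 * d) := by
      rw [← hRc]
      refine Finset.card_biUnion_le_card_mul _ _ _ fun a _ => ?_
      have h1 := card_rootSet_minpoly_le (F := F) a
      have h2 := card_rootSet_minpoly_le (F := F) (a ^ s)⁻¹
      have h3 : (Finset.univ.filter fun z => (z ^ s)⁻¹ ∈ rt a).card ≤ d := by
        refine (Finset.card_le_card_of_injOn (fun z => (z ^ s)⁻¹) ?_ hψ.injOn).trans h1
        intro z hz
        exact (Finset.mem_filter.1 hz).2
      have h4 := Finset.card_union_le (rt a ∪ rt (a ^ s)⁻¹)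
        (Finset.univ.filter fun z => (z ^ s)⁻¹ ∈ rt a)
      have h5 := Finset.card_union_le (rt a) (rt (a ^ s)⁻¹)
      simp only [rt] at h4 h5 h3 ⊢
      omega
    have hlt : B.card < A.card := by nlinarith
    obtain ⟨z, hzA, hzB⟩ := Finset.exists_mem_notMem_of_card_lt_card hlt
    have hzB' : ∀ a ∈ R, aeval z (minpoly F a) ≠ 0 ∧ aeval z (minpoly F (a ^ s)⁻¹) ≠ 0 ∧
        aeval (z ^ s)⁻¹ (minpoly F a) ≠ 0 := by
      intro a ha
      simp only [B, Finset.mem_biUnion, not_exists, not_and, Finset.mem_union, not_or,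
        Finset.mem_filter, Finset.mem_univ, true_and, rt, mem_rootSet_minpoly] at hzB
      have := hzB a ha
      exact ⟨this.1.1, this.1.2, this.2⟩
    have hzR : z ∉ R := fun h => (hzB' z h).1 (minpoly.aeval F z)
    refine ⟨insert z R, ?_, ?_, ?_, ?_⟩
    · exact Finset.insert_subset hzA hRA
    · rw [Finset.card_insert_of_notMem hzR, hRc]
    · intro a ha b hb hab
      rw [Finset.mem_insert] at ha hb
      rcases ha with rfl | ha <;> rcases hb with rfl | hb
      · exact absurd rfl hab
      · exact fun h => (hzB' b hb).1 (aeval_minpoly_comm h)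
      · exact (hzB' a ha).1
      · exact hR1 a ha b hb hab
    · intro a ha b hb
      rw [Finset.mem_insert] at ha hb
      rcases ha with rfl | ha <;> rcases hb with rfl | hb
      · exact hA2 _ hzA
      · exact fun h => (hzB' b hb).2.1 (aeval_minpoly_comm h)
      · exact (hzB' a ha).2.2
      · exact hR2 a ha b hb

end TorusParameters

end FiniteClassical

namespace FiniteClassical

open Polynomial

/-! ### Block decompositions and the size of the union of conjugacy classes -/

section Blocks

variable {F : Type*} [Field F] {E : Type*} [Field E] [Algebra F E]
  {V : Type*} [AddCommGroup V] [Module F V]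

/-- A decomposition `V = ι₁ (J₁ → E) ⊕ ι₂ (J₂ → E) ⊕ U`, given by the two embeddings and the
projections `p₁`, `p₂` onto the first two summands; the third one is `U = ker p₁ ⊓ ker p₂`. -/
structure BlockDecomposition (F E V J₁ J₂ : Type*) [Field F] [Field E] [Algebra F E]
    [AddCommGroup V] [Module F V] where
  ι₁ : (J₁ → E) →ₗ[F] V
  ι₂ : (J₂ → E) →ₗ[F] V
  p₁ : V →ₗ[F] (J₁ → E)
  p₂ : V →ₗ[F] (J₂ → E)
  p₁_ι₁ : ∀ m, p₁ (ι₁ m) = m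
  p₂_ι₂ : ∀ m, p₂ (ι₂ m) = m
  p₁_ι₂ : ∀ m, p₁ (ι₂ m) = 0
  p₂_ι₁ : ∀ m, p₂ (ι₁ m) = 0

namespace BlockDecomposition

variable {J₁ J₂ : Type*} (D : BlockDecomposition F E V J₁ J₂)

/-- The third summand of a block decomposition. -/
def rest : Submodule F V := LinearMap.ker D.p₁ ⊓ LinearMap.ker D.p₂

theorem mem_rest {v : V} : v ∈ D.rest ↔ D.p₁ v = 0 ∧ D.p₂ v = 0 := by
  simp [rest]

theorem sub_mem_rest (v : V) : v - D.ι₁ (D.p₁ v) - D.ι₂ (D.p₂ v) ∈ D.rest := by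
  rw [mem_rest]
  simp [D.p₁_ι₁, D.p₂_ι₂, D.p₁_ι₂, D.p₂_ι₁]

theorem ι₁_injective : Function.Injective D.ι₁ :=
  Function.LeftInverse.injective D.p₁_ι₁

/-- `x` acts on the three summands by multiplication with `τ`, by multiplication with `σ`, and by
an element whose order divides `N`. -/
structure Acts (x : V ≃ₗ[F] V) (τ : J₁ → E) (σ : J₂ → E) (N : ℕ) : Prop where
  ι₁ : ∀ m, x (D.ι₁ m) = D.ι₁ (τ * m)
  ι₂ : ∀ m, x (D.ι₂ m) = D.ι₂ (σ * m)
  p₁ : ∀ v, D.p₁ (x v) = τ * D.p₁ v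
  p₂ : ∀ v, D.p₂ (x v) = σ * D.p₂ v
  pow : ∀ u ∈ D.rest, (x ^ N) u = u

variable {D} {x : V ≃ₗ[F] V} {τ : J₁ → E} {σ : J₂ → E} {N : ℕ}

theorem Acts.p₁_pow (h : D.Acts x τ σ N) (k : ℕ) (v : V) : D.p₁ ((x ^ k) v) = τ ^ k * D.p₁ v := by
  induction k with
  | zero => simp
  | succ k ih => rw [pow_succ', LinearEquiv.mul_apply, h.p₁, ih, pow_succ', mul_assoc]

theorem Acts.p₂_pow (h : D.Acts x τ σ N) (k : ℕ) (v : V) : D.p₂ ((x ^ k) v) = σ ^ k * D.p₂ v := by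
  induction k with
  | zero => simp
  | succ k ih => rw [pow_succ', LinearEquiv.mul_apply, h.p₂, ih, pow_succ', mul_assoc]

theorem Acts.mem_rest_iff (h : D.Acts x τ σ N) (hτ : ∀ i, τ i ^ N ≠ 1) (hσ : ∀ i, σ i ^ N ≠ 1)
    (v : V) : v ∈ D.rest ↔ (x ^ N) v = v := by
  refine ⟨h.pow v, fun hv => D.mem_rest.2 ⟨?_, ?_⟩⟩
  · have e := h.p₁_pow N v
    rw [hv] at e
    ext i
    have e1 : D.p₁ v i = τ i ^ N * D.p₁ v i := congrFun e i
    have e2 : (τ i ^ N - 1) * D.p₁ v i = 0 := by rw [sub_mul, ← e1]; ring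
    exact (mul_eq_zero.1 e2).resolve_left (sub_ne_zero.2 (hτ i))
  · have e := h.p₂_pow N v
    rw [hv] at e
    ext i
    have e1 : D.p₂ v i = σ i ^ N * D.p₂ v i := congrFun e i
    have e2 : (σ i ^ N - 1) * D.p₂ v i = 0 := by rw [sub_mul, ← e1]; ring
    exact (mul_eq_zero.1 e2).resolve_left (sub_ne_zero.2 (hσ i))

theorem Acts.aeval_mem_rest (h : D.Acts x τ σ N) (p : F[X]) {u : V} (hu : u ∈ D.rest) :
    aeval (x : V →ₗ[F] V) p u ∈ D.rest := by
  have hx : ∀ u ∈ D.rest, x u ∈ D.rest := by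
    intro u hu
    rw [D.mem_rest] at hu ⊢
    rw [h.p₁, h.p₂, hu.1, hu.2, mul_zero, mul_zero]
    exact ⟨rfl, rfl⟩
  induction p using Polynomial.induction_on' with
  | add p q hp hq => rw [map_add]; exact D.rest.add_mem hp hq
  | monomial n a =>
    rw [aeval_monomial, Module.End.mul_apply, Module.algebraMap_end_apply]
    refine D.rest.smul_mem a ?_
    induction n with
    | zero => simpa using hu
    | succ n ih => rw [pow_succ', Module.End.mul_apply]; exact hx _ ih

/-- The kernel of the minimal polynomial of a generator `τ i` is the `i`-th block, provided that no
other `τ j` and no `σ j` is conjugate to `τ i`. -/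
theorem Acts.exists_single_of_aeval_eq_zero [DecidableEq J₁] [Finite E] (h : D.Acts x τ σ N)
    (hτN : ∀ i, τ i ^ N ≠ 1) (i : J₁)
    (hτ : ∀ j, j ≠ i → aeval (τ j) (minpoly F (τ i)) ≠ 0)
    (hσ : ∀ j, aeval (σ j) (minpoly F (τ i)) ≠ 0) (v : V)
    (hv : aeval (x : V →ₗ[F] V) (minpoly F (τ i)) v = 0) : ∃ z : E, v = D.ι₁ (Pi.single i z) := by
  set μ := minpoly F (τ i)
  set u := v - D.ι₁ (D.p₁ v) - D.ι₂ (D.p₂ v) with hu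
  have huU : u ∈ D.rest := D.sub_mem_rest v
  have hve : v = D.ι₁ (D.p₁ v) + D.ι₂ (D.p₂ v) + u := by rw [hu]; abel
  have e := hv
  rw [hve, map_add, map_add, aeval_apply_torus (x := (x : V →ₗ[F] V)) h.ι₁,
    aeval_apply_torus (x := (x : V →ₗ[F] V)) h.ι₂] at e
  have hw := D.mem_rest.1 (h.aeval_mem_rest μ huU)
  have e1 := congrArg D.p₁ e
  have e2 := congrArg D.p₂ e
  rw [map_add, map_add, D.p₁_ι₁, D.p₁_ι₂, hw.1, map_zero, add_zero, add_zero] at e1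
  rw [map_add, map_add, D.p₂_ι₁, D.p₂_ι₂, hw.2, map_zero, add_zero, zero_add] at e2
  have h2 : D.p₂ v = 0 := by
    ext j
    exact (mul_eq_zero.1 (congrFun e2 j)).resolve_left (hσ j)
  have h1 : D.p₁ v = Pi.single i (D.p₁ v i) := by
    ext j
    rcases eq_or_ne j i with rfl | hj
    · simp
    · rw [Pi.single_eq_of_ne hj]
      exact (mul_eq_zero.1 (congrFun e1 j)).resolve_left (hτ j hj)
  rw [e1, e2, map_zero, map_zero, zero_add, zero_add] at e
  have hirr : Irreducible μ := minpoly.irreducible (IsIntegral.of_finite F (τ i))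
  have hcop : IsCoprime μ ((X : F[X]) ^ N - 1) := by
    rw [hirr.coprime_iff_not_dvd, minpoly.dvd_iff]
    simpa [sub_eq_zero] using hτN i
  obtain ⟨a, b, hab⟩ := hcop
  have hu0 : u = 0 := by
    have hN : aeval (x : V →ₗ[F] V) ((X : F[X]) ^ N - 1) u = 0 := by
      have hc : ∀ k : ℕ, ((x : V →ₗ[F] V) ^ k) u = (x ^ k) u := by
        intro k
        induction k with
        | zero => simp
        | succ k ih => rw [pow_succ', pow_succ', Module.End.mul_apply, ih]; rfl
      simp [hc, h.pow u huU]
    have := congrArg (fun p => aeval (x : V →ₗ[F] V) p u) hab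
    simp only [map_add, map_mul, LinearMap.add_apply, Module.End.mul_apply, e, hN, map_one,
      Module.End.one_apply, map_zero, add_zero] at this
    exact this.symm
  refine ⟨D.p₁ v i, ?_⟩
  rw [← h1]
  rw [h2, hu0, map_zero, add_zero, add_zero] at hve
  exact hve

/-- The lower bound for the number of conjugates of a family of elements that act on the blocks of
`V` by pairwise non-conjugate generators of `E`. -/
theorem card_mul_card_le [Finite F] [Finite E] [FiniteDimensional F V] {t : ℕ}
    {D : BlockDecomposition F E V (Fin t) J₂} {G : Subgroup (V ≃ₗ[F] V)} {T : Type*} [Finite T]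
    (x : T → G) (τ : T → Fin t → E) (σ : T → J₂ → E) (hinj : Function.Injective τ)
    (h : ∀ s, D.Acts (x s : V ≃ₗ[F] V) (τ s) (σ s) N)
    (hτN : ∀ s i, τ s i ^ N ≠ 1) (hσN : ∀ s i, σ s i ^ N ≠ 1)
    (hgen : ∀ s i, (minpoly F (τ s i)).natDegree = Module.finrank F E)
    (hτ : ∀ s i j, j ≠ i → aeval (τ s j) (minpoly F (τ s i)) ≠ 0)
    (hσ : ∀ s i j, aeval (σ s j) (minpoly F (τ s i)) ≠ 0)
    (hdet : ∀ s, ∀ y ∈ G, Commute y (x s) → (∀ m, y (D.ι₁ m) = D.ι₁ m) →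
      (∀ u ∈ D.rest, y u = u) → y = 1)
    (A : Set G) (hA : ∀ s h, h * x s * h⁻¹ ∈ A) :
    Nat.card T * Nat.card G ≤ Nat.card A *
      (Nat.card E ^ t * Nat.card F ^ (Module.finrank F D.rest) ^ 2 * Module.finrank F V ^ t) := by
  classical
  have : Finite V := Module.finite_of_finite F
  have : Finite (V ≃ₗ[F] V) := Finite.of_injective _ DFunLike.coe_injective
  refine card_mul_card_le_card_mul x A hA _ _ (fun s => ?_)
    (card_conj_torus_le D.ι₁_injective G x τ hinj fun s m => (h s).ι₁ m)
  let S : Set (V ≃ₗ[F] V) := {y | y ∈ G ∧ y * x s = x s * y}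
  have key := card_commuting_le (x := (x s : V ≃ₗ[F] V)) (ι := D.ι₁) (τ := τ s)
    (μ := fun i => minpoly F (τ s i)) (S := S) (U := D.rest) (N := N)
    (h s).ι₁ (fun i z => ?_) (fun i => minpoly.aeval F (τ s i))
    (fun i v hv => (h s).exists_single_of_aeval_eq_zero (hτN s) i (hτ s i) (hσ s i) v hv)
    ((h s).mem_rest_iff (hτN s) (hσN s)) (fun y hy => hy.2)
    (fun y₁ h₁ y₂ h₂ hM hU => by
      have e : ∀ v, y₁ v = y₂ v → (y₂⁻¹ * y₁) v = v := fun v hv => by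
        rw [LinearEquiv.mul_apply, hv]
        exact y₂.symm_apply_apply v
      exact (inv_mul_eq_one.1 (hdet s (y₂⁻¹ * y₁) (G.mul_mem (G.inv_mem h₂.1) h₁.1)
        (Commute.mul_left (Commute.inv_left h₂.2) h₁.2)
        (fun m => e _ (hM m)) (fun u hu => e _ (hU u hu)))).symm)
  · refine le_trans ?_ key
    refine Nat.card_le_card_of_injective
      (fun y : {y : G // y * x s = x s * y} => (⟨y.1, y.1.2, congrArg Subtype.val y.2⟩ : S)) ?_
    intro a b hab
    exact Subtype.ext (Subtype.ext (Subtype.mk.inj hab))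
  · have htop : IntermediateField.adjoin F {τ s i} = ⊤ :=
      (Field.primitive_element_iff_minpoly_natDegree_eq F (τ s i)).2 (hgen s i)
    have hz : z ∈ IntermediateField.adjoin F {τ s i} := by rw [htop]; trivial
    rw [← IntermediateField.mem_toSubalgebra, IntermediateField.adjoin_simple_toSubalgebra_of_isAlgebraic
      (IsIntegral.of_finite F (τ s i)).isAlgebraic] at hz
    rw [Algebra.adjoin_singleton_eq_range_aeval] at hz
    exact hz

end BlockDecomposition

end Blocks

end FiniteClassical

namespace FiniteClassical

open Polynomial Module

/-! ### Polar spaces and hyperbolic families -/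

/-- A common description of nondegenerate alternating, hermitian and quadratic spaces over a finite
field: a reflexive sesquilinear form `f` and a function `Q` whose polarisation is `η * f`. The
function `Q` is the quadratic form (with `η = 1`) in the orthogonal case, and zero (with `η = 0`) in
the other two. The last two fields say that there are singular vectors in every
three-dimensional subspace, and that a vector which is not orthogonal to a singular vector `a` can
be made singular by adding a multiple of `a`. -/
structure PolarSpace (F V : Type*) [Field F] [AddCommGroup V] [Module F V] where
  θ : F →+* F
  ε : F
  η : F
  f : V →ₛₗ[θ] V →ₗ[F] F
  Q : V → F
  θ_θ : ∀ a, θ (θ a) = a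
  θ_ε : θ ε = ε
  ε_ε : ε * ε = 1
  η_symm : ∀ c, η * (ε * θ c) = η * c
  symm : ∀ x y, f y x = ε * θ (f x y)
  nondeg : ∀ x, (∀ y, f x y = 0) → x = 0
  Q_add : ∀ x y, Q (x + y) = Q x + Q y + η * f x y
  Q_smul : ∀ (c : F) x, Q x = 0 → Q (c • x) = 0
  exists_singular : ∀ W : Submodule F V, 3 ≤ finrank F W → ∃ a ∈ W, a ≠ 0 ∧ f a a = 0 ∧ Q a = 0
  exists_adjust : ∀ a b, f a a = 0 → Q a = 0 → f a b = 1 →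
    ∃ k : F, f (b + k • a) (b + k • a) = 0 ∧ Q (b + k • a) = 0

namespace PolarSpace

variable {F : Type*} [Field F] {V : Type*} [AddCommGroup V] [Module F V] (P : PolarSpace F V)

/-- The linear automorphisms that preserve both `f` and `Q`. -/
def group : Subgroup (V ≃ₗ[F] V) where
  carrier := {g | (∀ x y, P.f (g x) (g y) = P.f x y) ∧ ∀ x, P.Q (g x) = P.Q x}
  one_mem' := ⟨fun _ _ => rfl, fun _ => rfl⟩
  mul_mem' := fun {a b} ha hb =>
    ⟨fun x y => (ha.1 (b x) (b y)).trans (hb.1 x y), fun x => (ha.2 (b x)).trans (hb.2 x)⟩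
  inv_mem' := fun {a} ha => by
    have e : ∀ z, a (a⁻¹ z) = z := fun z => a.apply_symm_apply z
    refine ⟨fun x y => ?_, fun x => ?_⟩
    · have h := ha.1 (a⁻¹ x) (a⁻¹ y)
      rw [e, e] at h
      exact h.symm
    · have h := ha.2 (a⁻¹ x)
      rw [e] at h
      exact h.symm

theorem ε_ne_zero : P.ε ≠ 0 := fun h => by simpa [h] using P.ε_ε

variable {P}

theorem map_f {g : V ≃ₗ[F] V} (hg : g ∈ P.group) (x y : V) : P.f (g x) (g y) = P.f x y := hg.1 x y

theorem f_eq_zero_comm {x y : V} : P.f x y = 0 ↔ P.f y x = 0 := by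
  rw [P.symm x y, mul_eq_zero, map_eq_zero P.θ]
  simp [P.ε_ne_zero]

theorem nondeg_right {y : V} (h : ∀ x, P.f x y = 0) : y = 0 :=
  P.nondeg y fun x => f_eq_zero_comm.1 (h x)

theorem exists_f_eq_one {a : V} (ha : a ≠ 0) : ∃ b, P.f a b = 1 := by
  by_contra! h
  refine ha (P.nondeg a fun y => ?_)
  by_contra hy
  exact h ((P.f a y)⁻¹ • y) (by rw [map_smul, smul_eq_mul, inv_mul_cancel₀ hy])

theorem Q_zero : P.Q 0 = 0 := by
  have := P.Q_add 0 0
  simpa using this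

theorem Q_sum_eq_zero {I : Type*} (s : Finset I) (v : I → V) (c : I → F) (hQ : ∀ i, P.Q (v i) = 0)
    (hf : ∀ i j, P.f (v i) (v j) = 0) : P.Q (∑ i ∈ s, c i • v i) = 0 := by
  classical
  induction s using Finset.induction_on with
  | empty => simpa using Q_zero
  | insert i s hi ih =>
    rw [Finset.sum_insert hi, P.Q_add, P.Q_smul _ _ (hQ i), ih]
    simp [hf]

variable (P) in
/-- The families `e`, `e'` consist of singular vectors and span an orthogonal sum of hyperbolic
planes with the hyperbolic pairs `(e i, e' i)`. -/
structure IsHyperbolic {I : Type*} [DecidableEq I] (e e' : I → V) : Prop where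
  ee : ∀ i j, P.f (e i) (e j) = 0
  ee' : ∀ i j, P.f (e i) (e' j) = if i = j then 1 else 0
  e'e' : ∀ i j, P.f (e' i) (e' j) = 0
  Qe : ∀ i, P.Q (e i) = 0
  Qe' : ∀ i, P.Q (e' i) = 0

theorem IsHyperbolic.e'e {I : Type*} [DecidableEq I] {e e' : I → V} (h : P.IsHyperbolic e e')
    (i j : I) : P.f (e' i) (e j) = if i = j then P.ε else 0 := by
  rw [P.symm (e j) (e' i), h.ee']
  rcases eq_or_ne i j with rfl | hij
  · simp
  · simp [hij, hij.symm]

theorem IsHyperbolic.comp {I I' : Type*} [DecidableEq I] [DecidableEq I'] {e e' : I → V}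
    (h : P.IsHyperbolic e e') {φ : I' → I} (hφ : Function.Injective φ) :
    P.IsHyperbolic (e ∘ φ) (e' ∘ φ) where
  ee i j := h.ee _ _
  ee' i j := by simp [h.ee', hφ.eq_iff]
  e'e' i j := h.e'e' _ _
  Qe i := h.Qe _
  Qe' i := h.Qe' _

theorem exists_isHyperbolic [FiniteDimensional F V] (m : ℕ) (hm : 2 * m + 1 ≤ finrank F V) :
    ∃ e e' : Fin m → V, P.IsHyperbolic e e' := by
  induction m with
  | zero => exact ⟨Fin.elim0, Fin.elim0, ⟨fun i => i.elim0, fun i => i.elim0, fun i => i.elim0,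
      fun i => i.elim0, fun i => i.elim0⟩⟩
  | succ m ih =>
    obtain ⟨e, e', h⟩ := ih (by omega)
    let L : V →ₗ[F] (Fin m ⊕ Fin m → F) :=
      LinearMap.pi (Sum.elim (fun i => P.f (e i)) (fun i => P.f (e' i)))
    have hL : ∀ v, v ∈ LinearMap.ker L ↔ (∀ i, P.f (e i) v = 0) ∧ ∀ i, P.f (e' i) v = 0 := by
      intro v
      rw [LinearMap.mem_ker]
      constructor
      · intro hv
        exact ⟨fun i => congrFun hv (Sum.inl i), fun i => congrFun hv (Sum.inr i)⟩
      · rintro ⟨h1, h2⟩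
        ext i
        rcases i with i | i
        · exact h1 i
        · exact h2 i
    have hdim : 3 ≤ finrank F (LinearMap.ker L) := by
      have h1 := LinearMap.finrank_range_add_finrank_ker L
      have h2 := Submodule.finrank_le (LinearMap.range L)
      rw [Module.finrank_fintype_fun_eq_card, Fintype.card_sum, Fintype.card_fin] at h2
      omega
    obtain ⟨a, haW, ha0, haf, haQ⟩ := P.exists_singular _ hdim
    rw [hL] at haW
    obtain ⟨b₀, hb₀⟩ := exists_f_eq_one (P := P) ha0
    set b₁ := b₀ - ∑ i, P.f (e i) b₀ • e' i - ∑ i, (P.ε * P.f (e' i) b₀) • e i with hb₁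
    have h1 : ∀ j, P.f (e j) b₁ = 0 := by
      intro j
      simp [hb₁, map_sub, map_sum, h.ee', h.ee]
    have h2 : ∀ j, P.f (e' j) b₁ = 0 := by
      intro j
      have : P.ε * P.f (e' j) b₀ * P.ε = P.f (e' j) b₀ := by
        rw [mul_comm, ← mul_assoc, P.ε_ε, one_mul]
      simp [hb₁, map_sub, map_sum, h.e'e, h.e'e', this]
    have h3 : P.f a b₁ = 1 := by
      simp [hb₁, map_sub, map_sum, f_eq_zero_comm.1 (haW.1 _), f_eq_zero_comm.1 (haW.2 _), hb₀]
    obtain ⟨k, hkf, hkQ⟩ := P.exists_adjust a b₁ haf haQ h3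
    set b := b₁ + k • a
    have hb1 : ∀ j, P.f (e j) b = 0 := fun j => by simp [b, h1, haW.1]
    have hb2 : ∀ j, P.f (e' j) b = 0 := fun j => by simp [b, h2, haW.2]
    have hab : P.f a b = 1 := by simp [b, h3, haf]
    refine ⟨Fin.cons a e, Fin.cons b e', ⟨?_, ?_, ?_, ?_, ?_⟩⟩
    · intro i j
      refine Fin.cases ?_ (fun i => ?_) i <;> refine Fin.cases ?_ (fun j => ?_) j
      · simpa using haf
      · simpa using f_eq_zero_comm.1 (haW.1 j)
      · simpa using haW.1 i
      · simpa using h.ee i j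
    · intro i j
      refine Fin.cases ?_ (fun i => ?_) i <;> refine Fin.cases ?_ (fun j => ?_) j
      · simpa using hab
      · simpa [(Fin.succ_ne_zero j).symm] using f_eq_zero_comm.1 (haW.2 j)
      · simpa [(Fin.succ_ne_zero i)] using hb1 i
      · simpa using h.ee' i j
    · intro i j
      refine Fin.cases ?_ (fun i => ?_) i <;> refine Fin.cases ?_ (fun j => ?_) j
      · simpa using hkf
      · simpa using f_eq_zero_comm.1 (hb2 j)
      · simpa using hb2 i
      · simpa using h.e'e' i j
    · intro i
      refine Fin.cases ?_ (fun i => ?_) i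
      · simpa using haQ
      · simpa using h.Qe i
    · intro i
      refine Fin.cases ?_ (fun i => ?_) i
      · simpa using hkQ
      · simpa using h.Qe' i

section Splitting

variable {E : Type*} [Field E] [Algebra F E] {J : Type*}

variable (P) in
/-- A block decomposition of a polar space whose first two summands are totally singular and
paired by `B`, and whose third summand is orthogonal to them. -/
structure Splitting (B : (J → E) →ₛₗ[P.θ] (J → E) →ₗ[F] F) extends
    BlockDecomposition F E V J J where
  f_ι₁ : ∀ x v, P.f (ι₁ x) v = B x (p₂ v)
  f_ι₂ : ∀ v y, P.f v (ι₂ y) = B (p₁ v) y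
  Q_ι₁ : ∀ x, P.Q (ι₁ x) = 0
  Q_ι₂ : ∀ y, P.Q (ι₂ y) = 0

/-- A hyperbolic family indexed by a basis of `J → E` gives a splitting. -/
theorem exists_splitting [FiniteDimensional F (J → E)]
    (B : (J → E) →ₛₗ[P.θ] (J → E) →ₗ[F] F) (hB : ∀ y, (∀ x, B x y = 0) → y = 0)
    {e e' : Fin (finrank F (J → E)) → V} (h : P.IsHyperbolic e e') :
    ∃ D : P.Splitting B,
      (∀ x, D.ι₁ x ∈ Submodule.span F (Set.range e)) ∧
      ∀ x, D.ι₂ x ∈ Submodule.span F (Set.range e') := by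
  let b := Module.finBasis F (J → E)
  let L : (J → E) →ₗ[F] (Fin (finrank F (J → E)) → F) := LinearMap.pi fun j => B (b j)
  have hLinj : Function.Injective L := by
    rw [injective_iff_map_eq_zero]
    intro y hy
    apply hB
    intro x
    have hy' : ∀ j, B (b j) y = 0 := fun j => congrFun hy j
    rw [← b.sum_repr x]
    simp [-Basis.sum_repr, hy']
  let L' := LinearEquiv.ofInjectiveOfFinrankEq L hLinj (by simp)
  have hL' : ∀ (c : Fin (finrank F (J → E)) → F) j, B (b j) (L'.symm c) = c j := by
    intro c j
    exact congrFun (L'.apply_symm_apply c) j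
  have hBx : ∀ x y, B x y = ∑ j, P.θ (b.repr x j) * B (b j) y := by
    intro x y
    conv_lhs => rw [← b.sum_repr x]
    simp [-Basis.sum_repr]
  have hext : ∀ y y', (∀ j, B (b j) y = B (b j) y') → y = y' := by
    intro y y' hyy
    apply hLinj
    ext j
    exact hyy j
  let ι₁ : (J → E) →ₗ[F] V := b.constr F e
  let ι₂ : (J → E) →ₗ[F] V := (Fintype.linearCombination F e').comp L
  let p₁ : V →ₗ[F] (J → E) :=
    (Fintype.linearCombination F b).comp (LinearMap.pi fun j => P.ε • P.f (e' j))
  let p₂ : V →ₗ[F] (J → E) := (L'.symm : _ →ₗ[F] _).comp (LinearMap.pi fun j => P.f (e j))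
  have hι₁ : ∀ x, ι₁ x = ∑ j, b.repr x j • e j := fun x => by
    simp [ι₁, Module.Basis.constr_apply_fintype]
  have hι₂ : ∀ y, ι₂ y = ∑ j, B (b j) y • e' j := fun y => by
    simp [ι₂, L, Fintype.linearCombination_apply]
  have hp₁ : ∀ v, p₁ v = ∑ j, (P.ε * P.f (e' j) v) • b j := fun v => by
    simp [p₁, Fintype.linearCombination_apply]
  have hp₂ : ∀ v j, B (b j) (p₂ v) = P.f (e j) v := fun v j => by
    simp [p₂, hL']
  have hr : ∀ v j, b.repr (p₁ v) j = P.ε * P.f (e' j) v := by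
    intro v j
    rw [hp₁]
    simp [map_sum, Finsupp.single_apply]
  refine ⟨⟨⟨ι₁, ι₂, p₁, p₂, ?_, ?_, ?_, ?_⟩, ?_, ?_, ?_, ?_⟩, ?_, ?_⟩
  · intro m
    apply b.ext_elem
    intro j
    rw [hr, hι₁]
    have hm : P.ε * (b.repr m j * P.ε) = b.repr m j := by rw [mul_left_comm, P.ε_ε, mul_one]
    simp [map_sum, h.e'e, hm]
  · intro m
    apply hext
    intro j
    rw [hp₂, hι₂]
    simp [map_sum, h.ee']
  · intro m
    apply b.ext_elem
    intro j
    rw [hr, hι₂]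
    simp [map_sum, h.e'e']
  · intro m
    apply hext
    intro j
    rw [hp₂, hι₁]
    simp [map_sum, h.ee]
  · intro x v
    rw [hBx, hι₁]
    simp [map_sum, LinearMap.map_smulₛₗ, hp₂]
  · intro v y
    rw [hBx, hι₂, map_sum]
    refine Finset.sum_congr rfl fun j _ => ?_
    rw [hr, map_mul, P.θ_ε, ← P.symm, map_smul, smul_eq_mul, mul_comm]
  · intro x
    rw [hι₁]
    exact Q_sum_eq_zero _ _ _ h.Qe h.ee
  · intro x
    rw [hι₂]
    exact Q_sum_eq_zero _ _ _ h.Qe' h.e'e'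
  · intro x
    rw [hι₁]
    exact Submodule.sum_mem _ fun j _ => Submodule.smul_mem _ _ (Submodule.subset_span ⟨j, rfl⟩)
  · intro x
    rw [hι₂]
    exact Submodule.sum_mem _ fun j _ => Submodule.smul_mem _ _ (Submodule.subset_span ⟨j, rfl⟩)

end Splitting

end PolarSpace

end FiniteClassical

namespace FiniteClassical

open Polynomial Module

/-! ### Torus elements and the fibres over the abelianisation -/

namespace BlockDecomposition

variable {F : Type*} [Field F] {E : Type*} [Field E] [Algebra F E]
  {V : Type*} [AddCommGroup V] [Module F V] {J₁ J₂ : Type*}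
  (D : BlockDecomposition F E V J₁ J₂)

/-- The torus of a block decomposition: `(τ, σ)` acts on the first two summands by multiplication
with `τ` and `σ`, and trivially on the third. -/
def torus : (J₁ → Eˣ) × (J₂ → Eˣ) →* (V ≃ₗ[F] V) :=
  (LinearMap.GeneralLinearGroup.generalLinearEquiv F V).toMonoidHom.comp
    (MonoidHom.toHomUnits
      { toFun := fun τ => LinearMap.id
          + D.ι₁ ∘ₗ LinearMap.mulLeft F ((fun i => (τ.1 i : E)) - 1) ∘ₗ D.p₁
          + D.ι₂ ∘ₗ LinearMap.mulLeft F ((fun i => (τ.2 i : E)) - 1) ∘ₗ D.p₂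
        map_one' := by
          ext v
          simp only [LinearMap.add_apply, LinearMap.comp_apply, LinearMap.mulLeft_apply,
            Prod.fst_one, Prod.snd_one, Pi.one_apply, Units.val_one, Module.End.one_apply,
            LinearMap.id_apply]
          have h₁ : (fun _ : J₁ => (1 : E)) - 1 = 0 := sub_self _
          have h₂ : (fun _ : J₂ => (1 : E)) - 1 = 0 := sub_self _
          rw [h₁, h₂]
          simp
        map_mul' := fun τ τ' => by
          ext v
          simp only [LinearMap.add_apply, LinearMap.comp_apply, LinearMap.mulLeft_apply,
            Prod.fst_mul, Prod.snd_mul, Pi.mul_apply, Units.val_mul, Module.End.mul_apply,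
            LinearMap.id_apply, map_add, D.p₁_ι₁, D.p₁_ι₂, D.p₂_ι₁, D.p₂_ι₂]
          have h₁ : ((fun i => (τ.1 i : E) * (τ'.1 i : E)) - 1) * D.p₁ v
              = ((fun i => (τ'.1 i : E)) - 1) * D.p₁ v + ((fun i => (τ.1 i : E)) - 1) *
                (D.p₁ v + ((fun i => (τ'.1 i : E)) - 1) * D.p₁ v) := by
            ext i
            simp only [Pi.mul_apply, Pi.add_apply, Pi.sub_apply, Pi.one_apply]
            ring
          have h₂ : ((fun i => (τ.2 i : E) * (τ'.2 i : E)) - 1) * D.p₂ v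
              = ((fun i => (τ'.2 i : E)) - 1) * D.p₂ v + ((fun i => (τ.2 i : E)) - 1) *
                (D.p₂ v + ((fun i => (τ'.2 i : E)) - 1) * D.p₂ v) := by
            ext i
            simp only [Pi.mul_apply, Pi.add_apply, Pi.sub_apply, Pi.one_apply]
            ring
          rw [h₁, h₂, map_add, map_add]
          simp only [mul_add, map_add, mul_zero, map_zero]
          abel })

variable {D}

theorem torus_apply (τ : (J₁ → Eˣ) × (J₂ → Eˣ)) (v : V) :
    D.torus τ v = v + D.ι₁ (((fun i => (τ.1 i : E)) - 1) * D.p₁ v)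
      + D.ι₂ (((fun i => (τ.2 i : E)) - 1) * D.p₂ v) := rfl

/-- `w` acts trivially on the first two summands and respects the decomposition. -/
structure Fixes (D : BlockDecomposition F E V J₁ J₂) (w : V ≃ₗ[F] V) : Prop where
  ι₁ : ∀ m, w (D.ι₁ m) = D.ι₁ m
  ι₂ : ∀ m, w (D.ι₂ m) = D.ι₂ m
  p₁ : ∀ v, D.p₁ (w v) = D.p₁ v
  p₂ : ∀ v, D.p₂ (w v) = D.p₂ v

theorem Fixes.commute_torus {w : V ≃ₗ[F] V} (h : D.Fixes w) (τ : (J₁ → Eˣ) × (J₂ → Eˣ)) :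
    Commute (D.torus τ) w := by
  ext v
  simp only [LinearEquiv.mul_apply, torus_apply, h.p₁, h.p₂, map_add, h.ι₁, h.ι₂]

theorem Fixes.acts_torus_mul {w : V ≃ₗ[F] V} (h : D.Fixes w) {N : ℕ} (hw : w ^ N = 1)
    (τ : (J₁ → Eˣ) × (J₂ → Eˣ)) :
    D.Acts (D.torus τ * w) (fun i => (τ.1 i : E)) (fun i => (τ.2 i : E)) N where
  ι₁ m := by
    rw [LinearEquiv.mul_apply, h.ι₁, torus_apply, D.p₁_ι₁, D.p₂_ι₁, mul_zero, map_zero, add_zero,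
      ← map_add]
    congr 1
    ring
  ι₂ m := by
    rw [LinearEquiv.mul_apply, h.ι₂, torus_apply, D.p₁_ι₂, D.p₂_ι₂, mul_zero, map_zero, add_zero,
      ← map_add]
    congr 1
    ring
  p₁ v := by
    rw [LinearEquiv.mul_apply, torus_apply, map_add, map_add, D.p₁_ι₁, D.p₁_ι₂, h.p₁]
    ring
  p₂ v := by
    rw [LinearEquiv.mul_apply, torus_apply, map_add, map_add, D.p₂_ι₁, D.p₂_ι₂, h.p₂]
    ring
  pow u hu := by
    rw [(h.commute_torus τ).mul_pow, hw, mul_one, ← map_pow, torus_apply, (D.mem_rest.1 hu).1,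
      (D.mem_rest.1 hu).2]
    simp

/-- The number of elements `g` in the fibre over `α` with `g ^ e` in `S`, for a block decomposition
of `V` with `t` blocks. The set `R` supplies the entries of the torus elements, and every class of
the abelianisation is represented by an element `w` that fixes the blocks and has `w ^ e ∈ S`. -/
theorem card_mul_card_le_card_fiber [Finite F] [Finite E] [FiniteDimensional F V] {t : ℕ}
    (D : BlockDecomposition F E V (Fin t) J₂) (G : Subgroup (V ≃ₗ[F] V)) (S : Set (V ≃ₗ[F] V))
    (hS : ∀ g ∈ S, ∀ h ∈ G, h * g * h⁻¹ ∈ S) {N e : ℕ} (hE : ∀ z : Eˣ, z ^ e = 1)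
    (ψ : (Fin t → Eˣ) → (J₂ → Eˣ)) (hψ : ∀ τ, D.torus (τ, ψ τ) ∈ G)
    (hG : ∀ β : Abelianization G, ∃ w : G, Abelianization.of w = β ∧ (w : V ≃ₗ[F] V) ^ N = 1 ∧
      (w : V ≃ₗ[F] V) ^ e ∈ S ∧ D.Fixes (w : V ≃ₗ[F] V))
    (R : Finset Eˣ) (hRN : ∀ a ∈ R, a ^ N ≠ 1)
    (hRd : ∀ a ∈ R, (minpoly F (a : E)).natDegree = finrank F E)
    (hR : ∀ a ∈ R, ∀ b ∈ R, b ≠ a → aeval (b : E) (minpoly F (a : E)) ≠ 0)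
    (hRψN : ∀ τ : Fin t → Eˣ, (∀ i, τ i ∈ R) → ∀ j, ψ τ j ^ N ≠ 1)
    (hRψ : ∀ τ : Fin t → Eˣ, (∀ i, τ i ∈ R) → ∀ i j,
      aeval (ψ τ j : E) (minpoly F (τ i : E)) ≠ 0)
    (hdet : ∀ τ : Fin t → Eˣ, (∀ i, τ i ∈ R) → ∀ x ∈ G,
      D.Acts x (fun i => (τ i : E)) (fun i => (ψ τ i : E)) N →
      ∀ y ∈ G, Commute y x → (∀ m, y (D.ι₁ m) = D.ι₁ m) → (∀ u ∈ D.rest, y u = u) → y = 1)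
    (α : Abelianization G) :
    R.card.descFactorial t * Nat.card G ≤
      Nat.card {g : G // ((g ^ e : G) : V ≃ₗ[F] V) ∈ S ∧ Abelianization.of g = α} *
      (Nat.card E ^ t * Nat.card F ^ (finrank F D.rest) ^ 2 * finrank F V ^ t) := by
  classical
  let T := Fin t ↪ R
  let τ : T → Fin t → Eˣ := fun s i => (s i : Eˣ)
  have hτR : ∀ s i, τ s i ∈ R := fun s i => (s i).2
  choose w hw₁ hw₂ hw₃ hw₄ using fun s : T =>
    hG (α * (Abelianization.of (⟨D.torus (τ s, ψ (τ s)), hψ _⟩ : G))⁻¹)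
  let x : T → G := fun s => ⟨D.torus (τ s, ψ (τ s)), hψ _⟩ * w s
  have hacts : ∀ s, D.Acts (x s : V ≃ₗ[F] V) (fun i => (τ s i : E)) (fun i => (ψ (τ s) i : E)) N :=
    fun s => (hw₄ s).acts_torus_mul (hw₂ s) (τ s, ψ (τ s))
  have hval : ∀ {a b : Eˣ}, (a : E) = b → a = b := fun h => Units.ext h
  have hpow : ∀ {a : Eˣ}, a ^ N ≠ 1 → (a : E) ^ N ≠ 1 := fun h h' =>
    h (Units.ext (by rw [Units.val_pow_eq_pow_val, h', Units.val_one]))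
  have hx : ∀ s, Abelianization.of (x s) = α := by
    intro s
    simp only [x]
    rw [map_mul, hw₁, mul_comm α, mul_inv_cancel_left]
  have hxe : ∀ s, ((x s ^ e : G) : V ≃ₗ[F] V) ∈ S := by
    intro s
    have h1 : ((x s ^ e : G) : V ≃ₗ[F] V) = (D.torus (τ s, ψ (τ s)) * (w s : V ≃ₗ[F] V)) ^ e := rfl
    have h2 : D.torus (τ s, ψ (τ s)) ^ e = 1 := by
      rw [← map_pow]
      have : ((τ s, ψ (τ s)) ^ e : (Fin t → Eˣ) × (J₂ → Eˣ)) = 1 :=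
        Prod.ext (funext fun i => hE _) (funext fun i => hE _)
      rw [this, map_one]
    rw [h1, ((hw₄ s).commute_torus _).mul_pow, h2, one_mul]
    exact hw₃ s
  have hcard : Nat.card T = R.card.descFactorial t := by
    rw [Nat.card_eq_fintype_card, Fintype.card_embedding_eq, Fintype.card_coe, Fintype.card_fin]
  rw [← hcard]
  refine BlockDecomposition.card_mul_card_le (D := D) (N := N) x (fun s i => (τ s i : E))
    (fun s i => (ψ (τ s) i : E)) ?_ hacts (fun s i => hpow (hRN _ (hτR s i)))
    (fun s i => hpow (hRψN _ (hτR s) i)) (fun s i => hRd _ (hτR s i)) ?_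
    (fun s i j => hRψ _ (hτR s) i j)
    (fun s y hy => hdet (τ s) (hτR s) (x s) (x s).2 (hacts s) y hy)
    {g : G | ((g ^ e : G) : V ≃ₗ[F] V) ∈ S ∧ Abelianization.of g = α} ?_
  · intro s s' h
    refine DFunLike.ext _ _ fun i => Subtype.ext (Units.ext (congrFun h i))
  · intro s i j hij
    refine hR _ (hτR s i) _ (hτR s j) fun h => hij (s.injective (Subtype.ext h))
  · intro s h
    refine ⟨?_, ?_⟩
    · rw [conj_pow]
      exact hS _ (hxe s) _ h.2
    · rw [map_mul, map_mul, map_inv, mul_inv_cancel_comm, hx]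

end BlockDecomposition

namespace PolarSpace

variable {F : Type*} [Field F] {V : Type*} [AddCommGroup V] [Module F V] {P : PolarSpace F V}
  {E : Type*} [Field E] [Algebra F E] {J : Type*} {B : (J → E) →ₛₗ[P.θ] (J → E) →ₗ[F] F}

theorem Splitting.torus_mem_group (D : P.Splitting B) {τ σ : J → Eˣ}
    (hB : ∀ x y, B ((fun i => (τ i : E)) * x) ((fun i => (σ i : E)) * y) = B x y) :
    D.torus (τ, σ) ∈ P.group := by
  have hρ : ∀ v, ∃ a b, D.torus (τ, σ) v = v + D.ι₁ a + D.ι₂ b ∧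
      a = (fun i => (τ i : E)) * D.p₁ v - D.p₁ v ∧ b = (fun i => (σ i : E)) * D.p₂ v - D.p₂ v := by
    intro v
    refine ⟨_, _, BlockDecomposition.torus_apply (τ, σ) v, ?_, ?_⟩ <;> ring
  have hι₁ : ∀ v x, P.f v (D.ι₁ x) = P.ε * P.θ (B x (D.p₂ v)) := fun v x => by
    rw [P.symm (D.ι₁ x) v, D.f_ι₁]
  have hι₂ : ∀ v y, P.f (D.ι₂ y) v = P.ε * P.θ (B (D.p₁ v) y) := fun v y => by
    rw [P.symm v (D.ι₂ y), D.f_ι₂]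
  refine ⟨fun v v' => ?_, fun v => ?_⟩
  · obtain ⟨a, b, h, rfl, rfl⟩ := hρ v
    obtain ⟨a', b', h', rfl, rfl⟩ := hρ v'
    rw [h, h']
    simp only [map_add, LinearMap.add_apply, D.f_ι₁, hι₁, hι₂, D.f_ι₂, D.p₂_ι₁, D.p₁_ι₂,
      D.p₂_ι₂, map_sub, LinearMap.sub_apply, hB, map_zero, LinearMap.zero_apply]
    ring
  · obtain ⟨a, b, h, rfl, rfl⟩ := hρ v
    rw [h, P.Q_add, P.Q_add, D.Q_ι₁, D.Q_ι₂]
    simp only [map_add, LinearMap.add_apply, D.f_ι₁, hι₁, D.f_ι₂, D.p₂_ι₂, map_sub,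
      LinearMap.sub_apply, hB]
    linear_combination P.η_symm (B ((fun i => (τ i : E)) * D.p₁ v) (D.p₂ v))
      - P.η_symm (B (D.p₁ v) (D.p₂ v))

theorem Splitting.fixes (D : P.Splitting B) (hB₁ : ∀ x, (∀ y, B x y = 0) → x = 0)
    (hB₂ : ∀ y, (∀ x, B x y = 0) → y = 0) {w : V ≃ₗ[F] V} (hw : w ∈ P.group)
    (h₁ : ∀ m, w (D.ι₁ m) = D.ι₁ m) (h₂ : ∀ m, w (D.ι₂ m) = D.ι₂ m) : D.Fixes w where
  ι₁ := h₁
  ι₂ := h₂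
  p₁ v := by
    rw [← sub_eq_zero]
    refine hB₁ _ fun y => ?_
    have e : P.f (w v) (D.ι₂ y) = P.f v (D.ι₂ y) := by
      conv_lhs => rw [← h₂]
      exact map_f hw _ _
    rw [map_sub, LinearMap.sub_apply, ← D.f_ι₂, ← D.f_ι₂, e, sub_self]
  p₂ v := by
    rw [← sub_eq_zero]
    refine hB₂ _ fun x => ?_
    have e : P.f (D.ι₁ x) (w v) = P.f (D.ι₁ x) v := by
      conv_lhs => rw [← h₁]
      exact map_f hw _ _
    rw [map_sub, ← D.f_ι₁, ← D.f_ι₁, e, sub_self]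

/-- An element of the group of a polar space that commutes with a torus element and acts trivially
on the first and the third summand acts trivially on the second one too, which is dual to the
first. -/
theorem Splitting.eq_one_of_commute [Finite E] [FiniteDimensional F V] (D : P.Splitting B)
    (hB₂ : ∀ y, (∀ x, B x y = 0) → y = 0) {x y : V ≃ₗ[F] V} {τ σ : J → E} {N : ℕ}
    (hx : D.Acts x τ σ N) (hτσ : ∀ i j, aeval (τ i) (minpoly F (σ j)) ≠ 0) (hy : y ∈ P.group)
    (hc : Commute y x) (h₁ : ∀ m, y (D.ι₁ m) = D.ι₁ m) (hU : ∀ u ∈ D.rest, y u = u) [Finite J] :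
    y = 1 := by
  classical
  have := Fintype.ofFinite J
  have hι₂ : ∀ j (c : E), y (D.ι₂ (Pi.single j c)) = D.ι₂ (Pi.single j c) := by
    intro j c
    set b : J → E := Pi.single j c
    set z := y (D.ι₂ b) - D.ι₂ b with hz
    have hfz : ∀ v, y v = v → P.f v z = 0 := by
      intro v hv
      have : P.f v (y (D.ι₂ b)) = P.f v (D.ι₂ b) := by
        conv_lhs => rw [← hv]
        exact map_f hy _ _
      rw [hz, map_sub, this, sub_self]
    have hp₂ : D.p₂ z = 0 := hB₂ _ fun m => by rw [← D.f_ι₁]; exact hfz _ (h₁ m)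
    set u := z - D.ι₁ (D.p₁ z) - D.ι₂ (D.p₂ z) with hu
    have huU : u ∈ D.rest := D.sub_mem_rest z
    have hu0 : u = 0 := by
      refine nondeg_right (P := P) fun v => ?_
      have hvr := D.sub_mem_rest v
      set r := v - D.ι₁ (D.p₁ v) - D.ι₂ (D.p₂ v) with hr
      have hve : v = D.ι₁ (D.p₁ v) + D.ι₂ (D.p₂ v) + r := by rw [hr]; abel
      have e1 : P.f (D.ι₁ (D.p₁ v)) u = 0 := by
        rw [D.f_ι₁, (D.mem_rest.1 huU).2, map_zero]
      have e2 : P.f (D.ι₂ (D.p₂ v)) u = 0 := by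
        rw [f_eq_zero_comm, D.f_ι₂, (D.mem_rest.1 huU).1, map_zero, LinearMap.zero_apply]
      have e3 : P.f r u = 0 := by
        have h3 : P.f r (D.ι₁ (D.p₁ z)) = 0 := by
          rw [f_eq_zero_comm, D.f_ι₁, (D.mem_rest.1 hvr).2, map_zero]
        rw [hu, hp₂, map_zero, sub_zero, map_sub, hfz r (hU r hvr), h3, sub_zero]
      rw [hve, map_add, map_add, LinearMap.add_apply, LinearMap.add_apply, e1, e2, e3]
      simp
    have hz1 : z = D.ι₁ (D.p₁ z) := by
      have : z = D.ι₁ (D.p₁ z) + D.ι₂ (D.p₂ z) + u := by rw [hu]; abel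
      rw [hu0, hp₂, map_zero, add_zero, add_zero] at this
      exact this
    set μ := minpoly F (σ j)
    have hμ : aeval (x : V →ₗ[F] V) μ (D.ι₂ b) = 0 := by
      rw [aeval_apply_torus (x := (x : V →ₗ[F] V)) hx.ι₂]
      have : (fun i => aeval (σ i) μ * b i) = 0 := by
        ext i
        rcases eq_or_ne i j with rfl | hij
        · simp [μ]
        · simp [b, hij]
      rw [this, map_zero]
    have hcL : (y : V →ₗ[F] V) * (x : V →ₗ[F] V) = (x : V →ₗ[F] V) * (y : V →ₗ[F] V) := by
      ext v
      exact DFunLike.congr_fun hc v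
    have hμz : aeval (x : V →ₗ[F] V) μ z = 0 := by
      have := aeval_apply_of_commute hcL μ (D.ι₂ b)
      rw [LinearEquiv.coe_coe] at this
      rw [hz, map_sub, this, hμ, map_zero, sub_zero]
    rw [hz1, aeval_apply_torus (x := (x : V →ₗ[F] V)) hx.ι₁] at hμz
    have h0 : D.p₁ z = 0 := by
      have := D.ι₁_injective (hμz.trans (map_zero D.ι₁).symm)
      ext i
      exact (mul_eq_zero.1 (congrFun this i)).resolve_left (hτσ i j)
    rw [h0, map_zero] at hz1
    exact sub_eq_zero.1 hz1
  have hι₂' : ∀ m, y (D.ι₂ m) = D.ι₂ m := by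
    intro m
    rw [← Finset.univ_sum_single m, map_sum, map_sum]
    exact Finset.sum_congr rfl fun i _ => hι₂ i (m i)
  ext v
  have hve : v = D.ι₁ (D.p₁ v) + D.ι₂ (D.p₂ v) + (v - D.ι₁ (D.p₁ v) - D.ι₂ (D.p₂ v)) := by abel
  rw [hve, map_add, map_add, h₁, hι₂', hU _ (D.sub_mem_rest v)]
  rfl

end PolarSpace

end FiniteClassical

namespace FiniteClassical

open Polynomial Module

/-! ### The fibre bound for polar spaces -/

theorem BlockDecomposition.finrank_rest_add {F : Type*} [Field F] {E : Type*} [Field E] [Algebra F E]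
    [FiniteDimensional F E] {V : Type*} [AddCommGroup V] [Module F V] [FiniteDimensional F V]
    {J₁ J₂ : Type*} [Fintype J₁] [Fintype J₂] (D : BlockDecomposition F E V J₁ J₂) :
    finrank F D.rest + (Fintype.card J₁ + Fintype.card J₂) * finrank F E = finrank F V := by
  have hk : D.rest = LinearMap.ker (D.p₁.prod D.p₂) := (LinearMap.ker_prod _ _).symm
  have hr : LinearMap.range (D.p₁.prod D.p₂) = ⊤ := by
    rw [LinearMap.range_eq_top]
    rintro ⟨a, b⟩
    refine ⟨D.ι₁ a + D.ι₂ b, ?_⟩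
    simp [D.p₁_ι₁, D.p₁_ι₂, D.p₂_ι₁, D.p₂_ι₂]
  have := LinearMap.finrank_range_add_finrank_ker (D.p₁.prod D.p₂)
  rw [hr, finrank_top, Module.finrank_prod, Module.finrank_pi_fintype, Module.finrank_pi_fintype,
    ← hk] at this
  simp only [Finset.sum_const, Finset.card_univ, smul_eq_mul] at this
  rw [← this]
  ring

section FieldExtension

variable {F : Type*} [Field F] {E : Type*} [Field E] [Algebra F E]

theorem mem_range_algebraMap_of_pow_card [Finite F] [Finite E] {z : E} (h : z ^ Nat.card F = z) :
    z ∈ (algebraMap F E).range := by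
  have := Fintype.ofFinite F
  have hk : ∀ k, z ^ Nat.card F ^ k = z := by
    intro k
    induction k with
    | zero => simp
    | succ k ih => rw [pow_succ, pow_mul, ih, h]
  have : z ∈ (⊥ : IntermediateField F E) := by
    rw [IsGalois.mem_bot_iff_fixed]
    intro σ
    obtain ⟨⟨k, _⟩, rfl⟩ := (FiniteField.bijective_frobeniusAlgEquivOfAlgebraic_pow F E).2 σ
    rw [AlgEquiv.coe_pow, FiniteField.coe_frobeniusAlgEquivOfAlgebraic_iterate,
      ← Nat.card_eq_fintype_card]
    exact hk k
  exact IntermediateField.mem_bot.1 this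

/-- A power of a generator of `E` that lies in `F` or is unipotent cannot be trivial: here the
exponent is the product of `|F| - 1` and a power of the characteristic. -/
theorem pow_ne_one_of_natDegree_minpoly [Finite F] [Finite E] {z : E} (hz : z ≠ 0)
    (h : 2 ≤ (minpoly F z).natDegree) : z ^ ((Nat.card F - 1) * Nat.card F ^ 2) ≠ 1 := by
  intro h1
  set q := Nat.card F
  have hq : 1 < q := Finite.one_lt_card
  have h2 : (z ^ (q - 1)) ^ q ^ 2 = 1 := by rw [← pow_mul]; exact h1
  have hY : 1 ≤ q ^ finrank F E := Nat.one_le_pow _ _ (by omega)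
  have h3 : (z ^ (q - 1)) ^ (q ^ finrank F E - 1) = 1 := by
    refine mul_right_cancel₀ (pow_ne_zero (q - 1) hz) ?_
    rw [← pow_succ, Nat.sub_add_cancel hY, pow_card_pow_finrank, one_mul]
  have hcop : Nat.Coprime (q ^ 2) (q ^ finrank F E - 1) := by
    refine Nat.Coprime.pow_left 2 ?_
    have hd : q ∣ q ^ finrank F E := dvd_pow_self q Module.finrank_pos.ne'
    refine Nat.Coprime.coprime_dvd_left hd ?_
    rw [Nat.coprime_self_sub_right hY]
    exact Nat.coprime_one_right _
  have h4 : z ^ (q - 1) = 1 := by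
    have := pow_gcd_eq_one.2 ⟨h2, h3⟩
    rwa [hcop, pow_one] at this
  have h5 : z ^ q = z := by
    rw [← Nat.sub_add_cancel hq.le, pow_succ, h4, one_mul]
  have := minpoly.natDegree_eq_one_iff.2 (mem_range_algebraMap_of_pow_card h5)
  omega

theorem exists_ringHom_pow [Finite F] {s : ℕ} (hs : s = 1 ∨ s ^ 2 = Nat.card F) :
    ∃ φ : E →+* E, ∀ z, φ z = z ^ s := by
  rcases hs with rfl | hs
  · exact ⟨RingHom.id E, fun z => (pow_one z).symm⟩
  · have := Fintype.ofFinite F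
    obtain ⟨p, hp⟩ := CharP.exists F
    obtain ⟨n, hpp, hn⟩ := FiniteField.card F p
    have := Fact.mk hpp
    have : CharP E p := charP_of_injective_algebraMap (algebraMap F E).injective p
    have hd : s ∣ p ^ (n : ℕ) := by
      rw [← hn, ← Nat.card_eq_fintype_card, ← hs]
      exact dvd_pow_self s two_ne_zero
    obtain ⟨k, _, rfl⟩ := (Nat.dvd_prime_pow hpp).1 hd
    exact ⟨iterateFrobenius E p k, fun z => iterateFrobenius_def p k z⟩

/-- The pairing `∑ i, Tr (φ (x i) * y i)` on `J → E`, where `φ` extends the automorphism `θ`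
of `F`. -/
noncomputable def traceForm {J : Type*} [Fintype J] (θ : F →+* F) (φ : E →+* E)
    (h : ∀ a, φ (algebraMap F E a) = algebraMap F E (θ a)) :
    (J → E) →ₛₗ[θ] (J → E) →ₗ[F] F :=
  LinearMap.mk₂'ₛₗ θ (RingHom.id F) (fun x y => ∑ i, Algebra.trace F E (φ (x i) * y i))
    (fun x x' y => by simp [add_mul, Finset.sum_add_distrib])
    (fun c x y => by
      rw [smul_eq_mul, Finset.mul_sum]
      refine Finset.sum_congr rfl fun i _ => ?_
      rw [Pi.smul_apply, Algebra.smul_def, map_mul φ, h, mul_assoc, ← Algebra.smul_def, map_smul,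
        smul_eq_mul])
    (fun x y y' => by simp [mul_add, Finset.sum_add_distrib])
    (fun c x y => by simp [Finset.mul_sum])

theorem traceForm_apply {J : Type*} [Fintype J] (θ : F →+* F) (φ : E →+* E)
    (h : ∀ a, φ (algebraMap F E a) = algebraMap F E (θ a)) (x y : J → E) :
    traceForm θ φ h x y = ∑ i, Algebra.trace F E (φ (x i) * y i) := rfl

theorem eq_zero_of_trace_mul_eq_zero [Finite F] [Finite E] {z : E} (h : ∀ y, Algebra.trace F E (z * y) = 0) : z = 0 :=
  (traceForm_nondegenerate F E).1 z h

theorem traceForm_left [Finite F] [Finite E] {J : Type*} [Fintype J] (θ : F →+* F) (φ : E →+* E)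
    (h : ∀ a, φ (algebraMap F E a) = algebraMap F E (θ a)) (x : J → E)
    (hx : ∀ y, traceForm θ φ h x y = 0) : x = 0 := by
  classical
  ext i
  have : φ (x i) = 0 := by
    refine eq_zero_of_trace_mul_eq_zero (F := F) fun z => ?_
    have := hx (Pi.single i z)
    rw [traceForm_apply, Finset.sum_eq_single i] at this
    · simpa using this
    · intro j _ hj
      simp [hj]
    · simp
  exact (map_eq_zero φ).1 this

theorem traceForm_right [Finite F] [Finite E] {J : Type*} [Fintype J] (θ : F →+* F) (φ : E →+* E)
    (h : ∀ a, φ (algebraMap F E a) = algebraMap F E (θ a)) (y : J → E)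
    (hy : ∀ x, traceForm θ φ h x y = 0) : y = 0 := by
  classical
  ext i
  refine eq_zero_of_trace_mul_eq_zero (F := F) fun z => ?_
  obtain ⟨w, rfl⟩ := (Finite.injective_iff_surjective.1 φ.injective) z
  have := hy (Pi.single i w)
  rw [traceForm_apply, Finset.sum_eq_single i] at this
  · simpa [mul_comm] using this
  · intro j _ hj
    simp [hj]
  · simp

theorem units_pow_eq_one [Finite E] {e : ℕ} (he : Nat.card F ^ finrank F E - 1 ∣ e) (z : Eˣ) : z ^ e = 1 := by
  obtain ⟨k, rfl⟩ := he
  rw [← Module.natCard_eq_pow_finrank, pow_mul, ← Nat.card_units, pow_card_eq_one', one_pow]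

/-- The units version of `exists_finset_generators`. -/
theorem exists_finset_units [Finite F] [Finite E] {s : ℕ} (hs : s = 1 ∨ s ^ 2 = Nat.card F)
    (hY : 2 ^ 16 ≤ Nat.card F ^ finrank F E) (r : ℕ)
    (hr : 6 * finrank F E * r ≤ Nat.card F ^ finrank F E) :
    ∃ R : Finset Eˣ, R.card = r ∧
      (∀ a ∈ R, (minpoly F (a : E)).natDegree = finrank F E) ∧
      (∀ a ∈ R, ∀ b ∈ R, b ≠ a → aeval (b : E) (minpoly F (a : E)) ≠ 0) ∧
      ∀ a ∈ R, ∀ b ∈ R, aeval (((b ^ s)⁻¹ : Eˣ) : E) (minpoly F (a : E)) ≠ 0 := by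
  classical
  obtain ⟨φ, hφ⟩ := exists_ringHom_pow (E := E) hs
  obtain ⟨R, hc, h1, h2, h3⟩ := exists_finset_generators (E := E) hs
    (fun z w h => φ.injective (by rw [hφ, hφ, h])) hY r hr
  refine ⟨R.preimage Units.val Units.val_injective.injOn, ?_, ?_, ?_, ?_⟩
  · rw [Finset.card_preimage, Finset.filter_true_of_mem, hc]
    intro a ha
    exact ⟨Units.mk0 a (h1 a ha).1, rfl⟩
  · intro a ha
    exact (h1 a (Finset.mem_preimage.1 ha)).2
  · intro a ha b hb hab
    exact h2 a (Finset.mem_preimage.1 ha) b (Finset.mem_preimage.1 hb) fun h => hab (Units.ext h.symm)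
  · intro a ha b hb
    simpa using h3 a (Finset.mem_preimage.1 ha) b (Finset.mem_preimage.1 hb)

end FieldExtension

theorem exists_finite_extension (F : Type*) [Field F] [Finite F] (d : ℕ) (hd : d ≠ 0) :
    ∃ (E : Type) (_ : Field E) (_ : Finite E) (_ : Algebra F E), finrank F E = d := by
  have := NeZero.mk hd
  obtain ⟨p, hp⟩ := CharP.exists F
  have := Fact.mk (CharP.char_is_prime F p)
  exact ⟨FiniteField.Extension F p d, inferInstance, inferInstance, inferInstance,
    FiniteField.finrank_extension F p d⟩

/-- The lower bound for the fibres over the abelianisation of the group of a polar space, for a set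
`S` such that every class has a representative `w` of small order with `w ^ k ∈ S` that fixes a
given hyperbolic family leaving room for five further hyperbolic pairs. -/
theorem PolarSpace.descFactorial_mul_card_le {F : Type*} [Field F] [Finite F] {V : Type*}
    [AddCommGroup V] [Module F V] [FiniteDimensional F V] (P : PolarSpace F V) {s : ℕ}
    (hs : s = 1 ∨ s ^ 2 = Nat.card F) (hθ : ∀ a, P.θ a = a ^ s) (S : Set (V ≃ₗ[F] V))
    (hS : ∀ g ∈ S, ∀ h ∈ P.group, h * g * h⁻¹ ∈ S) {d t r k : ℕ} (hd : 2 ≤ d)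
    (ht : 2 * (t * d) + 11 ≤ finrank F V) (hY : 2 ^ 16 ≤ Nat.card F ^ d)
    (hr : 6 * d * r ≤ Nat.card F ^ d) (hk : Nat.card F ^ d - 1 ∣ k)
    (hL : ∀ (m : ℕ) (e e' : Fin (m + 5) → V), P.IsHyperbolic e e' →
      ∀ β : Abelianization P.group, ∃ w : P.group, Abelianization.of w = β ∧
        (w : V ≃ₗ[F] V) ^ ((Nat.card F - 1) * Nat.card F ^ 2) = 1 ∧ (w : V ≃ₗ[F] V) ^ k ∈ S ∧
        ∀ i : Fin m, (w : V ≃ₗ[F] V) (e (Fin.castAdd 5 i)) = e (Fin.castAdd 5 i) ∧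
          (w : V ≃ₗ[F] V) (e' (Fin.castAdd 5 i)) = e' (Fin.castAdd 5 i))
    (α : Abelianization P.group) :
    r.descFactorial t * Nat.card P.group ≤
      Nat.card {g : P.group // ((g ^ k : P.group) : V ≃ₗ[F] V) ∈ S ∧ Abelianization.of g = α} *
      ((Nat.card F ^ d) ^ t * Nat.card F ^ (finrank F V - 2 * (t * d)) ^ 2 * finrank F V ^ t) := by
  obtain ⟨E, _, _, _, hE⟩ := exists_finite_extension F d (by omega)
  subst hE
  obtain ⟨R, hRc, hRd, hR, hRψ⟩ := exists_finset_units (E := E) hs hY r hr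
  obtain ⟨φ, hφ⟩ := exists_ringHom_pow (E := E) hs
  have hφθ : ∀ a, φ (algebraMap F E a) = algebraMap F E (P.θ a) := fun a => by
    rw [hφ, hθ, map_pow]
  let B : (Fin t → E) →ₛₗ[P.θ] (Fin t → E) →ₗ[F] F := traceForm P.θ φ hφθ
  have hM : finrank F (Fin t → E) = t * finrank F E := by
    rw [Module.finrank_pi_fintype]; simp
  obtain ⟨e, e', he⟩ := exists_isHyperbolic (P := P) (finrank F (Fin t → E) + 5) (by omega)
  obtain ⟨D, hD₁, hD₂⟩ := exists_splitting B (traceForm_right P.θ φ hφθ)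
    (he.comp (Fin.castAdd_injective _ 5))
  have hrest := D.finrank_rest_add
  rw [Fintype.card_fin] at hrest
  have hrest' : finrank F D.rest = finrank F V - 2 * (t * finrank F E) := by
    rw [← hrest, add_mul, two_mul]; omega
  have hN : ∀ a ∈ R, (a : E) ^ ((Nat.card F - 1) * Nat.card F ^ 2) ≠ 1 := fun a ha =>
    pow_ne_one_of_natDegree_minpoly a.ne_zero (by rw [hRd a ha]; exact hd)
  rw [← hrest', ← hRc, ← Module.natCard_eq_pow_finrank (K := F) (V := E)]
  refine D.card_mul_card_le_card_fiber P.group S hS (N := (Nat.card F - 1) * Nat.card F ^ 2)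
    (units_pow_eq_one hk) (fun τ i => (τ i ^ s)⁻¹) (fun τ => ?_) (fun β => ?_) R
    (fun a ha h => hN a ha ?_) hRd hR (fun τ hτ j h => hN (τ j) (hτ j) ?_)
    (fun τ hτ i j => hRψ _ (hτ i) _ (hτ j)) (fun τ hτ x _ hx y hy hc h₁ hU => ?_) α
  · refine D.torus_mem_group fun x y => ?_
    simp only [B, traceForm_apply]
    refine Finset.sum_congr rfl fun i _ => ?_
    congr 1
    simp only [Pi.mul_apply, hφ, mul_pow, Units.val_inv_eq_inv_val, Units.val_pow_eq_pow_val]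
    have : (τ i : E) ^ s ≠ 0 := pow_ne_zero _ (τ i).ne_zero
    field_simp
  · obtain ⟨w, hw₁, hw₂, hw₃, hw₄⟩ := hL _ e e' he β
    have hspan : ∀ (c : Fin (finrank F (Fin t → E)) → V),
        (∀ i, (w : V ≃ₗ[F] V) (c i) = c i) → ∀ v ∈ Submodule.span F (Set.range c),
        (w : V ≃ₗ[F] V) v = v := by
      intro c hc v hv
      induction hv using Submodule.span_induction with
      | mem x hx => obtain ⟨i, rfl⟩ := hx; exact hc i
      | zero => exact map_zero _
      | add x y _ _ hx hy => rw [map_add, hx, hy]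
      | smul a x _ hx => rw [map_smul, hx]
    exact ⟨w, hw₁, hw₂, hw₃, D.fixes (traceForm_left P.θ φ hφθ) (traceForm_right P.θ φ hφθ) w.2
      (fun m => hspan _ (fun i => (hw₄ i).1) _ (hD₁ m))
      (fun m => hspan _ (fun i => (hw₄ i).2) _ (hD₂ m))⟩
  · rw [← Units.val_pow_eq_pow_val, h, Units.val_one]
  · rw [inv_pow, inv_eq_one, ← pow_mul, mul_comm, pow_mul] at h
    have h2 := congrArg Units.val h
    rw [Units.val_pow_eq_pow_val, Units.val_pow_eq_pow_val, Units.val_one, ← hφ] at h2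
    exact φ.injective (h2.trans (map_one φ).symm)
  · refine D.eq_one_of_commute (traceForm_right P.θ φ hφθ) hx (fun i j h => ?_) hy hc h₁ hU
    exact hRψ _ (hτ i) _ (hτ j) (aeval_minpoly_comm h)

end FiniteClassical

namespace FiniteClassical

open Module

/-! ### Fixed spaces and generation -/

section FixedSpace

variable {F : Type*} [Field F] {V : Type*} [AddCommGroup V] [Module F V]

/-- The space of fixed vectors of `g`. -/
def fixedSpace (g : V ≃ₗ[F] V) : Submodule F V :=
  LinearMap.ker ((g : V →ₗ[F] V) - LinearMap.id)

theorem mem_fixedSpace {g : V ≃ₗ[F] V} {v : V} : v ∈ fixedSpace g ↔ g v = v := by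
  simp [fixedSpace, sub_eq_zero]

theorem degree_add_finrank_fixedSpace [FiniteDimensional F V] (g : V ≃ₗ[F] V) :
    degree g + finrank F (fixedSpace g) = finrank F V :=
  LinearMap.finrank_range_add_finrank_ker _

theorem exists_apply_ne {g : V ≃ₗ[F] V} (hg : g ≠ 1) : ∃ v, g v ≠ v := by
  by_contra! h
  exact hg (LinearEquiv.ext h)

theorem degree_pos [FiniteDimensional F V] {g : V ≃ₗ[F] V} (hg : g ≠ 1) : 1 ≤ degree g := by
  obtain ⟨v, hv⟩ := exists_apply_ne hg
  have h : fixedSpace g ≠ ⊤ := fun h => hv (mem_fixedSpace.1 (h ▸ Submodule.mem_top))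
  have h1 := Submodule.finrank_lt h
  have h2 := degree_add_finrank_fixedSpace g
  omega

theorem degree_conj (g h : V ≃ₗ[F] V) : degree (h * g * h⁻¹) = degree g := by
  have : LinearMap.range (((h * g * h⁻¹ : V ≃ₗ[F] V) : V →ₗ[F] V) - LinearMap.id)
      = (LinearMap.range ((g : V →ₗ[F] V) - LinearMap.id)).map (h : V →ₗ[F] V) := by
    ext v
    simp only [LinearMap.mem_range, Submodule.mem_map, exists_exists_eq_and, LinearMap.sub_apply,
      LinearMap.id_apply, LinearEquiv.coe_coe, map_sub, LinearEquiv.mul_apply]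
    constructor
    · rintro ⟨x, rfl⟩
      exact ⟨h⁻¹ x, by rw [show h (h⁻¹ x) = x from h.apply_symm_apply x]⟩
    · rintro ⟨x, rfl⟩
      exact ⟨h x, by rw [show h⁻¹ (h x) = x from h.symm_apply_apply x]⟩
  unfold degree
  rw [this]
  exact LinearEquiv.finrank_map_eq h _

theorem fixedSpace_lt {g h : V ≃ₗ[F] V} {v : V} (h₁ : ∀ x, g x = x → h x = x) (hv : g v ≠ v)
    (h₂ : h (g v) = v) : fixedSpace g < fixedSpace (h * g) := by
  refine lt_of_le_of_ne (fun x hx => ?_) fun e => ?_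
  · rw [mem_fixedSpace] at hx ⊢
    rw [LinearEquiv.mul_apply, hx, h₁ x hx]
  · have : v ∈ fixedSpace (h * g) := mem_fixedSpace.2 h₂
    rw [← e, mem_fixedSpace] at this
    exact hv this

/-- A subgroup is everything if every nontrivial element can be multiplied by an element of the
subgroup so that its fixed space grows. -/
theorem mem_of_forall_exists_fixedSpace_lt [FiniteDimensional F V] {G : Subgroup (V ≃ₗ[F] V)}
    (H : Subgroup G) (h : ∀ g : G, g ≠ 1 → ∃ k ∈ H, fixedSpace (g : V ≃ₗ[F] V) <
      fixedSpace ((k * g : G) : V ≃ₗ[F] V)) (g : G) : g ∈ H := by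
  induction hn : finrank F V - finrank F (fixedSpace (g : V ≃ₗ[F] V)) using
    Nat.strong_induction_on generalizing g with
  | _ n ih =>
    by_cases hg : g = 1
    · rw [hg]; exact H.one_mem
    obtain ⟨k, hk, hlt⟩ := h g hg
    have h1 := Submodule.finrank_lt_finrank_of_lt hlt
    have h2 := Submodule.finrank_le (fixedSpace ((k * g : G) : V ≃ₗ[F] V))
    have h3 := ih _ (by omega) (k * g) rfl
    exact (H.mul_mem_cancel_left hk).1 h3

theorem exists_apply_ne_zero_and {f g : V →ₗ[F] F} (hf : f ≠ 0) (hg : g ≠ 0) :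
    ∃ z, f z ≠ 0 ∧ g z ≠ 0 := by
  obtain ⟨x, hx⟩ := DFunLike.ne_iff.1 hf
  obtain ⟨y, hy⟩ := DFunLike.ne_iff.1 hg
  by_cases h1 : g x = 0
  · by_cases h2 : f y = 0
    · exact ⟨x + y, by simpa [h2] using hx, by simpa [h1] using hy⟩
    · exact ⟨y, h2, hy⟩
  · exact ⟨x, hx, h1⟩

theorem mem_minimalDegreeSet_of_degree_le_one [FiniteDimensional F V] {Γ : ClassicalForm F V}
    {g : V ≃ₗ[F] V} (h : g ∈ SCl Γ) (hg : g ≠ 1) (hd : degree g ≤ 1) : g ∈ minimalDegreeSet Γ :=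
  ⟨h, hg, fun _ _ hk => hd.trans (degree_pos hk)⟩

theorem degree_le_one_of_forall [FiniteDimensional F V] {g : V ≃ₗ[F] V} {a : V}
    (h : ∀ x, g x - x ∈ Submodule.span F {a}) : degree g ≤ 1 := by
  refine le_trans (Submodule.finrank_mono (t := Submodule.span F {a}) ?_) ((finrank_span_le_card {a}).trans (by simp))
  rintro _ ⟨x, rfl⟩
  exact h x

end FixedSpace

namespace PolarSpace

variable {F : Type*} [Field F] {V : Type*} [AddCommGroup V] [Module F V]

/-! ### Symplectic and unitary groups -/

/-- The map `x ↦ x + c f(a, x) a`. -/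
def quasiReflMap (P : PolarSpace F V) (a : V) (c : F) : V →ₗ[F] V :=
  LinearMap.id + (c • P.f a).smulRight a

theorem quasiReflMap_apply (P : PolarSpace F V) (a : V) (c : F) (x : V) :
    P.quasiReflMap a c x = x + (c * P.f a x) • a := by
  simp [quasiReflMap]

/-- The condition under which `x ↦ x + c f(a, x) a` preserves `f`. -/
def QuasiReflCond (P : PolarSpace F V) (a : V) (c : F) : Prop :=
  P.ε * c + P.θ c + c * P.θ c * P.f a a = 0

theorem θ_f_self (P : PolarSpace F V) (a : V) : P.θ (P.f a a) = P.ε * P.f a a := by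
  have := P.symm a a
  conv_rhs => rw [this, ← mul_assoc, P.ε_ε, one_mul]

/-- The transvection or quasi-reflection `x ↦ x + c f(a, x) a`, an isometry of `f`. -/
def quasiRefl (P : PolarSpace F V) (a : V) (c : F) (h : P.QuasiReflCond a c) : V ≃ₗ[F] V :=
  LinearEquiv.ofLinearMap (P.quasiReflMap a c) (P.quasiReflMap a (P.ε * P.θ c))
    (by
      ext x
      simp only [LinearMap.comp_apply, quasiReflMap_apply, LinearMap.id_apply, map_add, map_smul]
      have h' : P.ε * c + P.θ c + c * P.θ c * P.f a a = 0 := h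
      have e : c * (P.f a x + P.ε * P.θ c * P.f a x * P.f a a) + P.ε * P.θ c * P.f a x = 0 := by
        linear_combination (P.ε * P.f a x) * h' - (c * P.f a x) * P.ε_ε
      linear_combination (norm := module) e • a)
    (by
      ext x
      simp only [LinearMap.comp_apply, quasiReflMap_apply, LinearMap.id_apply, map_add, map_smul]
      have h' : P.ε * c + P.θ c + c * P.θ c * P.f a a = 0 := h
      have e : P.ε * P.θ c * (P.f a x + c * P.f a x * P.f a a) + c * P.f a x = 0 := by
        linear_combination (P.ε * P.f a x) * h' - (c * P.f a x) * P.ε_ε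
      linear_combination (norm := module) e • a)

variable {P : PolarSpace F V}

theorem quasiRefl_apply {a : V} {c : F} (h : P.QuasiReflCond a c) (x : V) :
    P.quasiRefl a c h x = x + (c * P.f a x) • a := P.quasiReflMap_apply a c x

theorem quasiRefl_mem (hQ : ∀ x, P.Q x = 0) {a : V} {c : F} (h : P.QuasiReflCond a c) :
    P.quasiRefl a c h ∈ P.group := by
  refine ⟨fun x y => ?_, fun x => by rw [hQ, hQ]⟩
  have h' : P.ε * c + P.θ c + c * P.θ c * P.f a a = 0 := h
  rw [quasiRefl_apply, quasiRefl_apply]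
  simp only [map_add, map_smul, LinearMap.add_apply, LinearMap.map_smulₛₗ, LinearMap.smul_apply,
    smul_eq_mul, map_mul]
  rw [P.symm a x]
  linear_combination (P.θ (P.f a x) * P.f a y) * h'

/-- `quasiRefl` as an element of the isometry group. -/
def qr (hQ : ∀ x, P.Q x = 0) (a : V) (c : F) (h : P.QuasiReflCond a c) : P.group :=
  ⟨P.quasiRefl a c h, quasiRefl_mem hQ h⟩

theorem qr_apply (hQ : ∀ x, P.Q x = 0) {a : V} {c : F} (h : P.QuasiReflCond a c) (x : V) :
    (qr hQ a c h : V ≃ₗ[F] V) x = x + (c * P.f a x) • a := quasiRefl_apply h x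

theorem group_ext {g h : P.group} (e : ∀ x, (g : V ≃ₗ[F] V) x = (h : V ≃ₗ[F] V) x) : g = h :=
  Subtype.ext (LinearEquiv.ext e)

theorem QuasiReflCond.map {a : V} {c : F} (h : P.QuasiReflCond a c) (g : P.group) :
    P.QuasiReflCond ((g : V ≃ₗ[F] V) a) c := by
  unfold QuasiReflCond
  rw [map_f g.2]
  exact h

theorem conj_qr (hQ : ∀ x, P.Q x = 0) {a : V} {c : F} (h : P.QuasiReflCond a c) (g : P.group) :
    g * qr hQ a c h * g⁻¹ = qr hQ ((g : V ≃ₗ[F] V) a) c (h.map g) := by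
  apply group_ext
  intro x
  have e : (g : V ≃ₗ[F] V) (((g⁻¹ : P.group) : V ≃ₗ[F] V) x) = x := (g : V ≃ₗ[F] V).apply_symm_apply x
  change (g : V ≃ₗ[F] V) ((qr hQ a c h : V ≃ₗ[F] V) (((g⁻¹ : P.group) : V ≃ₗ[F] V) x)) = _
  rw [qr_apply, qr_apply, map_add, map_smul, e]
  congr 3
  rw [← map_f g.2 a, e]

theorem of_qr_map (hQ : ∀ x, P.Q x = 0) {a b : V} {c : F} (h : P.QuasiReflCond a c) {g : P.group}
    (hg : (g : V ≃ₗ[F] V) a = b) (h' : P.QuasiReflCond b c) :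
    Abelianization.of (qr hQ b c h') = Abelianization.of (qr hQ a c h) := by
  subst hg
  rw [← conj_qr hQ h g, map_mul, map_mul, map_inv, mul_inv_cancel_comm]

/-- The quasi-reflection that maps `v` to `v'`. -/
theorem quasiReflCond_sub {v v' : V} (hvv : P.f v' v' = P.f v v) (hl : P.f (v - v') v ≠ 0) :
    P.QuasiReflCond (v - v') (-(P.f (v - v') v)⁻¹) := by
  have e : P.f (v - v') (v - v') = P.f (v - v') v + P.ε * P.θ (P.f (v - v') v) := by
    have h1 : P.f (v - v') v' = - (P.ε * P.θ (P.f (v - v') v)) := by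
      rw [← P.symm (v - v') v]
      simp only [map_sub, LinearMap.sub_apply, hvv]
      ring
    rw [map_sub, h1, sub_neg_eq_add]
  unfold QuasiReflCond
  rw [e]
  have hl' : P.θ (P.f (v - v') v) ≠ 0 := (map_ne_zero P.θ).2 hl
  rw [map_neg, map_inv₀]
  field_simp
  ring

theorem quasiRefl_sub_apply {v v' : V} (hl : P.f (v - v') v ≠ 0)
    (h : P.QuasiReflCond (v - v') (-(P.f (v - v') v)⁻¹)) :
    P.quasiRefl (v - v') (-(P.f (v - v') v)⁻¹) h v = v' := by
  rw [quasiRefl_apply, neg_mul, inv_mul_cancel₀ hl, neg_one_smul]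
  abel

theorem f_sub_eq_zero_of_fixed {g : V ≃ₗ[F] V} (hg : g ∈ P.group) {x : V} (hx : g x = x) (v : V) :
    P.f (g v - v) x = 0 := by
  rw [map_sub, LinearMap.sub_apply, ← map_f hg v x, hx, sub_self]

/-- The subgroup generated by all transvections and quasi-reflections. -/
def qrSubgroup (hQ : ∀ x, P.Q x = 0) : Subgroup P.group :=
  Subgroup.closure {g | ∃ a c h, g = qr hQ a c h}

theorem exists_qr_fixedSpace_lt (hQ : ∀ x, P.Q x = 0) (g : P.group) {v : V}
    (hv : P.f ((g : V ≃ₗ[F] V) v - v) ((g : V ≃ₗ[F] V) v) ≠ 0) :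
    ∃ k ∈ qrSubgroup hQ, fixedSpace (g : V ≃ₗ[F] V) < fixedSpace ((k * g : P.group) : V ≃ₗ[F] V) := by
  have hc := quasiReflCond_sub (map_f g.2 v v).symm hv
  refine ⟨qr hQ _ _ hc, Subgroup.subset_closure ⟨_, _, _, rfl⟩, ?_⟩
  refine fixedSpace_lt (v := v) (fun x hx => ?_) (fun h => hv ?_) (quasiRefl_sub_apply hv hc)
  · rw [qr_apply, f_sub_eq_zero_of_fixed g.2 hx, mul_zero, zero_smul, add_zero]
  · rw [h, sub_self, map_zero, LinearMap.zero_apply]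

/-- Unitary groups are generated by transvections and quasi-reflections: since `θ` is not the
identity, a sesquilinear form that vanishes on the diagonal vanishes. -/
theorem mem_qrSubgroup_of_θ_ne_id [FiniteDimensional F V] (hQ : ∀ x, P.Q x = 0) {t : F}
    (ht : P.θ t ≠ t) (g : P.group) : g ∈ qrSubgroup hQ := by
  refine mem_of_forall_exists_fixedSpace_lt _ (fun g hg => ?_) g
  by_contra hcon
  have h0 : ∀ v, P.f ((g : V ≃ₗ[F] V) v - v) ((g : V ≃ₗ[F] V) v) = 0 := fun v => by
    by_contra hv
    exact hcon (exists_qr_fixedSpace_lt hQ g hv)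
  have h1 : ∀ x y, P.f ((g : V ≃ₗ[F] V) x - x) ((g : V ≃ₗ[F] V) y)
      + P.f ((g : V ≃ₗ[F] V) y - y) ((g : V ≃ₗ[F] V) x) = 0 := by
    intro x y
    have h := h0 (x + y)
    have e : (g : V ≃ₗ[F] V) (x + y) - (x + y) =
      ((g : V ≃ₗ[F] V) x - x) + ((g : V ≃ₗ[F] V) y - y) := by rw [map_add]; abel
    rw [e, map_add (g : V ≃ₗ[F] V), map_add P.f, LinearMap.add_apply, map_add, map_add, h0, h0] at h
    linear_combination h
  have h2 : ∀ x y, P.f ((g : V ≃ₗ[F] V) x - x) ((g : V ≃ₗ[F] V) y) = 0 := by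
    intro x y
    have a := h1 x y
    have b := h1 (t • x) y
    have e : (g : V ≃ₗ[F] V) (t • x) - t • x = t • ((g : V ≃ₗ[F] V) x - x) := by
      rw [map_smul, smul_sub]
    rw [e, LinearMap.map_smulₛₗ, map_smul (g : V ≃ₗ[F] V), map_smul, LinearMap.smul_apply,
      smul_eq_mul, smul_eq_mul] at b
    have : (P.θ t - t) * P.f ((g : V ≃ₗ[F] V) x - x) ((g : V ≃ₗ[F] V) y) = 0 := by
      linear_combination b - t * a
    exact (mul_eq_zero.1 this).resolve_left (sub_ne_zero.2 ht)
  refine hg (group_ext fun x => ?_)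
  have : (g : V ≃ₗ[F] V) x - x = 0 := P.nondeg _ fun y => by
    have := h2 x ((g : V ≃ₗ[F] V).symm y)
    rwa [LinearEquiv.apply_symm_apply] at this
  exact sub_eq_zero.1 this

/-- Symplectic groups are generated by transvections. If `f (v, g v) = 0` for all `v`, then `g`
is first multiplied by a transvection that does not shrink the fixed space. -/
theorem mem_qrSubgroup_of_alternating [FiniteDimensional F V] (hQ : ∀ x, P.Q x = 0)
    (hf : ∀ x, P.f x x = 0) (h1 : P.ε + 1 = 0) (g : P.group) : g ∈ qrSubgroup hQ := by
  refine mem_of_forall_exists_fixedSpace_lt _ (fun g hg => ?_) g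
  by_cases hv : ∃ v, P.f ((g : V ≃ₗ[F] V) v - v) ((g : V ≃ₗ[F] V) v) ≠ 0
  · obtain ⟨v, hv⟩ := hv
    exact exists_qr_fixedSpace_lt hQ g hv
  push Not at hv
  have hv' : ∀ v, P.f v ((g : V ≃ₗ[F] V) v) = 0 := fun v => by
    have := hv v
    rw [map_sub, LinearMap.sub_apply, hf, zero_sub, neg_eq_zero] at this
    exact this
  have hgV : (g : V ≃ₗ[F] V) ≠ 1 := fun h => hg (Subtype.ext h)
  obtain ⟨w, hw⟩ := exists_apply_ne hgV
  set a := (g : V ≃ₗ[F] V) w - w with ha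
  have ha0 : a ≠ 0 := sub_ne_zero.2 hw
  have hc : P.QuasiReflCond a 1 := by
    unfold QuasiReflCond
    rw [hf, map_one]
    linear_combination h1
  have hfa : P.f a ≠ 0 := fun h => ha0 (P.nondeg a fun y => by rw [h]; rfl)
  have hfa' : (P.f a).comp ((g : V ≃ₗ[F] V) : V →ₗ[F] V) ≠ 0 := by
    intro h
    refine ha0 (P.nondeg a fun y => ?_)
    have := DFunLike.congr_fun h ((g : V ≃ₗ[F] V).symm y)
    simpa using this
  obtain ⟨v, hv₁, hv₂⟩ := exists_apply_ne_zero_and hfa hfa'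
  have hv₂' : P.f a ((g : V ≃ₗ[F] V) v) ≠ 0 := hv₂
  set s := qr hQ a 1 hc
  have hs : ∀ x, ((s * g : P.group) : V ≃ₗ[F] V) x
      = (g : V ≃ₗ[F] V) x + (P.f a ((g : V ≃ₗ[F] V) x)) • a := by
    intro x
    change (s : V ≃ₗ[F] V) ((g : V ≃ₗ[F] V) x) = _
    rw [qr_apply, one_mul]
  have hne : P.f (((s * g : P.group) : V ≃ₗ[F] V) v - v) (((s * g : P.group) : V ≃ₗ[F] V) v) ≠ 0 := by
    rw [map_sub, LinearMap.sub_apply, hf, zero_sub, neg_ne_zero, hs, map_add, hv', zero_add,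
      map_smul, smul_eq_mul]
    exact mul_ne_zero hv₂' (fun h => hv₁ (f_eq_zero_comm.1 h))
  obtain ⟨k, hk, hlt⟩ := exists_qr_fixedSpace_lt hQ (s * g) hne
  refine ⟨k * s, (qrSubgroup hQ).mul_mem hk (Subgroup.subset_closure ⟨_, _, _, rfl⟩), ?_⟩
  rw [mul_assoc]
  refine lt_of_le_of_lt (fun x hx => ?_) hlt
  rw [mem_fixedSpace] at hx ⊢
  rw [hs, hx, f_sub_eq_zero_of_fixed g.2 hx, zero_smul, add_zero]

theorem exists_map_eq (hQ : ∀ x, P.Q x = 0) {v v' : V} (hvv : P.f v' v' = P.f v v)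
    (hl : P.f (v - v') v ≠ 0) : ∃ g : P.group, (g : V ≃ₗ[F] V) v = v' :=
  ⟨qr hQ _ _ (quasiReflCond_sub hvv hl), quasiRefl_sub_apply hl (quasiReflCond_sub hvv hl)⟩

/-- The isometry group is transitive on the nonzero isotropic vectors. -/
theorem exists_map_eq_of_isotropic (hQ : ∀ x, P.Q x = 0) {v v' : V} (hv : P.f v v = 0)
    (hv' : P.f v' v' = 0) (h0 : v ≠ 0) (h0' : v' ≠ 0) :
    ∃ g : P.group, (g : V ≃ₗ[F] V) v = v' := by
  have key : ∀ {x y : V}, P.f x x = 0 → P.f y y = 0 → P.f y x ≠ 0 →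
      ∃ g : P.group, (g : V ≃ₗ[F] V) x = y := by
    intro x y hx hy hxy
    refine exists_map_eq hQ (by rw [hx, hy]) ?_
    rw [map_sub, LinearMap.sub_apply, hx, zero_sub, neg_ne_zero]
    exact hxy
  by_cases h : P.f v' v = 0
  · have n1 : P.f v ≠ 0 := fun e => h0 (P.nondeg v fun y => by rw [e]; rfl)
    have n2 : P.f v' ≠ 0 := fun e => h0' (P.nondeg v' fun y => by rw [e]; rfl)
    obtain ⟨z, hz₁, hz₂⟩ := exists_apply_ne_zero_and n1 n2
    obtain ⟨k, hk, -⟩ := P.exists_adjust v ((P.f v z)⁻¹ • z) hv (hQ v)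
      (by rw [map_smul, smul_eq_mul, inv_mul_cancel₀ hz₁])
    set z' := (P.f v z)⁻¹ • z + k • v
    have h₁ : P.f v z' ≠ 0 := by
      simp only [z', map_add, map_smul, smul_eq_mul, hv, mul_zero, add_zero]
      exact mul_ne_zero (inv_ne_zero hz₁) hz₁
    have h₂ : P.f v' z' ≠ 0 := by
      simp only [z', map_add, map_smul, smul_eq_mul, h, mul_zero, add_zero]
      exact mul_ne_zero (inv_ne_zero hz₁) hz₂
    obtain ⟨g₁, hg₁⟩ := key hv hk fun e => h₁ (f_eq_zero_comm.1 e)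
    obtain ⟨g₂, hg₂⟩ := key hk hv' h₂
    exact ⟨g₂ * g₁, by rw [← hg₂, ← hg₁]; rfl⟩
  · exact key hv hv' h

theorem quasiReflCond_of_isotropic {a : V} {c : F} (ha : P.f a a = 0) (hc : P.ε * c + P.θ c = 0) :
    P.QuasiReflCond a c := by
  unfold QuasiReflCond
  rw [ha, mul_zero, add_zero]
  exact hc

theorem of_qr_zero (hQ : ∀ x, P.Q x = 0) {c : F} (h : P.QuasiReflCond 0 c) : qr hQ 0 c h = 1 :=
  group_ext fun x => by rw [qr_apply, smul_zero, add_zero]; rfl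

/-- Transvections lie in the derived subgroup. All those with the same parameter are conjugate, and
polarising the quadratic map `a ↦ qr a c` on a totally isotropic space gives a relation between
four of them and three of them. -/
theorem of_qr_eq_one_of_isotropic (hQ : ∀ x, P.Q x = 0) {e e' : Fin 3 → V}
    (he : P.IsHyperbolic e e') {a : V} {c : F} (ha : P.f a a = 0) (h : P.QuasiReflCond a c) :
    Abelianization.of (qr hQ a c h) = 1 := by
  rcases eq_or_ne a 0 with rfl | ha0
  · rw [of_qr_zero, map_one]
  have hc : P.ε * c + P.θ c = 0 := by
    unfold QuasiReflCond at h
    rwa [ha, mul_zero, add_zero] at h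
  have hall : ∀ b (hb : P.QuasiReflCond b c), P.f b b = 0 → b ≠ 0 →
      Abelianization.of (qr hQ b c hb) = Abelianization.of (qr hQ a c h) := by
    intro b hb hbb hb0
    obtain ⟨g, hg⟩ := exists_map_eq_of_isotropic hQ ha hbb ha0 hb0
    exact of_qr_map hQ h hg hb
  have hf : ∀ i j, P.f (e i) (e j) = 0 := he.ee
  have hne : ∀ (b : V) (i : Fin 3), P.f b (e' i) = 1 → b ≠ 0 := by
    rintro b i hb rfl
    simp at hb
  have h3 : ∀ i, P.f (e i) (e i) = 0 := fun i => hf i i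
  have h2 : ∀ i j, P.f (e i + e j) (e i + e j) = 0 := fun i j => by simp [hf]
  have h1 : P.f (e 0 + e 1 + e 2) (e 0 + e 1 + e 2) = 0 := by simp [hf]
  have q : ∀ {b : V}, P.f b b = 0 → P.QuasiReflCond b c := fun hb => quasiReflCond_of_isotropic hb hc
  have key : qr hQ _ c (q h1) * qr hQ _ c (q (h3 0)) * qr hQ _ c (q (h3 1)) * qr hQ _ c (q (h3 2))
      = qr hQ _ c (q (h2 0 1)) * qr hQ _ c (q (h2 0 2)) * qr hQ _ c (q (h2 1 2)) := by
    apply group_ext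
    intro x
    simp only [Subgroup.coe_mul, LinearEquiv.mul_apply, qr_apply, map_add, map_smul,
      LinearMap.add_apply, hf, mul_zero, add_zero]
    module
  have := congrArg (Abelianization.of (G := P.group)) key
  simp only [map_mul] at this
  rw [hall _ _ h1 (hne _ 0 (by simp [he.ee'])), hall _ _ (h3 0) (hne _ 0 (by simp [he.ee'])),
    hall _ _ (h3 1) (hne _ 1 (by simp [he.ee'])), hall _ _ (h3 2) (hne _ 2 (by simp [he.ee'])),
    hall _ _ (h2 0 1) (hne _ 0 (by simp [he.ee'])), hall _ _ (h2 0 2) (hne _ 0 (by simp [he.ee'])),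
    hall _ _ (h2 1 2) (hne _ 1 (by simp [he.ee']))] at this
  exact mul_eq_left.1 this

end PolarSpace

end FiniteClassical

namespace FiniteClassical

open Module

/-! ### Representatives of the abelianisation: symplectic and unitary groups -/

namespace PolarSpace

variable {F : Type*} [Field F] {V : Type*} [AddCommGroup V] [Module F V] {P : PolarSpace F V}

theorem qr_pow_apply_of_isotropic (hQ : ∀ x, P.Q x = 0) {a : V} {c : F} (h : P.QuasiReflCond a c)
    (ha : P.f a a = 0) (n : ℕ) (x : V) :
    ((qr hQ a c h ^ n : P.group) : V ≃ₗ[F] V) x = x + ((n * c) * P.f a x) • a := by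
  induction n with
  | zero => simp
  | succ n ih =>
    rw [pow_succ', Subgroup.coe_mul, LinearEquiv.mul_apply, ih, qr_apply, map_add, map_smul, ha]
    push_cast
    simp only [smul_eq_mul]
    module

theorem qr_pow_apply_of_f_eq_one (hQ : ∀ x, P.Q x = 0) {a : V} {c : F} (h : P.QuasiReflCond a c)
    (ha : P.f a a = 1) (n : ℕ) (x : V) :
    ((qr hQ a c h ^ n : P.group) : V ≃ₗ[F] V) x = x + (((1 + c) ^ n - 1) * P.f a x) • a := by
  induction n with
  | zero => simp
  | succ n ih =>
    rw [pow_succ', Subgroup.coe_mul, LinearEquiv.mul_apply, ih, qr_apply, map_add, map_smul, ha,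
      pow_succ]
    simp only [smul_eq_mul]
    module

theorem commute_qr (hQ : ∀ x, P.Q x = 0) {a : V} {c : F} (h : P.QuasiReflCond a c) {g : P.group}
    (hg : (g : V ≃ₗ[F] V) a = a) : Commute (qr hQ a c h) g := by
  have e : g * qr hQ a c h * g⁻¹ = qr hQ a c h := by
    rw [conj_qr]
    congr 1
  exact (mul_inv_eq_iff_eq_mul.1 e).symm

theorem qr_apply_of_f_eq_zero (hQ : ∀ x, P.Q x = 0) {a : V} {c : F} (h : P.QuasiReflCond a c)
    {x : V} (hx : P.f a x = 0) : (qr hQ a c h : V ≃ₗ[F] V) x = x := by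
  rw [qr_apply, hx, mul_zero, zero_smul, add_zero]

theorem IsHyperbolic.e_ne_zero {I : Type*} [DecidableEq I] {e e' : I → V}
    (he : P.IsHyperbolic e e') (i : I) : e i ≠ 0 := fun h => by
  have := he.ee' i i
  simp [h] at this

/-- Representatives of the classes of the abelianisation in symplectic and unitary groups: the
product of a transvection in one hyperbolic plane and an element of order dividing `q - 1` that is
supported on another one. -/
theorem exists_rep_of_torsion_rep [Finite F] (hQ : ∀ x, P.Q x = 0) {c₀ : F} (hc₀ : c₀ ≠ 0)
    (hc : P.ε * c₀ + P.θ c₀ = 0) {k : ℕ} (hk : ((k : ℕ) : F) + 1 = 0) (hk' : Nat.card F - 1 ∣ k)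
    {S : Set (V ≃ₗ[F] V)} (hS : ∀ a c (h : P.QuasiReflCond a c), P.f a a = 0 → a ≠ 0 → c ≠ 0 →
      P.quasiRefl a c h ∈ S) {m : ℕ} {e e' : Fin (m + 5) → V} (he : P.IsHyperbolic e e')
    (hD : ∀ β : Abelianization P.group, ∃ D : P.group, Abelianization.of D = β ∧
      D ^ (Nat.card F - 1) = 1 ∧ ∀ i ≠ Fin.natAdd m 1,
        (D : V ≃ₗ[F] V) (e i) = e i ∧ (D : V ≃ₗ[F] V) (e' i) = e' i)
    (β : Abelianization P.group) : ∃ w : P.group, Abelianization.of w = β ∧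
        (w : V ≃ₗ[F] V) ^ ((Nat.card F - 1) * Nat.card F ^ 2) = 1 ∧ (w : V ≃ₗ[F] V) ^ k ∈ S ∧
        ∀ i : Fin m, (w : V ≃ₗ[F] V) (e (Fin.castAdd 5 i)) = e (Fin.castAdd 5 i) ∧
          (w : V ≃ₗ[F] V) (e' (Fin.castAdd 5 i)) = e' (Fin.castAdd 5 i) := by
  set j : Fin (m + 5) := Fin.natAdd m 0
  have hj : j ≠ Fin.natAdd m 1 := by simp [j, Fin.ext_iff]
  have hcond : P.QuasiReflCond (e j) c₀ := quasiReflCond_of_isotropic (he.ee j j) hc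
  set u := qr hQ (e j) c₀ hcond
  obtain ⟨D, hD₁, hD₂, hD₃⟩ := hD (β * (Abelianization.of u)⁻¹)
  have hcomm : Commute u D := commute_qr hQ hcond (hD₃ j hj).1
  have := Fintype.ofFinite F
  have hcast : ((Nat.card F : ℕ) : F) = 0 := by
    rw [Nat.card_eq_fintype_card, Nat.cast_card_eq_zero]
  have hu : u ^ ((Nat.card F - 1) * Nat.card F ^ 2) = 1 := by
    refine group_ext fun x => ?_
    rw [qr_pow_apply_of_isotropic hQ hcond (he.ee j j)]
    push_cast
    rw [hcast]
    simp
  refine ⟨u * D, ?_, ?_, ?_, fun i => ?_⟩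
  · rw [map_mul, hD₁, mul_comm β, mul_inv_cancel_left]
  · have : (u * D) ^ ((Nat.card F - 1) * Nat.card F ^ 2) = 1 := by
      rw [hcomm.mul_pow, hu, pow_mul D, hD₂, one_pow, one_mul]
    exact congrArg Subtype.val this
  · have hcond' : P.QuasiReflCond (e j) (-c₀) :=
      quasiReflCond_of_isotropic (he.ee j j) (by rw [map_neg]; linear_combination -hc)
    have : (u * D) ^ k = qr hQ (e j) (-c₀) hcond' := by
      obtain ⟨l, rfl⟩ := hk'
      rw [hcomm.mul_pow, pow_mul D, hD₂, one_pow, mul_one]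
      refine group_ext fun x => ?_
      rw [qr_pow_apply_of_isotropic hQ hcond (he.ee j j), qr_apply]
      congr 3
      linear_combination c₀ * hk
    change (((u * D) ^ k : P.group) : V ≃ₗ[F] V) ∈ S
    rw [this]
    exact hS _ _ hcond' (he.ee j j) (he.e_ne_zero j) (neg_ne_zero.2 hc₀)
  · have h1 : Fin.castAdd 5 i ≠ Fin.natAdd m 1 := by
      have := i.2
      simp only [ne_eq, Fin.ext_iff, Fin.val_castAdd, Fin.val_natAdd]
      omega
    have h0 : j ≠ Fin.castAdd 5 i := by
      have := i.2
      simp only [j, ne_eq, Fin.ext_iff, Fin.val_castAdd, Fin.val_natAdd]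
      omega
    constructor
    · rw [Subgroup.coe_mul, LinearEquiv.mul_apply, (hD₃ _ h1).1]
      exact qr_apply_of_f_eq_zero hQ hcond (he.ee _ _)
    · rw [Subgroup.coe_mul, LinearEquiv.mul_apply, (hD₃ _ h1).2]
      exact qr_apply_of_f_eq_zero hQ hcond (by rw [he.ee', if_neg h0])

/-- Symplectic groups of rank at least three are perfect. -/
theorem abelianization_eq_one_of_alternating [FiniteDimensional F V] (hQ : ∀ x, P.Q x = 0)
    (hf : ∀ x, P.f x x = 0) (h1 : P.ε + 1 = 0) {e e' : Fin 3 → V} (he : P.IsHyperbolic e e')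
    (β : Abelianization P.group) : β = 1 := by
  obtain ⟨g, rfl⟩ := QuotientGroup.mk_surjective β
  change Abelianization.of g = 1
  have hg := mem_qrSubgroup_of_alternating hQ hf h1 g
  induction hg using Subgroup.closure_induction with
  | mem g hg =>
    obtain ⟨a, c, h, rfl⟩ := hg
    exact of_qr_eq_one_of_isotropic hQ he (hf a) h
  | one => exact map_one _
  | mul x y _ _ hx hy => rw [map_mul, hx, hy, one_mul]
  | inv x _ hx => rw [map_inv, hx, inv_one]

/-- Quasi-reflections along vectors `a` with `f a a = 1` are determined up to conjugacy by their
parameter. -/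
theorem of_qr_eq_of_f_eq_one (hQ : ∀ x, P.Q x = 0) {ζ : F} (hζ : P.θ ζ * ζ = 1) (hζ1 : ζ ≠ 1)
    {a b : V} {c : F} (ha : P.f a a = 1) (hb : P.f b b = 1) (h : P.QuasiReflCond a c)
    (h' : P.QuasiReflCond b c) :
    Abelianization.of (qr hQ b c h') = Abelianization.of (qr hQ a c h) := by
  have key : ∀ {x : V} (hx : P.QuasiReflCond x c), P.f x x = 1 → P.f b x ≠ 1 →
      Abelianization.of (qr hQ b c h') = Abelianization.of (qr hQ x c hx) := by
    intro x hx hxx hbx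
    obtain ⟨g, hg⟩ := exists_map_eq hQ (v := x) (v' := b) (by rw [hb, hxx]) (by
      rw [map_sub, LinearMap.sub_apply, hxx]
      exact sub_ne_zero.2 (Ne.symm hbx))
    exact of_qr_map hQ hx hg h'
  by_cases hba : P.f b a = 1
  · have hζf : P.f (ζ • a) (ζ • a) = 1 := by
      rw [LinearMap.map_smulₛₗ P.f, LinearMap.smul_apply, map_smul, ha]
      simpa using hζ
    have hx : P.QuasiReflCond (ζ • a) c := by
      unfold QuasiReflCond at h ⊢
      rw [hζf]
      rwa [ha] at h
    rw [key hx hζf (by rw [map_smul, hba]; simpa using hζ1)]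
    congr 1
    refine group_ext fun x => ?_
    rw [qr_apply, qr_apply, LinearMap.map_smulₛₗ, LinearMap.smul_apply, smul_smul, smul_eq_mul]
    congr 2
    linear_combination (c * P.f a x) * hζ
  · exact key h ha hba

/-- The abelianisation of a unitary group is represented by quasi-reflections along a fixed
vector `a₀` with `f a₀ a₀ = 1`. -/
theorem exists_of_qr_eq [FiniteDimensional F V] (hQ : ∀ x, P.Q x = 0) (hε : P.ε = 1) {ζ : F}
    (hζ : P.θ ζ * ζ = 1) (hζ1 : ζ ≠ 1) (hnorm : ∀ γ, P.θ γ = γ → γ ≠ 0 → ∃ l, P.θ l * l = γ) {t : F}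
    (ht : P.θ t ≠ t) {e e' : Fin 3 → V} (he : P.IsHyperbolic e e') {a₀ : V} (ha₀ : P.f a₀ a₀ = 1)
    (β : Abelianization P.group) : ∃ c h, Abelianization.of (qr hQ a₀ c h) = β := by
  have h0 : P.QuasiReflCond a₀ 0 := by simp [QuasiReflCond]
  have h0' : qr hQ a₀ 0 h0 = 1 := group_ext fun x => by rw [qr_apply]; simp
  have hmul : ∀ {c c'} (h : P.QuasiReflCond a₀ c) (h' : P.QuasiReflCond a₀ c'),
      ∃ h'', qr hQ a₀ c h * qr hQ a₀ c' h' = qr hQ a₀ (c + c' + c * c') h'' := by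
    intro c c' h h'
    have hc : P.ε * c + P.θ c + c * P.θ c * P.f a₀ a₀ = 0 := h
    have hc' : P.ε * c' + P.θ c' + c' * P.θ c' * P.f a₀ a₀ = 0 := h'
    have h'' : P.QuasiReflCond a₀ (c + c' + c * c') := by
      unfold QuasiReflCond
      rw [ha₀, hε] at hc hc' ⊢
      simp only [map_add, map_mul]
      linear_combination (1 + c' + P.θ c' + c' * P.θ c') * hc + hc'
    refine ⟨h'', group_ext fun x => ?_⟩
    rw [Subgroup.coe_mul, LinearEquiv.mul_apply, qr_apply, qr_apply, qr_apply, map_add, map_smul,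
      ha₀]
    simp only [smul_eq_mul]
    module
  have hinv : ∀ {c} (h : P.QuasiReflCond a₀ c), ∃ c' h', (qr hQ a₀ c h)⁻¹ = qr hQ a₀ c' h' := by
    intro c h
    have hc : P.ε * c + P.θ c + c * P.θ c * P.f a₀ a₀ = 0 := h
    have h' : P.QuasiReflCond a₀ (P.θ c) := by
      unfold QuasiReflCond
      rw [P.θ_θ]
      rw [hε] at hc ⊢
      linear_combination hc
    refine ⟨_, h', inv_eq_of_mul_eq_one_right ?_⟩
    obtain ⟨h'', e⟩ := hmul h h'
    rw [e]
    refine group_ext fun x => ?_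
    have : c + P.θ c + c * P.θ c = 0 := by
      rw [hε, ha₀] at hc
      linear_combination hc
    rw [qr_apply, this]
    simp
  obtain ⟨g, rfl⟩ := QuotientGroup.mk_surjective β
  change ∃ c h, Abelianization.of (qr hQ a₀ c h) = Abelianization.of g
  have hg := mem_qrSubgroup_of_θ_ne_id hQ ht g
  induction hg using Subgroup.closure_induction with
  | mem g hg =>
    obtain ⟨a, c, h, rfl⟩ := hg
    by_cases ha : P.f a a = 0
    · exact ⟨0, h0, by rw [h0', map_one, of_qr_eq_one_of_isotropic hQ he ha h]⟩
    · obtain ⟨l, hl⟩ := hnorm (P.f a a) (by rw [θ_f_self, hε, one_mul]) ha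
      have hl0 : l ≠ 0 := by rintro rfl; exact ha (by rw [← hl]; simp)
      have hl0' : P.θ l ≠ 0 := (map_ne_zero P.θ).2 hl0
      set b := l⁻¹ • a
      have hab : a = l • b := by simp [b, smul_smul, hl0]
      have hb : P.f b b = 1 := by
        simp only [b, LinearMap.map_smulₛₗ, LinearMap.smul_apply, map_inv₀, map_smul, smul_eq_mul,
          ← hl]
        field_simp
      have hcond : ∀ v, P.f v v = 1 → P.QuasiReflCond v (c * P.f a a) := by
        intro v hv
        have hc : P.ε * c + P.θ c + c * P.θ c * P.f a a = 0 := h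
        unfold QuasiReflCond
        rw [map_mul, θ_f_self, hv]
        rw [hε] at hc ⊢
        linear_combination P.f a a * hc
      refine ⟨c * P.f a a, hcond _ ha₀, ?_⟩
      rw [of_qr_eq_of_f_eq_one hQ hζ hζ1 hb ha₀ (hcond _ hb) (hcond _ ha₀)]
      congr 1
      refine group_ext fun x => ?_
      rw [qr_apply, qr_apply, ← hl]
      conv_rhs => rw [hab, LinearMap.map_smulₛₗ, LinearMap.smul_apply, smul_smul, smul_eq_mul]
      congr 2
      ring
  | one => exact ⟨0, h0, by rw [h0']⟩
  | mul x y _ _ hx hy =>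
    obtain ⟨c, h, hx⟩ := hx
    obtain ⟨c', h', hy⟩ := hy
    obtain ⟨h'', e⟩ := hmul h h'
    exact ⟨_, h'', by rw [← e, map_mul, hx, hy, map_mul]⟩
  | inv x _ hx =>
    obtain ⟨c, h, hx⟩ := hx
    obtain ⟨c', h', e⟩ := hinv h
    exact ⟨_, h', by rw [← e, map_inv, hx, map_inv]⟩

theorem exists_torsion_rep_unitary [Finite F] [FiniteDimensional F V] (hQ : ∀ x, P.Q x = 0)
    (hε : P.ε = 1) {ζ : F} (hζ : P.θ ζ * ζ = 1) (hζ1 : ζ ≠ 1)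
    (hnorm : ∀ γ, P.θ γ = γ → γ ≠ 0 → ∃ l, P.θ l * l = γ) {t : F} (ht : P.θ t ≠ t) {y : F}
    (hy : y + P.θ y = 1) {m : ℕ} {e e' : Fin (m + 5) → V} (he : P.IsHyperbolic e e')
    (β : Abelianization P.group) : ∃ D : P.group, Abelianization.of D = β ∧
      D ^ (Nat.card F - 1) = 1 ∧ ∀ i ≠ Fin.natAdd m 1,
        (D : V ≃ₗ[F] V) (e i) = e i ∧ (D : V ≃ₗ[F] V) (e' i) = e' i := by
  set j : Fin (m + 5) := Fin.natAdd m 1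
  set a₀ := e j + y • e' j
  have ha₀ : P.f a₀ a₀ = 1 := by
    simp only [a₀, map_add, map_smul, LinearMap.add_apply, LinearMap.map_smulₛₗ,
      LinearMap.smul_apply, he.ee, he.ee', he.e'e, he.e'e', smul_eq_mul, hε, if_true]
    linear_combination hy
  let φ : Fin 3 → Fin (m + 5) := fun i => Fin.natAdd m (Fin.castLE (by norm_num) i)
  have hφ : Function.Injective φ := fun i i' h => by
    simpa [φ, Fin.ext_iff] using h
  obtain ⟨c, h, hc⟩ := exists_of_qr_eq hQ hε hζ hζ1 hnorm ht (he.comp hφ) ha₀ β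
  refine ⟨_, hc, group_ext fun x => ?_, fun i hi => ⟨?_, ?_⟩⟩
  · have hcc : P.ε * c + P.θ c + c * P.θ c * P.f a₀ a₀ = 0 := h
    rw [hε, ha₀] at hcc
    have hne : 1 + c ≠ 0 := by
      intro h0
      have : (1 + c) * (1 + P.θ c) = 1 := by linear_combination hcc
      rw [h0, zero_mul] at this
      exact zero_ne_one this
    have := Fintype.ofFinite F
    rw [qr_pow_apply_of_f_eq_one hQ h ha₀, Nat.card_eq_fintype_card,
      FiniteField.pow_card_sub_one_eq_one _ hne]
    simp
  · refine qr_apply_of_f_eq_zero hQ h ?_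
    simp [a₀, he.ee, he.e'e, hi.symm]
  · refine qr_apply_of_f_eq_zero hQ h ?_
    simp [a₀, he.ee', he.e'e', hi.symm]

end PolarSpace

end FiniteClassical

namespace FiniteClassical

open Module

/-! ### Involutions of finite fields -/

section Involution

variable {F : Type*} [Field F]

/-- An involutive automorphism of a finite field of order `q` is the power map with exponent the
square root of `q`. -/
theorem exists_sq_eq_card_of_involutive [Finite F] {θ : F →+* F} (h : ∀ a, θ (θ a) = a)
    (hne : θ ≠ RingHom.id F) : ∃ s, s ^ 2 = Nat.card F ∧ ∀ a, θ a = a ^ s := by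
  have := Fintype.ofFinite F
  obtain ⟨p, hp⟩ := CharP.exists F
  have := Fact.mk (CharP.char_is_prime F p)
  algebraize [ZMod.castHom (dvd_refl p) F]
  have hcomm : ∀ r : ZMod p, θ (algebraMap (ZMod p) F r) = algebraMap (ZMod p) F r := fun r =>
    RingHom.congr_fun (Subsingleton.elim (θ.comp (algebraMap (ZMod p) F)) (algebraMap (ZMod p) F)) r
  let Θ : F ≃ₐ[ZMod p] F := AlgEquiv.ofBijective { θ with commutes' := hcomm }
    (Finite.injective_iff_bijective.1 θ.injective)
  obtain ⟨⟨i, hi⟩, hΘ⟩ := (FiniteField.bijective_frobeniusAlgEquivOfAlgebraic_pow (ZMod p) F).2 Θ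
  have hΘ2 : Θ ^ 2 = 1 := AlgEquiv.ext fun a => h a
  have hΘ1 : Θ ≠ 1 := fun e => hne (RingHom.ext fun a => AlgEquiv.congr_fun e a)
  change FiniteField.frobeniusAlgEquivOfAlgebraic (ZMod p) F ^ i = Θ at hΘ
  have hdvd : finrank (ZMod p) F ∣ i * 2 := by
    rw [← FiniteField.orderOf_frobeniusAlgEquivOfAlgebraic, orderOf_dvd_iff_pow_eq_one, pow_mul, hΘ,
      hΘ2]
  have hi0 : i ≠ 0 := by
    rintro rfl
    exact hΘ1 (by rw [← hΘ, pow_zero])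
  have hi2 : i * 2 = finrank (ZMod p) F := by
    obtain ⟨c, hc⟩ := hdvd
    have : c = 1 := by
      rcases c with _ | _ | c
      · omega
      · rfl
      · nlinarith
    rw [hc, this, mul_one]
  refine ⟨p ^ i, ?_, fun a => ?_⟩
  · rw [← pow_mul, hi2, Module.natCard_eq_pow_finrank (K := ZMod p) (V := F), Nat.card_zmod]
  · have : θ a = (FiniteField.frobeniusAlgEquivOfAlgebraic (ZMod p) F ^ i) a := by rw [hΘ]; rfl
    rw [this, AlgEquiv.coe_pow, FiniteField.coe_frobeniusAlgEquivOfAlgebraic_iterate, ZMod.card]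

theorem exists_apply_ne_of_ne_id {θ : F →+* F} (hne : θ ≠ RingHom.id F) : ∃ t, θ t ≠ t := by
  by_contra! h
  exact hne (RingHom.ext h)

theorem exists_add_apply_eq_one {θ : F →+* F} (h : ∀ a, θ (θ a) = a)
    (hne : θ ≠ RingHom.id F) : ∃ y, y + θ y = 1 := by
  by_cases hx : ∃ x, x + θ x ≠ 0
  · obtain ⟨x, hx⟩ := hx
    refine ⟨x / (x + θ x), ?_⟩
    rw [map_div₀, map_add, h, add_comm (θ x) x, ← add_div, div_self hx]
  · push Not at hx
    refine absurd (RingHom.ext fun x => ?_) hne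
    have h1 := hx 1
    rw [map_one] at h1
    rw [RingHom.id_apply]
    linear_combination hx x - x * h1

theorem exists_norm_eq_one_ne_one {θ : F →+* F} (h : ∀ a, θ (θ a) = a)
    (hne : θ ≠ RingHom.id F) : ∃ ζ, θ ζ * ζ = 1 ∧ ζ ≠ 1 := by
  obtain ⟨t, ht⟩ := exists_apply_ne_of_ne_id hne
  have ht0 : t ≠ 0 := by rintro rfl; simp at ht
  have ht0' : θ t ≠ 0 := (map_ne_zero θ).2 ht0
  refine ⟨θ t / t, ?_, fun e => ht ?_⟩
  · rw [map_div₀, h]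
    field_simp
  · rwa [div_eq_one_iff_eq ht0] at e

/-- The norm map onto the fixed field of an involution of a finite field is surjective. -/
theorem exists_norm_eq [Finite F] {θ : F →+* F} (h : ∀ a, θ (θ a) = a)
    (hne : θ ≠ RingHom.id F) {γ : F} (hγ : θ γ = γ) (h0 : γ ≠ 0) : ∃ l, θ l * l = γ := by
  obtain ⟨s, hs, hθ⟩ := exists_sq_eq_card_of_involutive h hne
  have hcard : 1 < Nat.card F := Finite.one_lt_card
  have hs1 : 1 < s := by
    by_contra hcon
    have : s ^ 2 ≤ 1 ^ 2 := Nat.pow_le_pow_left (by omega) 2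
    omega
  obtain ⟨g, hg⟩ := IsCyclic.exists_generator (α := Fˣ)
  obtain ⟨i, hi⟩ := (Submonoid.mem_powers_iff _ _).1
    ((mem_powers_iff_mem_zpowers (x := g)).2 (hg (Units.mk0 γ h0)))
  have hord : orderOf g = (s - 1) * (s + 1) := by
    rw [orderOf_eq_card_of_forall_mem_zpowers hg, Nat.card_units, ← hs, mul_comm, ← Nat.sq_sub_sq,
      one_pow]
  have hu : Units.mk0 γ h0 ^ (s - 1) = 1 := by
    have : Units.mk0 γ h0 ^ s = Units.mk0 γ h0 := Units.ext (by simpa [hθ] using hγ)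
    have e : s - 1 + 1 = s := by omega
    rw [← e, pow_succ] at this
    exact mul_eq_right.1 this
  rw [← hi, ← pow_mul, ← orderOf_dvd_iff_pow_eq_one, hord, mul_comm i] at hu
  obtain ⟨j, hj⟩ := Nat.dvd_of_mul_dvd_mul_left (by omega) hu
  refine ⟨((g ^ j : Fˣ) : F), ?_⟩
  have := congrArg Units.val hi
  rw [hj, mul_comm, pow_mul] at this
  rw [hθ, ← pow_succ]
  simpa using this

end Involution

/-! ### Symplectic and unitary spaces as polar spaces -/

section Instances

variable {F : Type*} [Field F] {V : Type*} [AddCommGroup V] [Module F V]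

theorem exists_mem_ne_zero_of_finrank_pos {W : Submodule F V} (h : 1 ≤ finrank F W) :
    ∃ a ∈ W, a ≠ 0 :=
  W.exists_mem_ne_zero_of_ne_bot fun e => by rw [e, finrank_bot] at h; omega

/-- The polar space of a nondegenerate alternating form. -/
def symplecticSpace (f : V →ₗ[F] V →ₗ[F] F) (alt : ∀ x, f x x = 0) (nondeg : f.Nondegenerate) :
    PolarSpace F V where
  θ := RingHom.id F
  ε := -1
  η := 0
  f := f
  Q := fun _ => 0
  θ_θ _ := rfl
  θ_ε := rfl
  ε_ε := by ring
  η_symm c := by simp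
  symm x y := by
    rw [RingHom.id_apply, neg_one_mul]
    exact (LinearMap.IsAlt.neg (B := f) alt x y).symm
  nondeg := nondeg.1
  Q_add _ _ := by simp
  Q_smul _ _ _ := rfl
  exists_singular W hW := by
    obtain ⟨a, ha, h0⟩ := exists_mem_ne_zero_of_finrank_pos (W := W) (by omega)
    exact ⟨a, ha, h0, alt a, rfl⟩
  exists_adjust a b _ _ _ := ⟨0, alt _, rfl⟩

/-- The polar space of a nondegenerate hermitian form. -/
def unitarySpace [Finite F] [FiniteDimensional F V] (θ : F →+* F) (invol : ∀ a, θ (θ a) = a)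
    (ne_id : θ ≠ RingHom.id F) (f : V →ₛₗ[θ] V →ₗ[F] F) (herm : ∀ x y, θ (f x y) = f y x)
    (nondeg : f.Nondegenerate) : PolarSpace F V where
  θ := θ
  ε := 1
  η := 0
  f := f
  Q := fun _ => 0
  θ_θ := invol
  θ_ε := map_one θ
  ε_ε := by ring
  η_symm c := by simp
  symm x y := by rw [herm, one_mul]
  nondeg := nondeg.1
  Q_add _ _ := by simp
  Q_smul _ _ _ := rfl
  exists_singular W hW := by
    obtain ⟨a, ha, h0⟩ := exists_mem_ne_zero_of_finrank_pos (W := W) (by omega)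
    by_cases haa : f a a = 0
    · exact ⟨a, ha, h0, haa, rfl⟩
    have hker : 1 ≤ finrank F (LinearMap.ker (f a ∘ₗ W.subtype)) := by
      have h1 := LinearMap.finrank_range_add_finrank_ker (f a ∘ₗ W.subtype)
      have h2 := Submodule.finrank_le (LinearMap.range (f a ∘ₗ W.subtype))
      rw [finrank_self] at h2
      omega
    obtain ⟨⟨b, hbW⟩, hb, hb0⟩ := exists_mem_ne_zero_of_finrank_pos hker
    have hab : f a b = 0 := hb
    have hba : f b a = 0 := by rw [← herm, hab, map_zero]
    have hb0' : b ≠ 0 := fun e => hb0 (Subtype.ext e)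
    by_cases hbb : f b b = 0
    · exact ⟨b, hbW, hb0', hbb, rfl⟩
    obtain ⟨l, hl⟩ := exists_norm_eq invol ne_id (γ := -(f a a / f b b))
      (by rw [map_neg, map_div₀, herm, herm]) (neg_ne_zero.2 (div_ne_zero haa hbb))
    refine ⟨a + l • b, W.add_mem ha (W.smul_mem l hbW), fun e => haa ?_, ?_, rfl⟩
    · have : f a (a + l • b) = f a a := by rw [map_add, map_smul, hab, smul_zero, add_zero]
      rw [← this, e, map_zero]
    · simp only [map_add, LinearMap.add_apply, map_smul, LinearMap.map_smulₛₗ, LinearMap.smul_apply,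
        hab, hba, smul_eq_mul]
      have : f b b * (f a a / f b b) = f a a := by field_simp
      linear_combination f b b * hl - this
  exists_adjust a b ha _ hab := by
    obtain ⟨y, hy⟩ := exists_add_apply_eq_one invol ne_id
    have hba : f b a = 1 := by rw [← herm, hab, map_one]
    refine ⟨-(y * f b b), ?_, rfl⟩
    simp only [map_add, LinearMap.add_apply, map_smul, LinearMap.map_smulₛₗ, LinearMap.smul_apply,
      hab, hba, ha, smul_eq_mul, map_neg, map_mul, herm]
    linear_combination (-f b b) * hy

theorem group_symplecticSpace (f : V →ₗ[F] V →ₗ[F] F) (alt : ∀ x, f x x = 0)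
    (nondeg : f.Nondegenerate) :
    (symplecticSpace f alt nondeg).group = GCl (.symplectic f alt nondeg) :=
  Subgroup.ext fun _ => ⟨fun h => h.1, fun h => ⟨h, fun _ => rfl⟩⟩

theorem group_unitarySpace [Finite F] [FiniteDimensional F V] (θ : F →+* F)
    (invol : ∀ a, θ (θ a) = a) (ne_id : θ ≠ RingHom.id F) (f : V →ₛₗ[θ] V →ₗ[F] F)
    (herm : ∀ x y, θ (f x y) = f y x) (nondeg : f.Nondegenerate) :
    (unitarySpace θ invol ne_id f herm nondeg).group = GCl (.unitary θ invol ne_id f herm nondeg) :=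
  Subgroup.ext fun _ => ⟨fun h => h.1, fun h => ⟨h, fun _ => rfl⟩⟩

end Instances

/-! ### The set of elements of minimal degree -/

section MinimalDegree

variable {F : Type*} [Field F] {V : Type*} [AddCommGroup V] [Module F V]

theorem conj_mem_detOne {g : V ≃ₗ[F] V} (hg : g ∈ detOne F V) (h : V ≃ₗ[F] V) :
    h * g * h⁻¹ ∈ detOne F V :=
  (MonoidHom.normal_ker _).conj_mem g hg h

theorem conj_mem_SCl {Γ : ClassicalForm F V} {g h : V ≃ₗ[F] V} (hg : g ∈ SCl Γ) (hh : h ∈ GCl Γ) :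
    h * g * h⁻¹ ∈ SCl Γ := by
  cases Γ with
  | linear => exact conj_mem_detOne hg h
  | symplectic f alt nondeg => exact mul_mem (mul_mem hh hg) (inv_mem hh)
  | unitary θ invol ne_id f herm nondeg =>
    have hh' : h ∈ isometriesOf fun x y => f x y := hh
    exact Subgroup.mem_inf.2 ⟨mul_mem (mul_mem hh' hg.1) (inv_mem hh'), conj_mem_detOne hg.2 h⟩
  | orthogonal Q nondeg =>
    let H := orthogonalGroup Q ⊓ detOne F V
    have hh' : h ∈ orthogonalGroup Q := hh
    have hH : H.map (MulAut.conj h).toMonoidHom ≤ H := by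
      rintro _ ⟨x, hx, rfl⟩
      exact Subgroup.mem_inf.2 ⟨mul_mem (mul_mem hh' hx.1) (inv_mem hh'), conj_mem_detOne hx.2 h⟩
    have h1 : h * g * h⁻¹ ∈ (⁅H, H⁆).map (MulAut.conj h).toMonoidHom := ⟨g, hg, rfl⟩
    rw [Subgroup.map_commutator] at h1
    exact Subgroup.commutator_mono hH hH h1

theorem conj_mem_minimalDegreeSet {Γ : ClassicalForm F V} {g h : V ≃ₗ[F] V}
    (hg : g ∈ minimalDegreeSet Γ) (hh : h ∈ GCl Γ) : h * g * h⁻¹ ∈ minimalDegreeSet Γ := by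
  refine ⟨conj_mem_SCl hg.1 hh, fun e => hg.2.1 ?_, fun k hk hk1 => ?_⟩
  · rw [mul_inv_eq_one] at e
    exact mul_eq_left.1 e
  · rw [degree_conj]
    exact hg.2.2 k hk hk1

theorem det_quasiRefl [FiniteDimensional F V] {P : PolarSpace F V} {a : V} {c : F}
    (h : P.QuasiReflCond a c) (ha : P.f a a = 0) : P.quasiRefl a c h ∈ detOne F V := by
  have e : (P.quasiRefl a c h : V →ₗ[F] V) = LinearMap.transvection (c • P.f a) a := by
    ext x
    rw [LinearEquiv.coe_coe, PolarSpace.quasiRefl_apply, LinearMap.transvection.apply]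
    rfl
  change LinearEquiv.det _ = 1
  apply Units.ext
  rw [LinearEquiv.coe_det, e, LinearMap.transvection.det]
  simp [ha]

theorem quasiRefl_mem_minimalDegreeSet [FiniteDimensional F V] {Γ : ClassicalForm F V}
    {P : PolarSpace F V} {a : V} {c : F} (h : P.QuasiReflCond a c) (hS : P.quasiRefl a c h ∈ SCl Γ)
    (ha : a ≠ 0) (hc : c ≠ 0) : P.quasiRefl a c h ∈ minimalDegreeSet Γ := by
  refine mem_minimalDegreeSet_of_degree_le_one hS (fun e => ?_)
    (degree_le_one_of_forall (a := a) fun x => ?_)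
  · obtain ⟨b, hb⟩ := P.exists_f_eq_one ha
    have := LinearEquiv.congr_fun e b
    rw [PolarSpace.quasiRefl_apply, hb] at this
    simp [ha, hc] at this
  · rw [PolarSpace.quasiRefl_apply, add_sub_cancel_left]
    exact Submodule.smul_mem _ _ (Submodule.mem_span_singleton_self a)

end MinimalDegree

end FiniteClassical

namespace FiniteClassical

open Module

/-! ### The fibre bound: symplectic and unitary groups -/

section FibreBound

variable {F : Type*} [Field F] {V : Type*} [AddCommGroup V] [Module F V]

/-- The lower bound for the proportion of the elements in a class modulo the derived subgroup whose
power with exponent `κ (q ^ d - 1)` has minimal degree. Here `t` is the number of `d`-dimensional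
blocks on which the elements are constructed to act irreducibly, `r` is the number of available
eigenvalues, and `u` is the dimension of the space that is left over. -/
def FibreBound (Γ : ClassicalForm F V) (d t r u : ℕ) : Prop :=
  ∀ α : Abelianization (GCl Γ), r.descFactorial t * Nat.card (GCl Γ) ≤
    Nat.card {g : GCl Γ // ((g ^ (kappa Γ * (Nat.card F ^ d - 1)) : GCl Γ) : V ≃ₗ[F] V) ∈
      minimalDegreeSet Γ ∧ Abelianization.of g = α} *
    ((Nat.card F ^ d) ^ t * Nat.card F ^ u ^ 2 * finrank F V ^ t)

theorem fibreBound_of_polarSpace [Finite F] [FiniteDimensional F V] {Γ : ClassicalForm F V}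
    (P : PolarSpace F V) (hG : P.group = GCl Γ) {s : ℕ}
    (hs : s = 1 ∨ s ^ 2 = Nat.card F) (hθ : ∀ a, P.θ a = a ^ s) {d t r : ℕ} (hd : 2 ≤ d)
    (ht : 2 * (t * d) + 11 ≤ finrank F V) (hY : 2 ^ 16 ≤ Nat.card F ^ d)
    (hr : 6 * d * r ≤ Nat.card F ^ d)
    (hL : ∀ (m : ℕ) (e e' : Fin (m + 5) → V), P.IsHyperbolic e e' →
      ∀ β : Abelianization P.group, ∃ w : P.group, Abelianization.of w = β ∧
        (w : V ≃ₗ[F] V) ^ ((Nat.card F - 1) * Nat.card F ^ 2) = 1 ∧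
        (w : V ≃ₗ[F] V) ^ (kappa Γ * (Nat.card F ^ d - 1)) ∈ minimalDegreeSet Γ ∧
        ∀ i : Fin m, (w : V ≃ₗ[F] V) (e (Fin.castAdd 5 i)) = e (Fin.castAdd 5 i) ∧
          (w : V ≃ₗ[F] V) (e' (Fin.castAdd 5 i)) = e' (Fin.castAdd 5 i)) :
    FibreBound Γ d t r (finrank F V - 2 * (t * d)) := by
  have key := P.descFactorial_mul_card_le hs hθ (minimalDegreeSet Γ)
    (fun g hg h hh => conj_mem_minimalDegreeSet hg (hG ▸ hh)) hd ht hY hr (dvd_mul_left _ _) hL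
  unfold FibreBound
  generalize GCl Γ = G at hG
  subst hG
  exact key

theorem cast_card_pow_sub_one [Finite F] {d : ℕ} (hd : d ≠ 0) :
    ((Nat.card F ^ d - 1 : ℕ) : F) + 1 = 0 := by
  have := Fintype.ofFinite F
  have h1 : 1 ≤ Nat.card F ^ d := Nat.one_le_pow _ _ Nat.card_pos
  have h2 : ((Nat.card F : ℕ) : F) = 0 := by
    rw [Nat.card_eq_fintype_card, Nat.cast_card_eq_zero]
  rw [Nat.cast_sub h1, Nat.cast_pow, h2, zero_pow hd]
  simp

theorem sub_one_dvd_pow_sub_one (q d : ℕ) : q - 1 ∣ q ^ d - 1 := by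
  simpa using Nat.sub_dvd_pow_sub_pow q 1 d

/-- The first three of the five spare hyperbolic pairs. -/
theorem PolarSpace.IsHyperbolic.firstThree {P : PolarSpace F V} {m : ℕ} {e e' : Fin (m + 5) → V}
    (he : P.IsHyperbolic e e') : ∃ e₃ e₃' : Fin 3 → V, P.IsHyperbolic e₃ e₃' :=
  ⟨_, _, he.comp (φ := fun i : Fin 3 => Fin.natAdd m (Fin.castLE (by norm_num) i))
    fun i i' h => by simpa [Fin.ext_iff] using h⟩

theorem fibreBound_symplectic [Finite F] [FiniteDimensional F V] (f : V →ₗ[F] V →ₗ[F] F)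
    (alt : ∀ x, f x x = 0) (nondeg : f.Nondegenerate) {d t r : ℕ} (hd : 2 ≤ d)
    (ht : 2 * (t * d) + 11 ≤ finrank F V) (hY : 2 ^ 16 ≤ Nat.card F ^ d)
    (hr : 6 * d * r ≤ Nat.card F ^ d) :
    FibreBound (.symplectic f alt nondeg) d t r (finrank F V - 2 * (t * d)) := by
  set P := symplecticSpace f alt nondeg with hP
  have hG := group_symplecticSpace f alt nondeg
  have hQ : ∀ x, P.Q x = 0 := fun _ => rfl
  refine fibreBound_of_polarSpace P hG (s := 1) (Or.inl rfl) (fun a => (pow_one a).symm) hd ht hY hr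
    fun m e e' he β => ?_
  obtain ⟨e₃, e₃', he₃⟩ := he.firstThree
  have hk : kappa (.symplectic f alt nondeg) * (Nat.card F ^ d - 1) = Nat.card F ^ d - 1 := one_mul _
  rw [hk]
  refine PolarSpace.exists_rep_of_torsion_rep hQ one_ne_zero ?_
    (cast_card_pow_sub_one (by omega)) (sub_one_dvd_pow_sub_one _ d) (fun a c h _ ha hc => ?_) he
    (fun β => ⟨1, ?_, one_pow _, fun i _ => ⟨rfl, rfl⟩⟩) β
  · simp [hP, symplecticSpace]
  · exact quasiRefl_mem_minimalDegreeSet h (PolarSpace.quasiRefl_mem hQ h).1 ha hc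
  · rw [map_one, PolarSpace.abelianization_eq_one_of_alternating hQ alt (by simp [hP, symplecticSpace])
      he₃ β]

theorem fibreBound_unitary [Finite F] [FiniteDimensional F V] (θ : F →+* F)
    (invol : ∀ a, θ (θ a) = a) (ne_id : θ ≠ RingHom.id F) (f : V →ₛₗ[θ] V →ₗ[F] F)
    (herm : ∀ x y, θ (f x y) = f y x) (nondeg : f.Nondegenerate) {d t r : ℕ} (hd : 2 ≤ d)
    (ht : 2 * (t * d) + 11 ≤ finrank F V) (hY : 2 ^ 16 ≤ Nat.card F ^ d)
    (hr : 6 * d * r ≤ Nat.card F ^ d) :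
    FibreBound (.unitary θ invol ne_id f herm nondeg) d t r (finrank F V - 2 * (t * d)) := by
  set P := unitarySpace θ invol ne_id f herm nondeg
  have hG := group_unitarySpace θ invol ne_id f herm nondeg
  have hQ : ∀ x, P.Q x = 0 := fun _ => rfl
  obtain ⟨s, hs, hθ⟩ := exists_sq_eq_card_of_involutive invol ne_id
  obtain ⟨x, hx⟩ := exists_apply_ne_of_ne_id ne_id
  obtain ⟨y, hy⟩ := exists_add_apply_eq_one invol ne_id
  obtain ⟨ζ, hζ, hζ1⟩ := exists_norm_eq_one_ne_one invol ne_id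
  refine fibreBound_of_polarSpace P hG (s := s) (Or.inr hs) hθ hd ht hY hr fun m e e' he β => ?_
  have hk : kappa (.unitary θ invol ne_id f herm nondeg) * (Nat.card F ^ d - 1) =
    Nat.card F ^ d - 1 := one_mul _
  rw [hk]
  refine PolarSpace.exists_rep_of_torsion_rep hQ (c₀ := x - θ x) (sub_ne_zero.2 hx.symm) ?_
    (cast_card_pow_sub_one (by omega)) (sub_one_dvd_pow_sub_one _ d) (fun a c h haa ha hc => ?_) he
    (PolarSpace.exists_torsion_rep_unitary hQ rfl hζ hζ1
      (fun γ hγ h0 => exists_norm_eq invol ne_id hγ h0) hx hy he) β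
  · change 1 * (x - θ x) + θ (x - θ x) = 0
    rw [map_sub, invol]
    ring
  · exact quasiRefl_mem_minimalDegreeSet h ⟨(PolarSpace.quasiRefl_mem hQ h).1, det_quasiRefl h haa⟩
      ha hc

end FibreBound

end FiniteClassical

namespace FiniteClassical

open Module Polynomial

/-! ### General linear groups -/

section Linear

variable {F : Type*} [Field F] {V : Type*} [AddCommGroup V] [Module F V]

/-- The map `x ↦ x + φ(x) a` as an element of the general linear group. -/
noncomputable def dilatrans (φ : Dual F V) (a : V) (h : 1 + φ a ≠ 0) :
    (⊤ : Subgroup (V ≃ₗ[F] V)) :=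
  ⟨LinearEquiv.dilatransvection h.isUnit, trivial⟩

theorem dilatrans_apply {φ : Dual F V} {a : V} (h : 1 + φ a ≠ 0) (x : V) :
    (dilatrans φ a h : V ≃ₗ[F] V) x = x + φ x • a :=
  LinearEquiv.dilatransvection.apply

theorem top_ext {g h : (⊤ : Subgroup (V ≃ₗ[F] V))}
    (e : ∀ x, (g : V ≃ₗ[F] V) x = (h : V ≃ₗ[F] V) x) : g = h :=
  Subtype.ext (LinearEquiv.ext e)

theorem top_mul_apply (g h : (⊤ : Subgroup (V ≃ₗ[F] V))) (x : V) :
    ((g * h : (⊤ : Subgroup (V ≃ₗ[F] V))) : V ≃ₗ[F] V) x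
      = (g : V ≃ₗ[F] V) ((h : V ≃ₗ[F] V) x) := rfl

/-- Transvections of a space of dimension at least three are commutators. -/
theorem of_dilatrans_eq_one [FiniteDimensional F V] (hV : 3 ≤ finrank F V) {φ : Dual F V} {a : V}
    (h : φ a = 0) : Abelianization.of (dilatrans φ a (by simp [h])) = 1 := by
  have hb : ∃ b ∈ LinearMap.ker φ, b ∉ Submodule.span F {a} := by
    by_contra! hcon
    have h1 := Submodule.finrank_mono (s := LinearMap.ker φ) (t := Submodule.span F {a}) hcon
    have h2 := (finrank_span_le_card (R := F) {a}).trans_eq (by simp : _ = 1)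
    have h3 := LinearMap.finrank_range_add_finrank_ker φ
    have h4 := Submodule.finrank_le (LinearMap.range φ)
    rw [finrank_self] at h4
    omega
  obtain ⟨b, hφb, hb⟩ := hb
  have hφb : φ b = 0 := hφb
  obtain ⟨ψ', hψ', hψa'⟩ := Submodule.exists_dual_map_eq_bot_of_notMem hb inferInstance
  have hψa : ψ' a = 0 := by
    have : ψ' a ∈ (Submodule.span F {a}).map ψ' :=
      Submodule.mem_map_of_mem (Submodule.mem_span_singleton_self a)
    rwa [hψa', Submodule.mem_bot] at this
  have ha : (1 : F) + ((ψ' b)⁻¹ • ψ') a ≠ 0 := by simp [hψa]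
  have hb' : 1 + φ b ≠ 0 := by simp [hφb]
  have key : dilatrans _ a ha * dilatrans φ b hb' =
      dilatrans φ a (by simp [h]) * dilatrans φ b hb' * dilatrans _ a ha := by
    refine top_ext fun x => ?_
    simp only [top_mul_apply, dilatrans_apply, map_add, map_smul, LinearMap.smul_apply, smul_eq_mul,
      hφb, h, inv_mul_cancel₀ hψ']
    module
  have := congrArg (Abelianization.of (G := (⊤ : Subgroup (V ≃ₗ[F] V)))) key
  rw [map_mul, map_mul, map_mul, mul_assoc, mul_comm (Abelianization.of (dilatrans φ b hb'))] at this
  exact right_eq_mul.1 this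

theorem exists_map_eq_of_dual [FiniteDimensional F V] {φ ψ : Dual F V} {a b : V} (ha : φ a = 1)
    (hb : ψ b = 1) : ∃ g : V ≃ₗ[F] V, g a = b ∧ ∀ x, ψ (g x) = φ x := by
  have hker : ∀ {φ : Dual F V} {a : V}, φ a = 1 →
      finrank F (LinearMap.ker φ) + 1 = finrank F V := by
    intro φ a h
    have h1 := LinearMap.finrank_range_add_finrank_ker φ
    have h2 : LinearMap.range φ = ⊤ :=
      LinearMap.range_eq_top.2 fun c => ⟨c • a, by rw [map_smul, h, smul_eq_mul, mul_one]⟩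
    rw [h2, finrank_top, finrank_self] at h1
    omega
  let L : LinearMap.ker φ ≃ₗ[F] LinearMap.ker ψ :=
    LinearEquiv.ofFinrankEq _ _ (by have := hker ha; have := hker hb; omega)
  have hmem : ∀ {φ : Dual F V} {a : V}, φ a = 1 →
      ∀ x, (LinearMap.id - φ.smulRight a : V →ₗ[F] V) x ∈ LinearMap.ker φ := by
    intro φ a h x
    simp [h]
  let G : V →ₗ[F] V := φ.smulRight b + (LinearMap.ker ψ).subtype ∘ₗ L.toLinearMap ∘ₗ
    (LinearMap.id - φ.smulRight a : V →ₗ[F] V).codRestrict _ (hmem ha)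
  have hGa : G a = b := by
    have : (LinearMap.id - φ.smulRight a : V →ₗ[F] V).codRestrict _ (hmem ha) a = 0 := by
      ext
      simp [ha]
    simp only [G, LinearMap.add_apply, LinearMap.comp_apply, this, map_zero, add_zero]
    simp [ha]
  have hGψ : ∀ x, ψ (G x) = φ x := by
    intro x
    simp only [G, LinearMap.add_apply, LinearMap.comp_apply, map_add]
    rw [LinearMap.smulRight_apply, map_smul, hb, Submodule.subtype_apply,
      LinearMap.mem_ker.1 (Subtype.prop _)]
    simp
  have hinj : Function.Injective G := by
    rw [injective_iff_map_eq_zero]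
    intro x hx
    have h0 : φ x = 0 := by rw [← hGψ, hx, map_zero]
    simp only [G, LinearMap.add_apply, LinearMap.comp_apply, LinearMap.smulRight_apply, h0,
      zero_smul, zero_add, Submodule.subtype_apply, LinearEquiv.coe_coe] at hx
    have h1 := L.map_eq_zero_iff.1 (Subtype.ext hx)
    have h2 := congrArg Subtype.val h1
    simpa [h0] using h2
  exact ⟨LinearEquiv.ofInjectiveEndo G hinj, hGa, hGψ⟩

theorem conj_dilatrans {φ ψ : Dual F V} {a b : V} {g : V ≃ₗ[F] V} (hg : g a = b)
    (hψ : ∀ x, ψ (g x) = φ x) (h : 1 + φ a ≠ 0) (h' : 1 + ψ b ≠ 0) :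
    Abelianization.of (dilatrans ψ b h') = Abelianization.of (dilatrans φ a h) := by
  have : (⟨g, trivial⟩ : (⊤ : Subgroup (V ≃ₗ[F] V))) * dilatrans φ a h = dilatrans ψ b h' * ⟨g, trivial⟩ := by
    refine top_ext fun x => ?_
    simp only [top_mul_apply, dilatrans_apply, map_add, map_smul, hg, hψ]
  have := congrArg (Abelianization.of (G := (⊤ : Subgroup (V ≃ₗ[F] V)))) this
  rw [map_mul, map_mul, mul_comm] at this
  exact (mul_right_cancel this).symm

/-- Two vectors outside a subspace are separated from it by a single functional. -/
theorem exists_dual_ne_zero [FiniteDimensional F V] {W : Submodule F V} {a b : V} (ha : a ∉ W)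
    (hb : b ∉ W) : ∃ φ : Dual F V, (∀ w ∈ W, φ w = 0) ∧ φ a ≠ 0 ∧ φ b ≠ 0 := by
  have key : ∀ {a : V}, a ∉ W → Dual.eval F (V ⧸ W) (W.mkQ a) ≠ 0 := by
    intro a ha h
    refine ha ((Submodule.Quotient.mk_eq_zero W).1 ?_)
    exact (forall_dual_apply_eq_zero_iff F (W.mkQ a)).1 fun φ => DFunLike.congr_fun h φ
  obtain ⟨φ, h1, h2⟩ := exists_apply_ne_zero_and (key ha) (key hb)
  exact ⟨φ ∘ₗ W.mkQ, fun w hw => by simp [(Submodule.Quotient.mk_eq_zero W).2 hw], h1, h2⟩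

/-- The abelianisation of the general linear group is represented by the dilatations along a fixed
vector. -/
theorem exists_of_dilatrans_eq [FiniteDimensional F V] (hV : 3 ≤ finrank F V) {φ₀ : Dual F V}
    {a₀ : V} (h₀ : φ₀ a₀ = 1) (β : Abelianization (⊤ : Subgroup (V ≃ₗ[F] V))) :
    ∃ (c : F) (h : _), Abelianization.of (dilatrans (c • φ₀) a₀ h) = β := by
  have hone : ∀ {c : F}, (1 : F) + (c • φ₀) a₀ ≠ 0 ↔ 1 + c ≠ 0 := by simp [h₀]
  have hdil : ∀ (φ : Dual F V) a h, ∃ (c : F) (h' : _),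
      Abelianization.of (dilatrans (c • φ₀) a₀ h') = Abelianization.of (dilatrans φ a h) := by
    intro φ a h
    by_cases ha : φ a = 0
    · refine ⟨0, by simp, ?_⟩
      rw [of_dilatrans_eq_one hV ha, of_dilatrans_eq_one hV (by simp)]
    · obtain ⟨g, hg₁, hg₂⟩ := exists_map_eq_of_dual (φ := (φ a)⁻¹ • φ) (a := a)
        (by simp [inv_mul_cancel₀ ha]) h₀
      have hg₂' : ∀ x, (φ a • φ₀) (g x) = φ x := fun x => by
        rw [LinearMap.smul_apply, hg₂, LinearMap.smul_apply, smul_smul, mul_inv_cancel₀ ha, one_smul]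
      exact ⟨φ a, hone.2 h, conj_dilatrans hg₁ hg₂' _ _⟩
  have hmul : ∀ {c c' : F} (h : (1 : F) + (c • φ₀) a₀ ≠ 0) (h' : (1 : F) + (c' • φ₀) a₀ ≠ 0), ∃ h'',
      dilatrans (c • φ₀) a₀ h * dilatrans (c' • φ₀) a₀ h' =
        dilatrans ((c + c' + c * c') • φ₀) a₀ h'' := by
    intro c c' h h'
    have h'' : (1 : F) + ((c + c' + c * c') • φ₀) a₀ ≠ 0 := by
      rw [hone] at h h' ⊢
      convert mul_ne_zero h h' using 1
      ring
    refine ⟨h'', top_ext fun x => ?_⟩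
    simp only [top_mul_apply, dilatrans_apply, map_add, map_smul, LinearMap.smul_apply, smul_eq_mul,
      h₀]
    module
  have hH : ∀ x : (⊤ : Subgroup (V ≃ₗ[F] V)), x ∈ ({
      carrier := {g | ∃ (c : F) (h : _), Abelianization.of (dilatrans (c • φ₀) a₀ h) = Abelianization.of g}
      one_mem' := by
        refine ⟨0, by simp, ?_⟩
        rw [map_one, of_dilatrans_eq_one hV (by simp)]
      mul_mem' := by
        rintro g g' ⟨c, h, e⟩ ⟨c', h', e'⟩
        obtain ⟨h'', key⟩ := hmul h h'
        exact ⟨_, h'', by rw [← key, map_mul, e, e', map_mul]⟩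
      inv_mem' := by
        rintro g ⟨c, h, e⟩
        have hc := hone.1 h
        have h' : (1 : F) + ((-c * (1 + c)⁻¹) • φ₀) a₀ ≠ 0 := by
          rw [hone]
          field_simp
          simpa using hc
        obtain ⟨h'', key⟩ := hmul h h'
        refine ⟨_, h', ?_⟩
        rw [map_inv, ← e, eq_inv_iff_mul_eq_one, mul_comm, ← map_mul, key,
          of_dilatrans_eq_one hV]
        simp only [LinearMap.smul_apply, h₀, smul_eq_mul]
        field_simp
        ring } : Subgroup (⊤ : Subgroup (V ≃ₗ[F] V))) := by
    refine mem_of_forall_exists_fixedSpace_lt _ fun g hg => ?_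
    obtain ⟨v, hv⟩ := exists_apply_ne (g := (g : V ≃ₗ[F] V)) fun h => hg (Subtype.ext h)
    have hv1 : v ∉ fixedSpace (g : V ≃ₗ[F] V) := fun h => hv (mem_fixedSpace.1 h)
    have hv2 : (g : V ≃ₗ[F] V) v ∉ fixedSpace (g : V ≃ₗ[F] V) := fun h =>
      hv ((g : V ≃ₗ[F] V).injective (mem_fixedSpace.1 h))
    obtain ⟨φ, hφ, hφ1, hφ2⟩ := exists_dual_ne_zero hv1 hv2
    set ψ : Dual F V := (φ ((g : V ≃ₗ[F] V) v))⁻¹ • φ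
    have hψ : ψ ((g : V ≃ₗ[F] V) v) = 1 := inv_mul_cancel₀ hφ2
    have h1 : 1 + ψ (v - (g : V ≃ₗ[F] V) v) ≠ 0 := by
      rw [map_sub, hψ, add_sub_cancel]
      exact mul_ne_zero (inv_ne_zero hφ2) hφ1
    refine ⟨dilatrans ψ _ h1, hdil _ _ _, fixedSpace_lt (v := v) (fun x hx => ?_) hv ?_⟩
    · rw [dilatrans_apply]
      simp [ψ, hφ x (mem_fixedSpace.2 hx)]
    · rw [dilatrans_apply, hψ, one_smul, add_sub_cancel]
  obtain ⟨g, rfl⟩ := QuotientGroup.mk_surjective β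
  exact hH g

theorem dilatrans_pow_apply_of_eq_zero {φ : Dual F V} {a : V} (h : 1 + φ a ≠ 0) (ha : φ a = 0)
    (n : ℕ) (x : V) :
    ((dilatrans φ a h ^ n : (⊤ : Subgroup (V ≃ₗ[F] V))) : V ≃ₗ[F] V) x = x + (n * φ x) • a := by
  induction n with
  | zero => simp
  | succ n ih =>
    rw [pow_succ', top_mul_apply, ih, dilatrans_apply, map_add, map_smul, ha]
    push_cast
    simp only [smul_eq_mul]
    module

theorem dilatrans_pow_apply_of_eq_one {φ : Dual F V} {a : V} {c : F} (h : 1 + (c • φ) a ≠ 0)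
    (ha : φ a = 1) (n : ℕ) (x : V) :
    ((dilatrans (c • φ) a h ^ n : (⊤ : Subgroup (V ≃ₗ[F] V))) : V ≃ₗ[F] V) x =
      x + (((1 + c) ^ n - 1) * φ x) • a := by
  induction n with
  | zero => simp
  | succ n ih =>
    rw [pow_succ', top_mul_apply, ih, dilatrans_apply, map_add, map_smul, pow_succ]
    simp only [LinearMap.smul_apply, smul_eq_mul, ha]
    module

/-- Representatives of the classes of the abelianisation of the general linear group: the product
of a transvection and a dilatation that commute. -/
theorem exists_rep_linear [Finite F] [FiniteDimensional F V] (hV : 3 ≤ finrank F V)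
    {φ₀ φ₁ : Dual F V} {a₀ a₁ : V} (h₀₀ : φ₀ a₀ = 1) (h₀₁ : φ₀ a₁ = 0) (h₁₀ : φ₁ a₀ = 0)
    (h₁₁ : φ₁ a₁ = 0) (ha₁ : a₁ ≠ 0) (hφ₁ : φ₁ ≠ 0) {k : ℕ} (hk : ((k : ℕ) : F) + 1 = 0)
    (hk' : Nat.card F - 1 ∣ k) (β : Abelianization (⊤ : Subgroup (V ≃ₗ[F] V))) :
    ∃ w : (⊤ : Subgroup (V ≃ₗ[F] V)), Abelianization.of w = β ∧
      (w : V ≃ₗ[F] V) ^ ((Nat.card F - 1) * Nat.card F ^ 2) = 1 ∧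
      (w : V ≃ₗ[F] V) ^ k ∈ minimalDegreeSet (ClassicalForm.linear : ClassicalForm F V) ∧
      ∃ c, ∀ x, (w : V ≃ₗ[F] V) x = x + (c * φ₀ x) • a₀ + φ₁ x • a₁ := by
  obtain ⟨c, hc, rfl⟩ := exists_of_dilatrans_eq hV h₀₀ β
  set D := dilatrans (c • φ₀) a₀ hc
  have h1 : 1 + φ₁ a₁ ≠ 0 := by simp [h₁₁]
  set u := dilatrans φ₁ a₁ h1
  have hc' : 1 + c ≠ 0 := by simpa [h₀₀] using hc
  have := Fintype.ofFinite F
  have hcast : ((Nat.card F : ℕ) : F) = 0 := by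
    rw [Nat.card_eq_fintype_card, Nat.cast_card_eq_zero]
  have hD : D ^ (Nat.card F - 1) = 1 := by
    refine top_ext fun x => ?_
    rw [dilatrans_pow_apply_of_eq_one hc h₀₀, Nat.card_eq_fintype_card,
      FiniteField.pow_card_sub_one_eq_one _ hc']
    simp
  have hu : u ^ ((Nat.card F - 1) * Nat.card F ^ 2) = 1 := by
    refine top_ext fun x => ?_
    rw [dilatrans_pow_apply_of_eq_zero h1 h₁₁]
    push_cast
    rw [hcast]
    simp
  have hcomm : Commute u D := by
    refine top_ext fun x => ?_
    simp only [u, D, top_mul_apply, dilatrans_apply, map_add, map_smul, LinearMap.smul_apply,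
      smul_eq_mul, h₀₁, h₁₀]
    module
  refine ⟨u * D, ?_, ?_, ?_, c, fun x => ?_⟩
  · rw [map_mul, of_dilatrans_eq_one hV h₁₁, one_mul]
  · have : (u * D) ^ ((Nat.card F - 1) * Nat.card F ^ 2) = 1 := by
      rw [hcomm.mul_pow, hu, pow_mul D, hD, one_pow, one_mul]
    exact congrArg Subtype.val this
  · have hwk : ((u * D : (⊤ : Subgroup (V ≃ₗ[F] V))) : V ≃ₗ[F] V) ^ k =
        LinearEquiv.transvection (f := -φ₁) (v := a₁) (by simp [h₁₁]) := by
      obtain ⟨l, rfl⟩ := hk'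
      have : (u * D) ^ ((Nat.card F - 1) * l) = u ^ ((Nat.card F - 1) * l) := by
        rw [hcomm.mul_pow, pow_mul D, hD, one_pow, mul_one]
      have := congrArg Subtype.val this
      refine Eq.trans this (LinearEquiv.ext fun x => ?_)
      rw [dilatrans_pow_apply_of_eq_zero h1 h₁₁, LinearEquiv.transvection.apply]
      congr 2
      rw [LinearMap.neg_apply]
      linear_combination φ₁ x * hk
    rw [hwk]
    refine mem_minimalDegreeSet_of_degree_le_one (LinearEquiv.transvection.det_eq_one _)
      (fun e => hφ₁ ?_) (degree_le_one_of_forall (a := a₁) fun x => ?_)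
    · ext x
      have := LinearEquiv.congr_fun e x
      rw [LinearEquiv.transvection.apply] at this
      simpa [ha₁] using this
    · rw [LinearEquiv.transvection.apply, add_sub_cancel_left]
      exact Submodule.smul_mem _ _ (Submodule.mem_span_singleton_self a₁)
  · rw [top_mul_apply, dilatrans_apply, dilatrans_apply, map_add, map_smul, h₁₀]
    simp

/-- A block decomposition of `V` with `t` blocks in the first summand and none in the second, which
leaves room for a transvection and a dilatation that commute. -/
theorem exists_blockDecomposition_linear [FiniteDimensional F V] {E : Type*} [Field E]
    [Algebra F E] [FiniteDimensional F E] {t : ℕ} (ht : t * finrank F E + 3 ≤ finrank F V) :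
    ∃ (D : BlockDecomposition F E V (Fin t) (Fin 0)) (φ₀ φ₁ : Dual F V) (a₀ a₁ : V),
      φ₀ a₀ = 1 ∧ φ₀ a₁ = 0 ∧ φ₁ a₀ = 0 ∧ φ₁ a₁ = 0 ∧ a₁ ≠ 0 ∧ φ₁ ≠ 0 ∧
      (∀ m, φ₀ (D.ι₁ m) = 0 ∧ φ₁ (D.ι₁ m) = 0) ∧ D.p₁ a₀ = 0 ∧ D.p₁ a₁ = 0 := by
  obtain ⟨u, hu⟩ := Nat.exists_eq_add_of_le ht
  have hM : finrank F ((Fin t → E) × (Fin 3 → F) × (Fin u → F)) = finrank F V := by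
    rw [Module.finrank_prod, Module.finrank_prod, Module.finrank_pi_fintype]
    simp
    omega
  let Φ := LinearEquiv.ofFinrankEq _ _ hM
  let φ : Fin 3 → Dual F V := fun i =>
    LinearMap.proj i ∘ₗ LinearMap.fst F _ _ ∘ₗ LinearMap.snd F _ _ ∘ₗ Φ.symm.toLinearMap
  let a : Fin 3 → V := fun i => Φ (0, Pi.single i 1, 0)
  have hφa : ∀ i j, φ i (a j) = if i = j then 1 else 0 := fun i j => by
    simp [φ, a, Pi.single_apply]
  refine ⟨{ ι₁ := Φ.toLinearMap ∘ₗ LinearMap.inl F _ _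
            ι₂ := 0
            p₁ := LinearMap.fst F _ _ ∘ₗ Φ.symm.toLinearMap
            p₂ := 0
            p₁_ι₁ := fun m => by simp
            p₂_ι₂ := fun m => Subsingleton.elim _ _
            p₁_ι₂ := fun m => by simp
            p₂_ι₁ := fun m => rfl }, φ 0, φ 1, a 0, a 2, by simp [hφa], by simp [hφa], by simp [hφa],
      by simp [hφa], fun h => ?_, fun h => ?_, fun m => ⟨?_, ?_⟩, ?_, ?_⟩
  · have := hφa 2 2
    simp [h] at this
  · have := hφa 1 1
    simp [h] at this
  all_goals simp [φ, a]

theorem fibreBound_linear [Finite F] [FiniteDimensional F V] {d t r : ℕ} (hd : 2 ≤ d)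
    (ht : t * d + 3 ≤ finrank F V) (hY : 2 ^ 16 ≤ Nat.card F ^ d)
    (hr : 6 * d * r ≤ Nat.card F ^ d) :
    FibreBound (ClassicalForm.linear : ClassicalForm F V) d t r (finrank F V - t * d) := by
  have hG : (⊤ : Subgroup (V ≃ₗ[F] V)) = GCl (ClassicalForm.linear : ClassicalForm F V) := rfl
  unfold FibreBound
  generalize GCl (ClassicalForm.linear : ClassicalForm F V) = G at hG
  subst hG
  intro α
  obtain ⟨E, _, _, _, hE⟩ := exists_finite_extension F d (by omega)
  subst hE
  obtain ⟨R, hRc, hRd, hR, -⟩ := exists_finset_units (F := F) (E := E) (s := 1) (Or.inl rfl) hY r hr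
  obtain ⟨D, φ₀, φ₁, a₀, a₁, h₀₀, h₀₁, h₁₀, h₁₁, ha₁, hφ₁, hι, hp₀, hp₁⟩ :=
    exists_blockDecomposition_linear (V := V) ht
  have hrest := D.finrank_rest_add
  rw [Fintype.card_fin, Fintype.card_fin, add_zero] at hrest
  have hrest' : finrank F D.rest = finrank F V - t * finrank F E := by omega
  have hN : ∀ a ∈ R, (a : E) ^ ((Nat.card F - 1) * Nat.card F ^ 2) ≠ 1 := fun a ha =>
    pow_ne_one_of_natDegree_minpoly a.ne_zero (by rw [hRd a ha]; exact hd)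
  have hkap : kappa (ClassicalForm.linear : ClassicalForm F V) * (Nat.card F ^ finrank F E - 1) =
    Nat.card F ^ finrank F E - 1 := one_mul _
  rw [← hrest', ← hRc, hkap, ← Module.natCard_eq_pow_finrank (K := F) (V := E)]
  refine D.card_mul_card_le_card_fiber ⊤ (minimalDegreeSet (ClassicalForm.linear : ClassicalForm F V))
    (fun g hg h _ => conj_mem_minimalDegreeSet hg (Subgroup.mem_top h))
    (N := (Nat.card F - 1) * Nat.card F ^ 2)
    (fun z => units_pow_eq_one (F := F) (by rw [Module.natCard_eq_pow_finrank (K := F) (V := E)]) z)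
    (fun τ i => i.elim0) (fun τ => trivial) (fun β => ?_) R
    (fun a ha h => hN a ha ?_) hRd hR (fun τ hτ j => j.elim0)
    (fun τ hτ x j => j.elim0) (fun τ hτ x _ hx y hy hc h₁ hU => ?_) α
  · obtain ⟨w, hw₁, hw₂, hw₃, c, hw₄⟩ := exists_rep_linear (V := V) (by omega) h₀₀ h₀₁ h₁₀ h₁₁ ha₁
      hφ₁ (cast_card_pow_sub_one (F := F) (d := finrank F E) (by omega))
      (sub_one_dvd_pow_sub_one _ _) β
    rw [← Module.natCard_eq_pow_finrank (K := F) (V := E)] at hw₃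
    refine ⟨w, hw₁, hw₂, hw₃, fun m => ?_, fun m => ?_, fun v => ?_, fun v => Subsingleton.elim _ _⟩
    · rw [hw₄, (hι m).1, (hι m).2]
      simp
    · rw [Subsingleton.elim m 0, map_zero, map_zero]
    · rw [hw₄]
      simp [hp₀, hp₁]
  · rw [← Units.val_pow_eq_pow_val, h, Units.val_one]
  · ext v
    have hve : v = D.ι₁ (D.p₁ v) + (v - D.ι₁ (D.p₁ v)) := by abel
    have hr := D.sub_mem_rest v
    rw [Subsingleton.elim (D.p₂ v) 0, map_zero, sub_zero] at hr
    rw [hve, map_add, h₁, hU _ hr]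
    rfl

end Linear

end FiniteClassical

namespace FiniteClassical

open Module

/-! ### Quadratic spaces: reflections and Siegel transformations -/

section Orthogonal

variable {F : Type*} [Field F] {V : Type*} [AddCommGroup V] [Module F V]

/-- The polar form of a quadratic form, as a form with values in the field. -/
def bil (Q : QuadraticForm F V) : V →ₗ[F] V →ₗ[F] F := QuadraticMap.polarBilin Q

variable {Q : QuadraticForm F V}

theorem map_add_eq (x y : V) : Q (x + y) = Q x + Q y + bil Q x y := QuadraticMap.map_add Q x y

theorem map_smul_eq (c : F) (x : V) : Q (c • x) = c * c * Q x := QuadraticMap.map_smul Q c x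

theorem bil_comm (x y : V) : bil Q x y = bil Q y x := QuadraticMap.polar_comm Q x y

theorem bil_self (x : V) : bil Q x x = 2 * Q x := by
  have := QuadraticMap.polar_self Q x
  rwa [two_nsmul, ← two_mul] at this

theorem map_sub_eq (x y : V) : Q (x - y) = Q x + Q y - bil Q x y := by
  rw [sub_eq_add_neg, map_add_eq, QuadraticMap.map_neg, map_neg, ← sub_eq_add_neg]

theorem map_bil {g : V ≃ₗ[F] V} (hg : g ∈ orthogonalGroup Q) (x y : V) :
    bil Q (g x) (g y) = bil Q x y := by
  have h : ∀ z, Q (g z) = Q z := hg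
  have h1 := map_add_eq (Q := Q) (g x) (g y)
  rw [← map_add, h, h, h, map_add_eq] at h1
  exact (add_left_cancel h1).symm

theorem orthogonalGroup_ext {g h : orthogonalGroup Q}
    (e : ∀ x, (g : V ≃ₗ[F] V) x = (h : V ≃ₗ[F] V) x) : g = h :=
  Subtype.ext (LinearEquiv.ext e)

theorem orthogonalGroup_mul_apply (g h : orthogonalGroup Q) (x : V) :
    ((g * h : orthogonalGroup Q) : V ≃ₗ[F] V) x = (g : V ≃ₗ[F] V) ((h : V ≃ₗ[F] V) x) := rfl

/-- The linear map underlying the reflection along `a`. -/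
noncomputable def reflMap (Q : QuadraticForm F V) (a : V) : V →ₗ[F] V :=
  LinearMap.id - ((Q a)⁻¹ • bil Q a).smulRight a

theorem reflMap_apply (a x : V) : reflMap Q a x = x - ((Q a)⁻¹ * bil Q a x) • a := by
  simp [reflMap]

theorem reflMap_reflMap {a : V} (h : Q a ≠ 0) (x : V) : reflMap Q a (reflMap Q a x) = x := by
  rw [reflMap_apply, reflMap_apply, map_sub, map_smul, bil_self, smul_eq_mul]
  have : (Q a)⁻¹ * Q a = 1 := inv_mul_cancel₀ h
  linear_combination (norm := module) (2 * (Q a)⁻¹ * bil Q a x * this) • a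

/-- The reflection along a nonsingular vector `a`. -/
noncomputable def refl (Q : QuadraticForm F V) (a : V) (h : Q a ≠ 0) : orthogonalGroup Q :=
  ⟨LinearEquiv.ofInvolutive (reflMap Q a) (reflMap_reflMap h),
    fun x => by
      change Q (reflMap Q a x) = Q x
      rw [reflMap_apply, map_sub_eq, map_smul_eq, map_smul, bil_comm x a, smul_eq_mul]
      have : (Q a)⁻¹ * Q a = 1 := inv_mul_cancel₀ h
      linear_combination (Q a)⁻¹ * bil Q a x * bil Q a x * this⟩

theorem refl_apply {a : V} (h : Q a ≠ 0) (x : V) :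
    (refl Q a h : V ≃ₗ[F] V) x = x - ((Q a)⁻¹ * bil Q a x) • a := reflMap_apply a x

theorem refl_mul_self {a : V} (h : Q a ≠ 0) : refl Q a h * refl Q a h = 1 :=
  orthogonalGroup_ext (reflMap_reflMap h)

/-- The linear map underlying the Siegel transformation. -/
def siegelMap (Q : QuadraticForm F V) (a w : V) : V →ₗ[F] V :=
  LinearMap.id + (bil Q w).smulRight a - (bil Q a).smulRight w - (Q w • bil Q a).smulRight a

theorem siegelMap_apply (a w x : V) : siegelMap Q a w x =
    x + bil Q w x • a - bil Q a x • w - (Q w * bil Q a x) • a := by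
  simp [siegelMap]

theorem siegelMap_siegelMap {a w w' : V} (ha : Q a = 0) (hw : bil Q a w = 0) (hw' : bil Q a w' = 0)
    (x : V) : siegelMap Q a w (siegelMap Q a w' x) = siegelMap Q a (w + w') x := by
  have haa : bil Q a a = 0 := by rw [bil_self, ha, mul_zero]
  have hwa : bil Q w a = 0 := by rw [bil_comm, hw]
  simp only [siegelMap_apply, map_add, map_sub, map_smul, LinearMap.add_apply, haa, hw', hwa,
    map_add_eq]
  module

/-- The Siegel transformation of a singular vector `a` and a vector `w` orthogonal to it. -/
def siegel (Q : QuadraticForm F V) (a w : V) (ha : Q a = 0) (hw : bil Q a w = 0) :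
    orthogonalGroup Q :=
  ⟨LinearEquiv.ofLinearMap (siegelMap Q a w) (siegelMap Q a (-w))
    (by
      ext x
      rw [LinearMap.comp_apply, siegelMap_siegelMap ha hw (by rw [map_neg, hw, neg_zero]),
        siegelMap_apply]
      simp)
    (by
      ext x
      rw [LinearMap.comp_apply, siegelMap_siegelMap ha (by rw [map_neg, hw, neg_zero]) hw,
        siegelMap_apply]
      simp),
    fun x => by
      change Q (siegelMap Q a w x) = Q x
      have haa : bil Q a a = 0 := by rw [bil_self, ha, mul_zero]
      have hwa : bil Q w a = 0 := by rw [bil_comm, hw]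
      rw [siegelMap_apply]
      simp only [map_sub_eq, map_add_eq, map_smul_eq, map_add, map_sub, map_smul,
        LinearMap.add_apply, LinearMap.sub_apply, LinearMap.smul_apply, smul_eq_mul, haa, hw, hwa, ha,
        bil_comm x a, bil_comm x w]
      ring⟩

theorem siegel_apply {a w : V} (ha : Q a = 0) (hw : bil Q a w = 0) (x : V) :
    (siegel Q a w ha hw : V ≃ₗ[F] V) x =
      x + bil Q w x • a - bil Q a x • w - (Q w * bil Q a x) • a := siegelMap_apply a w x

theorem siegel_apply_of_singular {a b : V} (ha : Q a = 0) (hab : bil Q a b = 0) (hb : Q b = 0)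
    (x : V) : (siegel Q a b ha hab : V ≃ₗ[F] V) x = x + bil Q b x • a - bil Q a x • b := by
  rw [siegel_apply, hb, zero_mul, zero_smul, sub_zero]

theorem siegel_mul_siegel {a w w' : V} (ha : Q a = 0) (hw : bil Q a w = 0) (hw' : bil Q a w' = 0) :
    siegel Q a w ha hw * siegel Q a w' ha hw' =
      siegel Q a (w + w') ha (by rw [map_add, hw, hw', add_zero]) :=
  orthogonalGroup_ext fun x => siegelMap_siegelMap ha hw hw' x

/-- The subgroup generated by all reflections. -/
def reflSubgroup (Q : QuadraticForm F V) : Subgroup (orthogonalGroup Q) :=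
  Subgroup.closure {g | ∃ a h, g = refl Q a h}

theorem refl_mem_reflSubgroup {a : V} (h : Q a ≠ 0) : refl Q a h ∈ reflSubgroup Q :=
  Subgroup.subset_closure ⟨a, h, rfl⟩

theorem siegel_mem_reflSubgroup_of_ne_zero {a w : V} (ha : Q a = 0) (hw : bil Q a w = 0)
    (hQw : Q w ≠ 0) : siegel Q a w ha hw ∈ reflSubgroup Q := by
  have hwa : bil Q w a = 0 := by rw [bil_comm, hw]
  have e : Q (w - Q w • a) = Q w := by
    rw [map_sub_eq, map_smul_eq, map_smul, hwa, ha]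
    simp
  have h' : Q (w - Q w • a) ≠ 0 := by rwa [e]
  have : siegel Q a w ha hw = refl Q w hQw * refl Q (w - Q w • a) h' := by
    refine orthogonalGroup_ext fun x => ?_
    rw [orthogonalGroup_mul_apply, siegel_apply, refl_apply, refl_apply, e]
    simp only [map_sub, map_smul, LinearMap.sub_apply, LinearMap.smul_apply, bil_self, hwa,
      smul_eq_mul]
    have hq : (Q w)⁻¹ * Q w = 1 := inv_mul_cancel₀ hQw
    linear_combination (norm := module)
      ((bil Q a x * (2 * ((Q w)⁻¹ * Q w) + 1) - 2 * (Q w)⁻¹ * bil Q w x) * hq) • w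
        - ((bil Q w x - Q w * bil Q a x) * hq) • a
  rw [this]
  exact mul_mem (refl_mem_reflSubgroup _) (refl_mem_reflSubgroup _)

/-- A subspace of less than half the dimension has nonsingular vectors in its orthogonal space. -/
theorem exists_orthogonal_ne_zero [FiniteDimensional F V] (hQ : ∀ x, (∀ y, bil Q x y = 0) → x = 0)
    (W : Submodule F V) (hW : 2 * finrank F W < finrank F V) :
    ∃ y, (∀ w ∈ W, bil Q w y = 0) ∧ Q y ≠ 0 := by
  by_contra! h
  let B : LinearMap.BilinForm F V := bil Q
  have hn : B.Nondegenerate := ⟨hQ, fun y hy => hQ y fun x => by rw [bil_comm]; exact hy x⟩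
  have h1 : B.orthogonal W ≤ B.orthogonal (B.orthogonal W) := by
    intro x hx y hy
    have hx' := h x hx
    have hy' := h y hy
    have hxy := h (y + x) ((B.orthogonal W).add_mem hy hx)
    rw [map_add_eq, hx', hy', zero_add, zero_add] at hxy
    exact hxy
  have h2 := Submodule.finrank_mono h1
  have h3 := LinearMap.BilinForm.finrank_orthogonal hn W
  have h4 := LinearMap.BilinForm.finrank_orthogonal hn (B.orthogonal W)
  have h5 := Submodule.finrank_le W
  omega

theorem siegel_mem_reflSubgroup [FiniteDimensional F V] (hQ : ∀ x, (∀ y, bil Q x y = 0) → x = 0)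
    (hV : 5 ≤ finrank F V) {a b : V} (ha : Q a = 0) (hab : bil Q a b = 0) (hb : Q b = 0) :
    siegel Q a b ha hab ∈ reflSubgroup Q := by
  classical
  have hs := finrank_span_finset_le_card (R := F) ({a, b} : Finset V)
  have hc : Finset.card ({a, b} : Finset V) ≤ 2 := Finset.card_le_two
  obtain ⟨y, hy, hy0⟩ := exists_orthogonal_ne_zero hQ (Submodule.span F ({a, b} : Finset V))
    (by rw [Set.finrank] at hs; omega)
  have hay : bil Q a y = 0 := hy a (Submodule.subset_span (by simp))
  have hby : bil Q b y = 0 := hy b (Submodule.subset_span (by simp))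
  have h1 : Q (b - y) ≠ 0 := by rw [map_sub_eq, hb, hby]; simpa using hy0
  have h2 : bil Q a (b - y) = 0 := by rw [map_sub, hab, hay, sub_zero]
  have := siegel_mul_siegel ha h2 hay
  simp only [sub_add_cancel] at this
  rw [← this]
  exact mul_mem (siegel_mem_reflSubgroup_of_ne_zero ha h2 h1)
    (siegel_mem_reflSubgroup_of_ne_zero ha hay hy0)

theorem bil_sub_eq_zero_of_fixed {g : V ≃ₗ[F] V} (hg : g ∈ orthogonalGroup Q) {x : V} (hx : g x = x)
    (v : V) : bil Q (g v - v) x = 0 := by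
  rw [map_sub, LinearMap.sub_apply, ← map_bil hg v x, hx, sub_self]

theorem refl_sub_apply {g : V ≃ₗ[F] V} (hg : g ∈ orthogonalGroup Q) {v : V} (h : Q (g v - v) ≠ 0) :
    (refl Q (g v - v) h : V ≃ₗ[F] V) (g v) = v := by
  have hv : Q (g v) = Q v := hg v
  have e : bil Q (g v - v) (g v) = Q (g v - v) := by
    rw [map_sub_eq, map_sub, LinearMap.sub_apply, bil_self, bil_comm v, hv]
    ring
  rw [refl_apply, e, inv_mul_cancel₀ h, one_smul, sub_sub_cancel]

theorem refl_apply_of_bil_eq_zero {a : V} (h : Q a ≠ 0) {x : V} (hx : bil Q a x = 0) :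
    (refl Q a h : V ≃ₗ[F] V) x = x := by
  rw [refl_apply, hx, mul_zero, zero_smul, sub_zero]

/-- The orthogonal group is generated by reflections if the dimension is at least five. -/
theorem mem_reflSubgroup [FiniteDimensional F V] (hQ : ∀ x, (∀ y, bil Q x y = 0) → x = 0)
    (hV : 5 ≤ finrank F V) (g : orthogonalGroup Q) : g ∈ reflSubgroup Q := by
  refine mem_of_forall_exists_fixedSpace_lt _ (fun g hg => ?_) g
  obtain ⟨v, hv⟩ := exists_apply_ne (g := (g : V ≃ₗ[F] V)) fun h => hg (Subtype.ext h)
  by_cases hs : ∃ v, Q ((g : V ≃ₗ[F] V) v - v) ≠ 0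
  · obtain ⟨v, hv⟩ := hs
    refine ⟨refl Q _ hv, refl_mem_reflSubgroup _, fixedSpace_lt (v := v) (fun x hx => ?_)
      (fun h => hv ?_) (refl_sub_apply g.2 hv)⟩
    · exact refl_apply_of_bil_eq_zero hv (bil_sub_eq_zero_of_fixed g.2 hx v)
    · rw [h, sub_self, map_zero]
  · -- The image of `g - 1` is totally singular, and a Siegel transformation moves `g v` back to `v`.
    push Not at hs
    set a := (g : V ≃ₗ[F] V) v - v with ha
    have ha0 : a ≠ 0 := sub_ne_zero.2 hv
    have hor : ∃ w, bil Q w a = 1 := by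
      by_contra! h
      refine ha0 (hQ a fun y => ?_)
      by_contra hy
      refine h ((bil Q a y)⁻¹ • y) ?_
      rw [map_smul, LinearMap.smul_apply, bil_comm y, smul_eq_mul, inv_mul_cancel₀ hy]
    obtain ⟨w, hw⟩ := hor
    set b := (g : V ≃ₗ[F] V) w - w with hb
    have hQa : Q a = 0 := hs v
    have hQb : Q b = 0 := hs w
    have hab : bil Q a b = 0 := by
      have h1 := hs (v + w)
      have h2 : (g : V ≃ₗ[F] V) (v + w) - (v + w) = a + b := by rw [map_add, ha, hb]; abel
      rw [h2, map_add_eq, hQa, hQb, zero_add, zero_add] at h1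
      exact h1
    refine ⟨siegel Q a b hQa hab, siegel_mem_reflSubgroup hQ hV hQa hab hQb,
      fixedSpace_lt (v := v) (fun x hx => ?_) hv ?_⟩
    · rw [siegel_apply_of_singular hQa hab hQb, bil_sub_eq_zero_of_fixed g.2 hx,
        bil_sub_eq_zero_of_fixed g.2 hx, zero_smul, zero_smul, add_zero, sub_zero]
    · have e1 : bil Q a ((g : V ≃ₗ[F] V) v) = 0 := by
        have hv' : Q ((g : V ≃ₗ[F] V) v) = Q v := g.2 v
        rw [ha, map_sub_eq] at hQa
        rw [ha, map_sub, LinearMap.sub_apply, bil_self, bil_comm v, hv']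
        rw [hv'] at hQa
        linear_combination hQa
      have e2 : bil Q b ((g : V ≃ₗ[F] V) v) = -1 := by
        rw [hb, map_sub, LinearMap.sub_apply, map_bil g.2, ← hw, ha, map_sub]
        ring
      rw [siegel_apply_of_singular hQa hab hQb, e1, e2, ha]
      module

end Orthogonal

end FiniteClassical

namespace FiniteClassical

open Module

/-! ### Quadratic spaces: the parity of the degree and conjugacy of reflections -/

section Parity

variable {F : Type*} [Field F] {V : Type*} [AddCommGroup V] [Module F V]
  {Q : QuadraticForm F V}

/-- The image of `g - 1` is the orthogonal space of the fixed space of `g`. -/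
theorem exists_apply_sub_eq [FiniteDimensional F V] (hQ : ∀ x, (∀ y, bil Q x y = 0) → x = 0)
    {g : V ≃ₗ[F] V} (hg : g ∈ orthogonalGroup Q) {a : V}
    (ha : ∀ x ∈ fixedSpace g, bil Q a x = 0) : ∃ v, g v - v = a := by
  let B : LinearMap.BilinForm F V := bil Q
  have hn : B.Nondegenerate := ⟨hQ, fun y hy => hQ y fun x => by rw [bil_comm]; exact hy x⟩
  have h1 : LinearMap.range ((g : V →ₗ[F] V) - LinearMap.id) ≤ B.orthogonal (fixedSpace g) := by
    rintro _ ⟨v, rfl⟩ x hx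
    change bil Q x (g v - v) = 0
    rw [bil_comm, bil_sub_eq_zero_of_fixed hg (mem_fixedSpace.1 hx)]
  have h2 : finrank F (B.orthogonal (fixedSpace g)) = _ := LinearMap.BilinForm.finrank_orthogonal hn _
  have h3 := degree_add_finrank_fixedSpace g
  have h4 := Submodule.eq_of_le_of_finrank_eq h1 (by rw [h2]; unfold degree at h3; omega)
  have h5 : a ∈ B.orthogonal (fixedSpace g) := fun x hx => by
    change bil Q x a = 0
    rw [bil_comm, ha x hx]
  rw [← h4] at h5
  exact h5

theorem finrank_fixedSpace_refl_mul_le [FiniteDimensional F V] (g : orthogonalGroup Q) {a : V}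
    (h : Q a ≠ 0) : finrank F (fixedSpace ((refl Q a h * g : orthogonalGroup Q) : V ≃ₗ[F] V)) ≤
      finrank F (fixedSpace (g : V ≃ₗ[F] V)) + 1 := by
  set W := fixedSpace ((refl Q a h * g : orthogonalGroup Q) : V ≃ₗ[F] V)
  let L : W →ₗ[F] F := (bil Q a).comp (((g : V ≃ₗ[F] V) : V →ₗ[F] V).comp W.subtype)
  have h1 := LinearMap.finrank_range_add_finrank_ker L
  have h2 := Submodule.finrank_le (LinearMap.range L)
  rw [finrank_self] at h2
  have h3 : (LinearMap.ker L).map W.subtype ≤ fixedSpace (g : V ≃ₗ[F] V) := by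
    rintro _ ⟨x, hx, rfl⟩
    have hx' : bil Q a ((g : V ≃ₗ[F] V) x) = 0 := hx
    have hxW := mem_fixedSpace.1 x.2
    rw [orthogonalGroup_mul_apply, refl_apply_of_bil_eq_zero h hx'] at hxW
    exact mem_fixedSpace.2 hxW
  have h4 := Submodule.finrank_mono h3
  rw [Submodule.finrank_map_subtype_eq] at h4
  omega

/-- Multiplying by a reflection changes the degree by exactly one. -/
theorem degree_refl_mul [FiniteDimensional F V] (hQ : ∀ x, (∀ y, bil Q x y = 0) → x = 0)
    (g : orthogonalGroup Q) {a : V} (h : Q a ≠ 0) :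
    degree ((refl Q a h * g : orthogonalGroup Q) : V ≃ₗ[F] V) + 1 = degree (g : V ≃ₗ[F] V) ∨
      degree ((refl Q a h * g : orthogonalGroup Q) : V ≃ₗ[F] V) = degree (g : V ≃ₗ[F] V) + 1 := by
  have d1 := degree_add_finrank_fixedSpace (g : V ≃ₗ[F] V)
  have d2 := degree_add_finrank_fixedSpace ((refl Q a h * g : orthogonalGroup Q) : V ≃ₗ[F] V)
  have u1 := finrank_fixedSpace_refl_mul_le g h
  have u2 := finrank_fixedSpace_refl_mul_le (refl Q a h * g) h
  rw [← mul_assoc, refl_mul_self, one_mul] at u2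
  by_cases hv : ∃ v, (g : V ≃ₗ[F] V) v - v = a
  · obtain ⟨v, rfl⟩ := hv
    have := Submodule.finrank_lt_finrank_of_lt (fixedSpace_lt (v := v)
      (h := (refl Q ((g : V ≃ₗ[F] V) v - v) h : V ≃ₗ[F] V))
      (fun x hx => refl_apply_of_bil_eq_zero h (bil_sub_eq_zero_of_fixed g.2 hx v))
      (fun e => h (by rw [e, sub_self, map_zero])) (refl_sub_apply g.2 h))
    rw [← Subgroup.coe_mul] at this
    left
    omega
  · have hx : ∃ x ∈ fixedSpace (g : V ≃ₗ[F] V), bil Q a x ≠ 0 := by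
      by_contra! hcon
      exact hv (exists_apply_sub_eq hQ g.2 hcon)
    obtain ⟨x, hx, hax⟩ := hx
    have hlt : fixedSpace ((refl Q a h * g : orthogonalGroup Q) : V ≃ₗ[F] V) <
        fixedSpace (g : V ≃ₗ[F] V) := by
      refine lt_of_le_of_ne (fun y hy => ?_) fun e => ?_
      · have hy1 := mem_fixedSpace.1 hy
        have hy2 : (g : V ≃ₗ[F] V) y = (refl Q a h : V ≃ₗ[F] V) y := by
          conv_rhs => rw [← hy1, ← orthogonalGroup_mul_apply, ← mul_assoc, refl_mul_self, one_mul]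
        rw [refl_apply] at hy2
        by_cases h0 : (Q a)⁻¹ * bil Q a y = 0
        · rw [h0, zero_smul, sub_zero] at hy2
          exact mem_fixedSpace.2 hy2
        · refine absurd ⟨-((Q a)⁻¹ * bil Q a y)⁻¹ • y, ?_⟩ hv
          rw [map_smul, hy2, ← smul_sub, sub_sub_cancel_left, smul_neg, neg_smul, neg_neg,
            smul_smul, inv_mul_cancel₀ h0, one_smul]
      · rw [← e] at hx
        have h1 := mem_fixedSpace.1 hx
        rw [e] at hx
        rw [orthogonalGroup_mul_apply, mem_fixedSpace.1 hx, refl_apply, sub_eq_self, smul_eq_zero,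
          mul_eq_zero] at h1
        rcases h1 with (h1 | h1) | h1
        · exact h (inv_eq_zero.1 h1)
        · exact hax h1
        · exact h (by rw [h1, map_zero])
    have := Submodule.finrank_lt_finrank_of_lt hlt
    right
    omega

theorem degree_one : degree (1 : V ≃ₗ[F] V) = 0 := by
  have : ((1 : V ≃ₗ[F] V) : V →ₗ[F] V) - LinearMap.id = 0 := sub_self _
  rw [degree, this, LinearMap.range_zero, finrank_bot]

/-- On an orthogonal group the degree is additive modulo two; this is the Dickson invariant. -/
theorem cast_degree_mul [FiniteDimensional F V] (hQ : ∀ x, (∀ y, bil Q x y = 0) → x = 0)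
    (hV : 5 ≤ finrank F V) (g h : orthogonalGroup Q) :
    (degree ((g * h : orthogonalGroup Q) : V ≃ₗ[F] V) : ZMod 2) =
      degree (g : V ≃ₗ[F] V) + degree (h : V ≃ₗ[F] V) := by
  have h2 : (1 : ZMod 2) + 1 = 0 := by decide
  have hs : ∀ {a b : ZMod 2}, a + 1 = b → a = b + 1 := fun {a b} e => by linear_combination e - h2
  have key : ∀ {a : V} (ha : Q a ≠ 0) (h : orthogonalGroup Q),
      (degree ((refl Q a ha * h : orthogonalGroup Q) : V ≃ₗ[F] V) : ZMod 2) =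
        degree (h : V ≃ₗ[F] V) + 1 := by
    intro a ha h
    rcases degree_refl_mul hQ h ha with e | e
    · exact hs (by exact_mod_cast congrArg (Nat.cast (R := ZMod 2)) e)
    · exact_mod_cast congrArg (Nat.cast (R := ZMod 2)) e
  have hg := mem_reflSubgroup hQ hV g
  induction hg using Subgroup.closure_induction generalizing h with
  | mem g hg =>
    obtain ⟨a, ha, rfl⟩ := hg
    have h1 := key ha 1
    rw [mul_one, Subgroup.coe_one, degree_one, Nat.cast_zero, zero_add] at h1
    rw [key, h1, add_comm]
  | one => rw [one_mul, Subgroup.coe_one, degree_one, Nat.cast_zero, zero_add]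
  | mul x y _ _ hx hy => rw [mul_assoc, hx, hy, hx y, add_assoc]
  | inv x _ hx =>
    have h1 := hx x⁻¹
    have h3 := hx (x⁻¹ * h)
    rw [mul_inv_cancel, Subgroup.coe_one, degree_one, Nat.cast_zero] at h1
    rw [mul_inv_cancel_left] at h3
    linear_combination h1 - h3

/-- The elements of `Ω` have even degree. -/
theorem even_degree_of_mem_SCl [FiniteDimensional F V] {nondeg : (QuadraticMap.polarBilin Q).Nondegenerate}
    (hV : 5 ≤ finrank F V) {g : V ≃ₗ[F] V} (hg : g ∈ SCl (.orthogonal Q nondeg)) :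
    Even (degree g) := by
  let χ : orthogonalGroup Q →* Multiplicative (ZMod 2) :=
    MonoidHom.mk' (fun g => Multiplicative.ofAdd (degree (g : V ≃ₗ[F] V) : ZMod 2)) fun g h =>
      congrArg Multiplicative.ofAdd (cast_degree_mul nondeg.1 hV g h)
  have hle : ⁅orthogonalGroup Q ⊓ detOne F V, orthogonalGroup Q ⊓ detOne F V⁆ ≤
      χ.ker.map (orthogonalGroup Q).subtype := by
    rw [Subgroup.commutator_le]
    intro g₁ h₁ g₂ h₂
    let k₁ : orthogonalGroup Q := ⟨g₁, h₁.1⟩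
    let k₂ : orthogonalGroup Q := ⟨g₂, h₂.1⟩
    refine ⟨k₁ * k₂ * k₁⁻¹ * k₂⁻¹, ?_, rfl⟩
    rw [SetLike.mem_coe, MonoidHom.mem_ker, map_mul, map_mul, map_mul, map_inv, map_inv,
      mul_inv_cancel_comm, mul_inv_cancel]
  obtain ⟨g', hg', rfl⟩ := hle hg
  exact (ZMod.natCast_eq_zero_iff_even).1 (congrArg Multiplicative.toAdd hg')

theorem of_refl_eq_of_map {a b : V} (ha : Q a ≠ 0) (hb : Q b ≠ 0) {c : F} (g : orthogonalGroup Q)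
    (hg : (g : V ≃ₗ[F] V) a = c • b) :
    Abelianization.of (refl Q b hb) = Abelianization.of (refl Q a ha) := by
  have hQ : Q a = c * c * Q b := by
    have : Q ((g : V ≃ₗ[F] V) a) = Q a := g.2 a
    rw [← this, hg, map_smul_eq]
  have hc : c ≠ 0 := by
    rintro rfl
    exact ha (by rw [hQ]; ring)
  have : g * refl Q a ha = refl Q b hb * g := by
    refine orthogonalGroup_ext fun x => ?_
    have hB : bil Q a x = c * bil Q b ((g : V ≃ₗ[F] V) x) := by
      rw [← map_bil g.2, hg, map_smul, LinearMap.smul_apply, smul_eq_mul]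
    rw [orthogonalGroup_mul_apply, orthogonalGroup_mul_apply, refl_apply, refl_apply, map_sub,
      map_smul, hg, smul_smul, hQ, hB]
    congr 2
    field_simp
  have := congrArg (Abelianization.of (G := orthogonalGroup Q)) this
  rw [map_mul, map_mul, mul_comm] at this
  exact (mul_right_cancel this).symm

/-- Reflections along vectors with the same value of the quadratic form are conjugate. -/
theorem of_refl_eq [Finite F] [FiniteDimensional F V] (hQ : ∀ x, (∀ y, bil Q x y = 0) → x = 0)
    (hV : 7 ≤ finrank F V) {v v' : V} (hv : Q v ≠ 0) (hv' : Q v' ≠ 0) (hvv : Q v = Q v') :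
    Abelianization.of (refl Q v hv) = Abelianization.of (refl Q v' hv') := by
  classical
  have key : ∀ {x y : V} (hx : Q x ≠ 0) (hy : Q y ≠ 0), Q x = Q y → Q (x - y) ≠ 0 →
      Abelianization.of (refl Q x hx) = Abelianization.of (refl Q y hy) := by
    intro x y hx hy hxy h
    refine (of_refl_eq_of_map hx hy (c := 1) (refl Q _ h) ?_).symm
    have e : bil Q (x - y) x = Q (x - y) := by
      rw [map_sub_eq, map_sub, LinearMap.sub_apply, bil_self, bil_comm y, ← hxy]
      ring
    rw [refl_apply, e, inv_mul_cancel₀ h]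
    simp
  have scale : ∀ {x : V} (hx : Q x ≠ 0) {c : F} (hc : Q (c • x) ≠ 0),
      Abelianization.of (refl Q x hx) = Abelianization.of (refl Q (c • x) hc) :=
    fun hx c hc => of_refl_eq_of_map hc hx 1 rfl
  by_cases h1 : Q (v - v') = 0
  · by_cases h2 : Q (v - (-1 : F) • v') = 0
    · -- The characteristic is two, and `v`, `v'` are orthogonal.
      rw [map_sub_eq, ← hvv] at h1
      rw [map_sub_eq, map_smul_eq, ← hvv, map_smul, smul_eq_mul] at h2
      have h4 : (2 : F) * 2 * Q v = 0 := by linear_combination h1 + h2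
      have htwo : (2 : F) = 0 := by simpa [hv] using h4
      have hbil : bil Q v v' = 0 := by linear_combination Q v * htwo - h1
      have hchar : ringChar F = 2 := by
        have := CharTwo.of_one_ne_zero_of_two_eq_zero (one_ne_zero (α := F)) htwo
        exact ringChar.eq F 2
      have hne : ∀ {x : V}, Q x ≠ 0 → bil Q x ≠ 0 := fun {x} hx h =>
        hx (by rw [hQ x fun y => by rw [h]; rfl, map_zero])
      obtain ⟨z₀, hz₀, hz₀'⟩ := exists_apply_ne_zero_and (hne hv) (hne hv')
      have hz : ∃ z, bil Q v z ≠ 0 ∧ bil Q v' z ≠ 0 ∧ Q z ≠ 0 := by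
        by_cases h0 : Q z₀ = 0
        · have hs := finrank_span_finset_le_card (R := F) ({v, v', z₀} : Finset V)
          have hc : Finset.card ({v, v', z₀} : Finset V) ≤ 3 := Finset.card_le_three
          obtain ⟨y, hy, hy0⟩ := exists_orthogonal_ne_zero hQ
            (Submodule.span F ({v, v', z₀} : Finset V)) (by rw [Set.finrank] at hs; omega)
          have hy1 : bil Q v y = 0 := hy v (Submodule.subset_span (by simp))
          have hy2 : bil Q v' y = 0 := hy v' (Submodule.subset_span (by simp))
          have hy3 : bil Q z₀ y = 0 := hy z₀ (Submodule.subset_span (by simp))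
          exact ⟨z₀ + y, by rwa [map_add, hy1, add_zero], by rwa [map_add, hy2, add_zero],
            by rwa [map_add_eq, h0, hy3, zero_add, add_zero]⟩
        · exact ⟨z₀, hz₀, hz₀', h0⟩
      obtain ⟨z, hz1, hz2, hz3⟩ := hz
      obtain ⟨c, hc⟩ := FiniteField.isSquare_of_char_two hchar (Q v / Q z)
      have hcz : Q (c • z) = Q v := by
        rw [map_smul_eq, ← hc, div_mul_cancel₀ _ hz3]
      have hc0 : c ≠ 0 := by
        rintro rfl
        rw [mul_zero, div_eq_zero_iff] at hc
        tauto
      have hcz' : Q (c • z) ≠ 0 := by rwa [hcz]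
      rw [key hv hcz' hcz.symm ?_, key hv' hcz' (by rw [hcz, hvv]) ?_]
      · rw [map_sub_eq, hcz, ← hvv, map_smul, smul_eq_mul]
        have e : Q v + Q v - c * bil Q v' z = -(c * bil Q v' z) := by linear_combination Q v * htwo
        rw [e, neg_ne_zero]
        exact mul_ne_zero hc0 hz2
      · rw [map_sub_eq, hcz, map_smul, smul_eq_mul]
        have e : Q v + Q v - c * bil Q v z = -(c * bil Q v z) := by linear_combination Q v * htwo
        rw [e, neg_ne_zero]
        exact mul_ne_zero hc0 hz1
    · have h3 : Q ((-1 : F) • v') ≠ 0 := by rw [map_smul_eq]; simpa using hv'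
      rw [key hv h3 (by rw [map_smul_eq, hvv]; ring) h2, ← scale hv' h3]
  · exact key hv hv' hvv h1

/-- There are at most two classes of nonzero elements modulo squares in a finite field. -/
theorem exists_forall_eq_mul_self_or (F : Type*) [Field F] [Finite F] :
    ∃ η : F, η ≠ 0 ∧ ∀ x : F, x ≠ 0 → ∃ c, x = c * c ∨ x = η * (c * c) := by
  obtain ⟨g, hg⟩ := IsCyclic.exists_generator (α := Fˣ)
  refine ⟨g, g.ne_zero, fun x hx => ?_⟩
  obtain ⟨i, hi⟩ := (Submonoid.mem_powers_iff _ _).1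
    ((mem_powers_iff_mem_zpowers (x := g)).2 (hg (Units.mk0 x hx)))
  have hi' : (g : F) ^ i = x := by rw [← Units.val_pow_eq_pow_val, hi, Units.val_mk0]
  rcases Nat.even_or_odd' i with ⟨j, rfl | rfl⟩
  · exact ⟨(g : F) ^ j, Or.inl (by rw [← hi']; ring)⟩
  · exact ⟨(g : F) ^ j, Or.inr (by rw [← hi']; ring)⟩

/-- The abelianisation of an orthogonal group is generated by the classes of two reflections. -/
theorem exists_of_eq_refl_pow [Finite F] [FiniteDimensional F V]
    (hQ : ∀ x, (∀ y, bil Q x y = 0) → x = 0) (hV : 7 ≤ finrank F V) {v w : V} {η : F}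
    (hη : ∀ x : F, x ≠ 0 → ∃ c, x = c * c ∨ x = η * (c * c)) (hv : Q v = 1) (hw : Q w = η)
    (hv0 : Q v ≠ 0) (hw0 : Q w ≠ 0) (β : Abelianization (orthogonalGroup Q)) :
    ∃ i j : ℕ, Abelianization.of (refl Q v hv0 ^ i * refl Q w hw0 ^ j) = β := by
  have key : ∀ {a b : V} (ha : Q a ≠ 0) (hb : Q b ≠ 0) {c : F}, Q a = Q b * (c * c) →
      Abelianization.of (refl Q a ha) = Abelianization.of (refl Q b hb) := by
    intro a b ha hb c h
    have hc : c ≠ 0 := by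
      rintro rfl
      exact ha (by rw [h]; ring)
    have h1 : Q (c • b) ≠ 0 := by
      rw [map_smul_eq]
      exact mul_ne_zero (mul_ne_zero hc hc) hb
    rw [of_refl_eq hQ hV ha h1 (by rw [map_smul_eq, h, mul_comm])]
    exact (of_refl_eq_of_map h1 hb 1 rfl).symm
  obtain ⟨g, rfl⟩ := QuotientGroup.mk_surjective β
  change ∃ i j : ℕ, _ = Abelianization.of g
  have hg := mem_reflSubgroup hQ (by omega) g
  induction hg using Subgroup.closure_induction with
  | mem g hg =>
    obtain ⟨a, ha, rfl⟩ := hg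
    obtain ⟨c, hc | hc⟩ := hη _ ha
    · exact ⟨1, 0, by rw [pow_one, pow_zero, mul_one, key ha hv0 (by rw [hv, one_mul, hc])]⟩
    · exact ⟨0, 1, by rw [pow_one, pow_zero, one_mul, key ha hw0 (by rw [hw, hc])]⟩
  | one => exact ⟨0, 0, by simp⟩
  | mul x y _ _ hx hy =>
    obtain ⟨i, j, hx⟩ := hx
    obtain ⟨i', j', hy⟩ := hy
    refine ⟨i + i', j + j', ?_⟩
    rw [map_mul Abelianization.of x y, ← hx, ← hy]
    simp only [map_mul, map_pow, pow_add]
    exact mul_mul_mul_comm _ _ _ _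
  | inv x _ hx =>
    obtain ⟨i, j, hx⟩ := hx
    refine ⟨i, j, ?_⟩
    have hsq : ∀ {a : V} (ha : Q a ≠ 0), Abelianization.of (refl Q a ha) *
        Abelianization.of (refl Q a ha) = 1 := fun ha => by
      rw [← map_mul, refl_mul_self, map_one]
    rw [map_inv, ← hx, eq_inv_iff_mul_eq_one, map_mul, map_pow, map_pow, mul_mul_mul_comm,
      ← mul_pow, ← mul_pow, hsq, hsq, one_pow, one_pow, one_mul]

end Parity

end FiniteClassical

namespace FiniteClassical

open Module
open scoped commutatorElement

/-! ### Orthogonal groups -/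

section OrthogonalSpace

variable {F : Type*} [Field F] {V : Type*} [AddCommGroup V] [Module F V]

/-- A quadratic form in three variables over a finite field has a nontrivial zero. -/
theorem exists_singular_of_finrank [Finite F] [FiniteDimensional F V] (Q : QuadraticForm F V)
    (W : Submodule F V) (hW : 3 ≤ finrank F W) : ∃ a ∈ W, a ≠ 0 ∧ Q a = 0 := by
  classical
  have := Fintype.ofFinite F
  let b₀ := Module.finBasis F W
  let b : Fin 3 → V := fun i => b₀ (Fin.castLE hW i)
  have hb : LinearIndependent F b :=
    (b₀.linearIndependent.map' W.subtype W.ker_subtype).comp _ (Fin.castLE_injective hW)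
  have hbW : ∀ i, b i ∈ W := fun i => (b₀ _).2
  let p : MvPolynomial (Fin 3) F := ∑ i : Fin 3, ∑ j : Fin 3,
    MvPolynomial.C (if i = j then Q (b i) else if i < j then bil Q (b i) (b j) else 0) *
      (MvPolynomial.X i * MvPolynomial.X j)
  have hp : p.totalDegree < Fintype.card (Fin 3) := by
    rw [Fintype.card_fin]
    refine lt_of_le_of_lt (MvPolynomial.totalDegree_finsetSum_le (d := 2) fun i _ =>
      MvPolynomial.totalDegree_finsetSum_le fun j _ => ?_) (by norm_num)
    refine (MvPolynomial.totalDegree_mul _ _).trans ?_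
    rw [MvPolynomial.totalDegree_C, zero_add]
    refine (MvPolynomial.totalDegree_mul _ _).trans ?_
    rw [MvPolynomial.totalDegree_X, MvPolynomial.totalDegree_X]
  have heval : ∀ x : Fin 3 → F, MvPolynomial.eval x p = Q (∑ i, x i • b i) := by
    intro x
    simp only [p, map_mul, MvPolynomial.eval_C, MvPolynomial.eval_X, Fin.sum_univ_three,
      map_add_eq, map_smul_eq, map_add, map_smul, LinearMap.add_apply, LinearMap.smul_apply,
      smul_eq_mul]
    simp [Fin.lt_def, Fin.ext_iff]
    ring
  obtain ⟨q, hq⟩ := CharP.exists F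
  have hqp : q.Prime := CharP.char_is_prime F q
  have hdvd := char_dvd_card_solutions q hp
  have h0 : MvPolynomial.eval (0 : Fin 3 → F) p = 0 := by rw [heval]; simp
  have hone : 1 < Fintype.card {x : Fin 3 → F // MvPolynomial.eval x p = 0} :=
    lt_of_lt_of_le hqp.one_lt (Nat.le_of_dvd (Fintype.card_pos_iff.2 ⟨⟨0, h0⟩⟩) hdvd)
  obtain ⟨⟨x, hx⟩, hx0⟩ := Fintype.exists_ne_of_one_lt_card hone ⟨0, h0⟩
  refine ⟨∑ i, x i • b i, W.sum_mem fun i _ => W.smul_mem _ (hbW i), fun e => hx0 ?_, ?_⟩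
  · exact Subtype.ext (funext fun i => Fintype.linearIndependent_iff.1 hb x e i)
  · rw [← heval, hx]

/-- The polar space of a quadratic form with nondegenerate polar form. -/
def orthogonalSpace [Finite F] [FiniteDimensional F V] (Q : QuadraticForm F V)
    (nondeg : (QuadraticMap.polarBilin Q).Nondegenerate) : PolarSpace F V where
  θ := RingHom.id F
  ε := 1
  η := 1
  f := bil Q
  Q := Q
  θ_θ _ := rfl
  θ_ε := rfl
  ε_ε := by ring
  η_symm c := by simp
  symm x y := by rw [RingHom.id_apply, one_mul, bil_comm]
  nondeg := nondeg.1
  Q_add x y := by rw [map_add_eq, one_mul]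
  Q_smul c x h := by rw [map_smul_eq, h, mul_zero]
  exists_singular W hW := by
    obtain ⟨a, ha, h0, hQ⟩ := exists_singular_of_finrank Q W hW
    exact ⟨a, ha, h0, by rw [bil_self, hQ, mul_zero], hQ⟩
  exists_adjust a b ha hQ hab := by
    have : Q (b + (-Q b) • a) = 0 := by
      rw [map_add_eq, map_smul_eq, hQ, map_smul, bil_comm, hab, smul_eq_mul]
      ring
    exact ⟨-Q b, by rw [bil_self, this, mul_zero], this⟩

theorem group_orthogonalSpace [Finite F] [FiniteDimensional F V] (Q : QuadraticForm F V)
    (nondeg : (QuadraticMap.polarBilin Q).Nondegenerate) :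
    (orthogonalSpace Q nondeg).group = orthogonalGroup Q :=
  Subgroup.ext fun _ => ⟨fun h => h.2, fun h => ⟨map_bil h, h⟩⟩

theorem degree_inv [FiniteDimensional F V] (g : V ≃ₗ[F] V) : degree g⁻¹ = degree g := by
  have : fixedSpace g⁻¹ = fixedSpace g := by
    ext x
    rw [mem_fixedSpace, mem_fixedSpace]
    exact ⟨fun h => by conv_lhs => rw [← h]; exact g.apply_symm_apply x,
      fun h => by conv_lhs => rw [← h]; exact g.symm_apply_apply x⟩
  have h1 := degree_add_finrank_fixedSpace g
  have h2 := degree_add_finrank_fixedSpace g⁻¹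
  rw [this] at h2
  omega

theorem inv_mem_minimalDegreeSet [FiniteDimensional F V] {Γ : ClassicalForm F V} {g : V ≃ₗ[F] V}
    (hg : g ∈ minimalDegreeSet Γ) : g⁻¹ ∈ minimalDegreeSet Γ :=
  ⟨inv_mem hg.1, inv_ne_one.2 hg.2.1, by rw [degree_inv]; exact hg.2.2⟩

variable {Q : QuadraticForm F V}

theorem degree_le_finrank_of_forall [FiniteDimensional F V] {g : V ≃ₗ[F] V} {W : Submodule F V}
    (h : ∀ x, g x - x ∈ W) : degree g ≤ finrank F W :=
  Submodule.finrank_mono (LinearMap.range_le_iff_comap.2 (Submodule.eq_top_iff'.2 h))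

theorem degree_siegel_le [FiniteDimensional F V] {a b : V} (ha : Q a = 0) (hab : bil Q a b = 0)
    (hb : Q b = 0) : degree (siegel Q a b ha hab : V ≃ₗ[F] V) ≤ 2 := by
  classical
  have hs : finrank F (Submodule.span F ({a, b} : Set V)) ≤ 2 := by
    rw [← Finset.coe_pair]
    exact (finrank_span_finset_le_card _).trans Finset.card_le_two
  refine (degree_le_finrank_of_forall (W := Submodule.span F ({a, b} : Set V)) fun x => ?_).trans hs
  rw [siegel_apply_of_singular ha hab hb, add_sub_assoc, add_sub_cancel_left]
  exact Submodule.mem_span_pair.2 ⟨bil Q b x, -bil Q a x, by rw [neg_smul, sub_eq_add_neg]⟩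

theorem siegel_mem_minimalDegreeSet [FiniteDimensional F V]
    {nondeg : (QuadraticMap.polarBilin Q).Nondegenerate} (hV : 5 ≤ finrank F V) {a b : V}
    (ha : Q a = 0) (hab : bil Q a b = 0) (hb : Q b = 0)
    (hS : (siegel Q a b ha hab : V ≃ₗ[F] V) ∈ SCl (.orthogonal Q nondeg))
    (h1 : (siegel Q a b ha hab : V ≃ₗ[F] V) ≠ 1) :
    (siegel Q a b ha hab : V ≃ₗ[F] V) ∈ minimalDegreeSet (.orthogonal Q nondeg) := by
  refine ⟨hS, h1, fun h hh hh1 => (degree_siegel_le ha hab hb).trans ?_⟩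
  obtain ⟨k, hk⟩ := even_degree_of_mem_SCl hV hh
  have := degree_pos hh1
  omega

/-- A hyperbolic family with respect to a quadratic form. -/
structure IsHyp {I : Type*} [DecidableEq I] (Q : QuadraticForm F V) (e e' : I → V) : Prop where
  ee : ∀ i j, bil Q (e i) (e j) = 0
  ee' : ∀ i j, bil Q (e i) (e' j) = if i = j then 1 else 0
  e'e : ∀ i j, bil Q (e' i) (e j) = if i = j then 1 else 0
  e'e' : ∀ i j, bil Q (e' i) (e' j) = 0
  Qe : ∀ i, Q (e i) = 0
  Qe' : ∀ i, Q (e' i) = 0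

variable {I : Type*} [DecidableEq I] {e e' : I → V}

/-- The Siegel transformation of `e i` and `e' j`. -/
def IsHyp.elem (he : IsHyp Q e e') {i j : I} (hij : i ≠ j) : orthogonalGroup Q :=
  siegel Q (e i) (e' j) (he.Qe i) (by rw [he.ee', if_neg hij])

theorem IsHyp.elem_apply (he : IsHyp Q e e') {i j : I} (hij : i ≠ j) (x : V) :
    (he.elem hij : V ≃ₗ[F] V) x = x + bil Q (e' j) x • e i - bil Q (e i) x • e' j :=
  siegel_apply_of_singular _ _ (he.Qe' j) x

theorem IsHyp.elem_apply_of_eq_zero (he : IsHyp Q e e') {i j : I} (hij : i ≠ j) {x : V}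
    (h1 : bil Q (e i) x = 0) (h2 : bil Q (e' j) x = 0) : (he.elem hij : V ≃ₗ[F] V) x = x := by
  rw [he.elem_apply, h1, h2, zero_smul, zero_smul, add_zero, sub_zero]

theorem IsHyp.elem_mul_elem (he : IsHyp Q e e') {i j l : I} (hil : i ≠ l) (hlj : l ≠ j)
    (hij : i ≠ j) :
    he.elem hil * he.elem hlj = he.elem hij * (he.elem hlj * he.elem hil) := by
  refine orthogonalGroup_ext fun x => ?_
  simp only [orthogonalGroup_mul_apply, he.elem_apply, map_add, map_sub, map_smul, he.ee, he.ee',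
    he.e'e, he.e'e', hil, hij, hij.symm, hlj.symm, if_true, if_false, smul_eq_mul]
  module

theorem IsHyp.of_elem (he : IsHyp Q e e') {i j l : I} (hil : i ≠ l) (hlj : l ≠ j) (hij : i ≠ j) :
    Abelianization.of (he.elem hij) = 1 := by
  have := congrArg (Abelianization.of (G := orthogonalGroup Q)) (he.elem_mul_elem hil hlj hij)
  rw [map_mul, map_mul, map_mul, mul_comm (Abelianization.of (he.elem hlj))] at this
  exact right_eq_mul.1 this

theorem IsHyp.elem_mem_detOne (he : IsHyp Q e e') {i j l : I} (hil : i ≠ l) (hlj : l ≠ j)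
    (hij : i ≠ j) : (he.elem hij : V ≃ₗ[F] V) ∈ detOne F V := by
  have := congrArg (fun g : orthogonalGroup Q => LinearEquiv.det (g : V ≃ₗ[F] V))
    (he.elem_mul_elem hil hlj hij)
  simp only [Subgroup.coe_mul, map_mul] at this
  rw [mul_comm (LinearEquiv.det (he.elem hlj : V ≃ₗ[F] V))] at this
  exact right_eq_mul.1 this

theorem IsHyp.elem_mem_SCl (he : IsHyp Q e e') (nondeg : (QuadraticMap.polarBilin Q).Nondegenerate)
    {i j l l' : I} (hil : i ≠ l) (hlj : l ≠ j) (hij : i ≠ j) (hil' : i ≠ l') (hl'j : l' ≠ j)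
    (hll' : l ≠ l') : (he.elem hij : V ≃ₗ[F] V) ∈ SCl (.orthogonal Q nondeg) := by
  have h1 : (he.elem hil : V ≃ₗ[F] V) ∈ orthogonalGroup Q ⊓ detOne F V :=
    Subgroup.mem_inf.2 ⟨Subtype.prop _, he.elem_mem_detOne hil' hll'.symm hil⟩
  have h2 : (he.elem hlj : V ≃ₗ[F] V) ∈ orthogonalGroup Q ⊓ detOne F V :=
    Subgroup.mem_inf.2 ⟨Subtype.prop _, he.elem_mem_detOne hll' hl'j hlj⟩
  have h3 := Subgroup.commutator_mem_commutator h1 h2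
  have h4 := congrArg Subtype.val (he.elem_mul_elem hil hlj hij)
  have h5 : (he.elem hij : V ≃ₗ[F] V) = ⁅(he.elem hil : V ≃ₗ[F] V), (he.elem hlj : V ≃ₗ[F] V)⁆ := by
    rw [commutatorElement_def, eq_mul_inv_iff_mul_eq, eq_mul_inv_iff_mul_eq, mul_assoc]
    exact h4.symm
  rw [h5]
  exact h3

theorem IsHyp.elem_ne_one (he : IsHyp Q e e') {i j : I} (hij : i ≠ j) :
    (he.elem hij : V ≃ₗ[F] V) ≠ 1 := by
  intro h
  have h1 := LinearEquiv.congr_fun h (e j)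
  rw [he.elem_apply, he.e'e, he.ee, if_pos rfl, one_smul, zero_smul, sub_zero] at h1
  have h2 : e i = 0 := by simpa using h1
  have h3 := he.ee' i i
  simp [h2] at h3

theorem siegel_pow {a w : V} (ha : Q a = 0) (hw : bil Q a w = 0) (n : ℕ) :
    siegel Q a w ha hw ^ n = siegel Q a ((n : F) • w) ha (by rw [map_smul, hw, smul_zero]) := by
  induction n with
  | zero => exact orthogonalGroup_ext fun x => by simp [siegel_apply]
  | succ n ih =>
    rw [pow_succ, ih, siegel_mul_siegel]
    congr 1
    push_cast
    module

theorem IsHyp.elem_pow_of_cast_eq_zero (he : IsHyp Q e e') {i j : I} (hij : i ≠ j) {n : ℕ}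
    (hn : (n : F) = 0) : he.elem hij ^ n = 1 := by
  unfold IsHyp.elem
  rw [siegel_pow]
  exact orthogonalGroup_ext fun x => by simp [siegel_apply, hn]

end OrthogonalSpace

end FiniteClassical

namespace FiniteClassical

open Module

/-! ### The fibre bound: orthogonal groups -/

section OrthogonalBound

variable {F : Type*} [Field F] {V : Type*} [AddCommGroup V] [Module F V] {Q : QuadraticForm F V}

theorem commute_refl {a : V} (ha : Q a ≠ 0) {g : orthogonalGroup Q}
    (hg : (g : V ≃ₗ[F] V) a = a) : Commute g (refl Q a ha) := by
  refine orthogonalGroup_ext fun x => ?_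
  have h := map_bil g.2 a x
  rw [hg] at h
  rw [orthogonalGroup_mul_apply, orthogonalGroup_mul_apply, refl_apply, refl_apply, map_sub,
    map_smul, hg, h]

theorem refl_pow_apply_of_bil_eq_zero {a : V} (ha : Q a ≠ 0) {x : V} (hx : bil Q a x = 0) (n : ℕ) :
    ((refl Q a ha ^ n : orthogonalGroup Q) : V ≃ₗ[F] V) x = x := by
  induction n with
  | zero => rfl
  | succ n ih => rw [pow_succ, orthogonalGroup_mul_apply, refl_apply_of_bil_eq_zero ha hx, ih]

/-- Representatives of the classes of the abelianisation of an orthogonal group: the product of an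
element `u` of the derived subgroup, supported on the first three of the five spare hyperbolic
planes, and a product of reflections along vectors in the other two. -/
theorem exists_rep_orthogonal [Finite F] [FiniteDimensional F V]
    (hQ : ∀ x, (∀ y, bil Q x y = 0) → x = 0) (hV : 7 ≤ finrank F V) {m : ℕ}
    {e e' : Fin (m + 5) → V} (he : IsHyp Q e e') {u : orthogonalGroup Q}
    (hu : Abelianization.of u = 1) (hfix : ∀ x, (∀ i : Fin 3,
      bil Q (e (Fin.natAdd m (Fin.castLE (by norm_num) i))) x = 0 ∧
        bil Q (e' (Fin.natAdd m (Fin.castLE (by norm_num) i))) x = 0) → (u : V ≃ₗ[F] V) x = x)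
    {N k : ℕ} (hN : Even N) (huN : u ^ N = 1) (hk : Even k) {S : Set (V ≃ₗ[F] V)}
    (hS : ((u ^ k : orthogonalGroup Q) : V ≃ₗ[F] V) ∈ S) (β : Abelianization (orthogonalGroup Q)) :
    ∃ w : orthogonalGroup Q, Abelianization.of w = β ∧ (w : V ≃ₗ[F] V) ^ N = 1 ∧
      (w : V ≃ₗ[F] V) ^ k ∈ S ∧
      ∀ i : Fin m, (w : V ≃ₗ[F] V) (e (Fin.castAdd 5 i)) = e (Fin.castAdd 5 i) ∧
        (w : V ≃ₗ[F] V) (e' (Fin.castAdd 5 i)) = e' (Fin.castAdd 5 i) := by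
  obtain ⟨η, hη0, hη⟩ := exists_forall_eq_mul_self_or F
  set s : Fin 5 → Fin (m + 5) := Fin.natAdd m with hs
  have hsinj : ∀ {i j}, s i = s j ↔ i = j := fun {i j} => (Fin.natAdd_injective 5 m).eq_iff
  have hsne : ∀ (i : Fin m) j, s j ≠ Fin.castAdd 5 i := fun i j h => by
    have h1 := congrArg Fin.val h
    have h2 := i.2
    rw [hs, Fin.val_natAdd, Fin.val_castAdd] at h1
    omega
  have hQv : ∀ (i : Fin 5) (c : F), Q (e (s i) + c • e' (s i)) = c := fun i c => by
    rw [map_add_eq, map_smul_eq, he.Qe, he.Qe', map_smul, he.ee', if_pos rfl, smul_eq_mul]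
    ring
  set v := e (s 3) + (1 : F) • e' (s 3) with hv
  set v' := e (s 4) + η • e' (s 4) with hv'
  have hv0 : Q v ≠ 0 := by rw [hQv]; exact one_ne_zero
  have hv0' : Q v' ≠ 0 := by rw [hQv]; exact hη0
  obtain ⟨i, j, hij⟩ := exists_of_eq_refl_pow hQ hV hη (hQv 3 1) (hQv 4 η) hv0 hv0' β
  have hbil : ∀ (l : Fin 5) (c : F) (z : Fin (m + 5)), s l ≠ z →
      (bil Q (e (s l) + c • e' (s l)) (e z) = 0 ∧ bil Q (e (s l) + c • e' (s l)) (e' z) = 0) ∧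
      bil Q (e z) (e (s l) + c • e' (s l)) = 0 ∧ bil Q (e' z) (e (s l) + c • e' (s l)) = 0 := by
    intro l c z hz
    simp only [map_add, map_smul, LinearMap.add_apply, LinearMap.smul_apply, he.ee, he.ee', he.e'e,
      he.e'e', if_neg hz, if_neg hz.symm, smul_zero, add_zero, and_self]
  have hsi : ∀ (i : Fin 3) (l : Fin 5), 3 ≤ l.val →
      s l ≠ Fin.natAdd m (Fin.castLE (by norm_num) i) := fun i l hl h => by
    have h1 := congrArg Fin.val (hsinj.1 h)
    have h2 := i.2
    rw [Fin.val_castLE] at h1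
    omega
  have huv : (u : V ≃ₗ[F] V) v = v := hfix v fun i =>
    (hbil 3 1 _ (hsi i 3 (by decide))).2
  have huv' : (u : V ≃ₗ[F] V) v' = v' := hfix v' fun i =>
    (hbil 4 η _ (hsi i 4 (by decide))).2
  have h34 : bil Q v v' = 0 := by
    have h := (hbil 3 1 (s 4) (by rw [Ne, hsinj]; decide)).1
    rw [hv', map_add, map_smul, h.1, h.2, smul_zero, add_zero]
  set D := refl Q v hv0 ^ i * refl Q v' hv0' ^ j with hD
  have hcD : Commute (refl Q v hv0) (refl Q v' hv0') :=
    commute_refl hv0' (refl_apply_of_bil_eq_zero hv0 h34)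
  have hDD : ∀ {n : ℕ}, Even n → D ^ n = 1 := by
    rintro n ⟨l, rfl⟩
    have h1 : ∀ {a : V} (ha : Q a ≠ 0), refl Q a ha ^ (l + l) = 1 := fun ha => by
      rw [← two_mul, pow_mul, pow_two, refl_mul_self, one_pow]
    rw [hD, (hcD.pow_pow i j).mul_pow, ← pow_mul, ← pow_mul, mul_comm i, mul_comm j, pow_mul,
      pow_mul, h1, h1, one_pow, one_pow, one_mul]
  have hcu : Commute u D :=
    ((commute_refl hv0 huv).pow_right i).mul_right ((commute_refl hv0' huv').pow_right j)
  have hDfix : ∀ {x}, bil Q v x = 0 → bil Q v' x = 0 → (D : V ≃ₗ[F] V) x = x := by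
    intro x h1 h2
    rw [hD, orthogonalGroup_mul_apply, refl_pow_apply_of_bil_eq_zero hv0' h2,
      refl_pow_apply_of_bil_eq_zero hv0 h1]
  refine ⟨u * D, ?_, ?_, ?_, fun i => ⟨?_, ?_⟩⟩
  · rw [map_mul, hu, one_mul, hij]
  · have : (u * D) ^ N = 1 := by rw [hcu.mul_pow, huN, hDD hN, one_mul]
    exact congrArg Subtype.val this
  · have : (u * D) ^ k = u ^ k := by rw [hcu.mul_pow, hDD hk, mul_one]
    rw [← this] at hS
    exact hS
  · rw [orthogonalGroup_mul_apply, hDfix (hbil 3 1 _ (hsne i 3)).1.1 (hbil 4 η _ (hsne i 4)).1.1]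
    exact hfix _ fun l => ⟨he.ee _ _, by rw [he.e'e, if_neg (hsne i _)]⟩
  · rw [orthogonalGroup_mul_apply, hDfix (hbil 3 1 _ (hsne i 3)).1.2 (hbil 4 η _ (hsne i 4)).1.2]
    exact hfix _ fun l => ⟨by rw [he.ee', if_neg (hsne i _)], he.e'e' _ _⟩

/-- The element `u` for `exists_rep_orthogonal`. In odd characteristic it is a Siegel
transformation. In characteristic two it is a product of two Siegel transformations whose square
is a Siegel transformation. -/
theorem exists_unipotent_orthogonal [Finite F] [FiniteDimensional F V]
    (nondeg : (QuadraticMap.polarBilin Q).Nondegenerate) (hV : 7 ≤ finrank F V) {d : ℕ}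
    (hd : d ≠ 0) {J : Type*} [DecidableEq J] {e e' : J → V} (he : IsHyp Q e e') {s : Fin 4 → J}
    (hs : Function.Injective s) : ∃ u : orthogonalGroup Q, Abelianization.of u = 1 ∧
      (∀ x, (∀ i : Fin 3, bil Q (e (s (Fin.castLE (by norm_num) i))) x = 0 ∧
        bil Q (e' (s (Fin.castLE (by norm_num) i))) x = 0) → (u : V ≃ₗ[F] V) x = x) ∧
      Even ((Nat.card F - 1) * Nat.card F ^ 2) ∧ u ^ ((Nat.card F - 1) * Nat.card F ^ 2) = 1 ∧
      Even (kappa (.orthogonal Q nondeg) * (Nat.card F ^ d - 1)) ∧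
      ((u ^ (kappa (.orthogonal Q nondeg) * (Nat.card F ^ d - 1)) : orthogonalGroup Q) :
        V ≃ₗ[F] V) ∈ minimalDegreeSet (.orthogonal Q nondeg) := by
  have := Fintype.ofFinite F
  have hcast : ((Nat.card F : ℕ) : F) = 0 := by
    rw [Nat.card_eq_fintype_card, Nat.cast_card_eq_zero]
  have hpos : 1 ≤ Nat.card F ^ d := Nat.one_le_pow _ _ Nat.card_pos
  have h01 : s 0 ≠ s 1 := hs.ne (by decide)
  have h02 : s 0 ≠ s 2 := hs.ne (by decide)
  have h03 : s 0 ≠ s 3 := hs.ne (by decide)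
  have h12 : s 1 ≠ s 2 := hs.ne (by decide)
  have h13 : s 1 ≠ s 3 := hs.ne (by decide)
  have h23 : s 2 ≠ s 3 := hs.ne (by decide)
  have hmem : ((he.elem h02 ^ (Nat.card F ^ d - 1) : orthogonalGroup Q) : V ≃ₗ[F] V) ∈
      minimalDegreeSet (.orthogonal Q nondeg) := by
    have h1 : he.elem h02 ^ (Nat.card F ^ d - 1) = (he.elem h02)⁻¹ := by
      rw [eq_inv_iff_mul_eq_one, ← pow_succ, Nat.sub_add_cancel hpos]
      exact he.elem_pow_of_cast_eq_zero h02 (by rw [Nat.cast_pow, hcast, zero_pow hd])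
    rw [h1]
    exact inv_mem_minimalDegreeSet (siegel_mem_minimalDegreeSet (by omega) _ _ (he.Qe' _)
      (he.elem_mem_SCl nondeg h01 h12 h02 h03 h23.symm h13) (he.elem_ne_one h02))
  by_cases hc : ringChar F = 2
  · have hkap : kappa (.orthogonal Q nondeg) = 2 := if_pos hc
    have h2 : ((2 : ℕ) : F) = 0 := by rw [← hc]; exact ringChar.Nat.cast_ringChar
    have hA : ∀ {i j : J} (hij : i ≠ j), he.elem hij * he.elem hij = 1 := fun hij => by
      rw [← pow_two]
      exact he.elem_pow_of_cast_eq_zero hij h2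
    have hu2 : (he.elem h01 * he.elem h12) ^ 2 = he.elem h02 := by
      rw [pow_two]
      conv_lhs => enter [1]; rw [he.elem_mul_elem h01 h12 h02]
      rw [mul_assoc, mul_assoc, ← mul_assoc (he.elem h01), hA, one_mul, hA, mul_one]
    have hq : Even (Nat.card F) := by
      rw [Nat.card_eq_fintype_card, Nat.even_iff]
      exact FiniteField.even_card_of_char_two hc
    obtain ⟨l, hl⟩ := hq
    refine ⟨he.elem h01 * he.elem h12, ?_, fun x hx => ?_, ?_, ?_, ?_, ?_⟩
    · rw [map_mul, he.of_elem h03 h13.symm, he.of_elem h13 h23.symm, one_mul]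
    · rw [orthogonalGroup_mul_apply, he.elem_apply_of_eq_zero h12 (hx 1).1 (hx 2).2,
        he.elem_apply_of_eq_zero h01 (hx 0).1 (hx 1).2]
    · exact (Even.pow_of_ne_zero ⟨l, hl⟩ two_ne_zero).mul_left _
    · have e1 : (Nat.card F - 1) * Nat.card F ^ 2 =
          2 * (Nat.card F * (l * (Nat.card F - 1))) := by
        rw [pow_two]
        conv_lhs => enter [2, 1]; rw [hl]
        ring
      rw [e1, pow_mul, hu2, pow_mul, he.elem_pow_of_cast_eq_zero h02 hcast, one_pow]
    · rw [hkap]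
      exact even_two_mul _
    · rw [hkap, pow_mul, hu2]
      exact hmem
  · have hkap : kappa (.orthogonal Q nondeg) = 1 := if_neg hc
    have hq : Odd (Nat.card F) := by
      rw [Nat.card_eq_fintype_card, Nat.odd_iff]
      exact FiniteField.odd_card_of_char_ne_two hc
    have hev : ∀ {n : ℕ}, Odd n → Even (n - 1) := fun {n} h => by
      obtain ⟨l, rfl⟩ := h
      exact ⟨l, by omega⟩
    refine ⟨he.elem h02, he.of_elem h01 h12 h02, fun x hx => ?_, ?_, ?_, ?_, ?_⟩
    · exact he.elem_apply_of_eq_zero h02 (hx 0).1 (hx 2).2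
    · exact (hev hq).mul_right _
    · exact he.elem_pow_of_cast_eq_zero h02 (by push_cast; rw [hcast]; simp)
    · rw [hkap, one_mul]
      exact hev hq.pow
    · rw [hkap, one_mul]
      exact hmem

theorem fibreBound_orthogonal [Finite F] [FiniteDimensional F V] (Q : QuadraticForm F V)
    (nondeg : (QuadraticMap.polarBilin Q).Nondegenerate) {d t r : ℕ} (hd : 2 ≤ d)
    (ht : 2 * (t * d) + 11 ≤ finrank F V) (hY : 2 ^ 16 ≤ Nat.card F ^ d)
    (hr : 6 * d * r ≤ Nat.card F ^ d) :
    FibreBound (.orthogonal Q nondeg) d t r (finrank F V - 2 * (t * d)) := by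
  set P := orthogonalSpace Q nondeg with hP
  have hG : P.group = GCl (.orthogonal Q nondeg) := group_orthogonalSpace Q nondeg
  refine fibreBound_of_polarSpace P hG (s := 1) (Or.inl rfl) (fun a => (pow_one a).symm) hd ht hY hr
    fun m e e' he => ?_
  have he' : IsHyp Q e e' := ⟨he.ee, he.ee', fun i j => he.e'e i j, he.e'e', he.Qe, he.Qe'⟩
  obtain ⟨u, hu, hfix, hN, huN, hk, hS⟩ := exists_unipotent_orthogonal nondeg (by omega) (d := d)
    (by omega) he' (s := fun i : Fin 4 => Fin.natAdd m (Fin.castLE (by norm_num) i))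
    fun i j h => by simpa [Fin.ext_iff] using h
  have key := exists_rep_orthogonal nondeg.1 (by omega) he' hu hfix hN huN hk hS
  have hG' : P.group = orthogonalGroup Q := hG
  rw [← hG'] at key
  exact key

end OrthogonalBound

end FiniteClassical

namespace FiniteClassical

open Module

/-! ### The numerical estimate -/

theorem exists_fibreBound {F : Type*} [Field F] [Finite F] {V : Type*} [AddCommGroup V] [Module F V]
    [FiniteDimensional F V] (Γ : ClassicalForm F V) {d r : ℕ} (hd : 2 ≤ d)
    (hV : 11 ≤ finrank F V) (hY : 2 ^ 16 ≤ Nat.card F ^ d) (hr : 6 * d * r ≤ Nat.card F ^ d) :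
    ∃ t u, t * d ≤ finrank F V ∧ u ≤ 8 * d ∧ FibreBound Γ d t r u := by
  have hform : ∃ t, 2 * (t * d) + 11 ≤ finrank F V ∧ t * d ≤ finrank F V ∧
      finrank F V - 2 * (t * d) ≤ 8 * d := by
    have h1 := Nat.div_mul_le_self (finrank F V - 11) (2 * d)
    have h2 := Nat.lt_mul_div_succ (finrank F V - 11) (b := 2 * d) (by omega)
    set t := (finrank F V - 11) / (2 * d)
    have e1 : t * (2 * d) = 2 * (t * d) := by ring
    have e2 : 2 * d * (t + 1) = 2 * (t * d) + 2 * d := by ring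
    exact ⟨t, by omega, by omega, by omega⟩
  obtain ⟨t, ht1, ht2, ht3⟩ := hform
  cases Γ with
  | linear =>
    have h1 := Nat.div_mul_le_self (finrank F V - 3) d
    have h2 := Nat.lt_mul_div_succ (finrank F V - 3) (b := d) (by omega)
    set t := (finrank F V - 3) / d
    have e2 : d * (t + 1) = t * d + d := by ring
    exact ⟨t, _, by omega, by omega, fibreBound_linear hd (by omega) hY hr⟩
  | symplectic f alt nondeg =>
    exact ⟨t, _, ht2, ht3, fibreBound_symplectic f alt nondeg hd ht1 hY hr⟩
  | orthogonal Q nondeg => exact ⟨t, _, ht2, ht3, fibreBound_orthogonal Q nondeg hd ht1 hY hr⟩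
  | unitary θ invol ne_id f herm nondeg =>
    exact ⟨t, _, ht2, ht3, fibreBound_unitary θ invol ne_id f herm nondeg hd ht1 hY hr⟩

/-- The fibre bound in exponential form. Since `t ≤ n / d` is small compared with the number `r` of
available eigenvalues, the falling factorial of `r` is at least `(q ^ d / (12 * d)) ^ t`, and the
remaining factor `(12 * d * n) ^ t * q ^ (u ^ 2)` is absorbed by the exponential. -/
theorem exp_le_div_of_descFactorial_le {q n d t u c g : ℕ} (hq : 1 ≤ q) (hn : 3 ≤ n) (hd : 1 ≤ d)
    (hdn : d ≤ n) (hC : 12 * n < q ^ d) (ht : t * d ≤ n) (hu : u ≤ 8 * d) (hg : 0 < g)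
    (h : (q ^ d / (6 * d)).descFactorial t * g ≤ c * ((q ^ d) ^ t * q ^ u ^ 2 * n ^ t)) :
    Real.exp (-(64 * ((d : ℝ) ^ 2 * Real.log q)) - 64 * ((n : ℝ) * Real.log n / (d : ℝ)))
      ≤ (c : ℝ) / (g : ℝ) := by
  have hq' : (1 : ℝ) ≤ q := by exact_mod_cast hq
  have hn' : (3 : ℝ) ≤ n := by exact_mod_cast hn
  have hd' : (1 : ℝ) ≤ d := by exact_mod_cast hd
  have hdn' : (d : ℝ) ≤ n := by exact_mod_cast hdn
  have hd0 : (0 : ℝ) < d := by linarith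
  have hn0 : (0 : ℝ) < n := by linarith
  have hq0 : (0 : ℝ) < q := by linarith
  have hg' : (0 : ℝ) < g := by exact_mod_cast hg
  have ht' : (t : ℝ) * d ≤ n := by exact_mod_cast ht
  set r := q ^ d / (6 * d) with hr
  set X : ℝ := (q : ℝ) ^ d with hX
  have hX0 : 0 < X := pow_pos hq0 d
  have hC' : 12 * (n : ℝ) < X := by rw [hX]; exact_mod_cast hC
  have hr1 : X < 6 * d * (r + 1) := by
    have := Nat.lt_mul_div_succ (q ^ d) (b := 6 * d) (by omega)
    rw [hX]
    exact_mod_cast this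
  have hbase : X / (12 * d) ≤ ((r + 1 - t : ℕ) : ℝ) := by
    have h1 : (r : ℝ) + 1 ≤ ((r + 1 - t : ℕ) : ℝ) + t := by
      have : r + 1 ≤ (r + 1 - t) + t := by omega
      exact_mod_cast this
    rw [div_le_iff₀ (by positivity)]
    nlinarith
  have hfac : (X / (12 * d)) ^ t ≤ (r.descFactorial t : ℝ) := by
    refine (pow_le_pow_left₀ (by positivity) hbase t).trans ?_
    exact_mod_cast Nat.pow_sub_le_descFactorial r t
  have h' : (r.descFactorial t : ℝ) * g ≤ c * (X ^ t * (q : ℝ) ^ u ^ 2 * (n : ℝ) ^ t) := by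
    rw [hX]
    exact_mod_cast h
  have hkey : (g : ℝ) ≤ c * ((12 * d * n) ^ t * (q : ℝ) ^ u ^ 2) := by
    have h1 : (X / (12 * d)) ^ t * g ≤ c * (X ^ t * (q : ℝ) ^ u ^ 2 * (n : ℝ) ^ t) :=
      (mul_le_mul_of_nonneg_right hfac hg'.le).trans h'
    have h2 : 0 < (X / (12 * d)) ^ t := by positivity
    refine le_of_mul_le_mul_left (h1.trans_eq ?_) h2
    have h3 : X ^ t = (X / (12 * d)) ^ t * (12 * d) ^ t := by
      rw [← mul_pow]
      congr 1
      field_simp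
    rw [mul_pow (12 * (d : ℝ)) n, h3]
    ring
  have hlog : 0 ≤ Real.log n := Real.log_nonneg (by linarith)
  have hexp1 : (12 * (d : ℝ) * n) ^ t ≤ Real.exp (64 * ((n : ℝ) * Real.log n / d)) := by
    have h1 : 12 * (d : ℝ) * n ≤ (n : ℝ) ^ 5 := by
      have h2 : (12 : ℝ) ≤ (n : ℝ) ^ 3 :=
        le_trans (by norm_num) (pow_le_pow_left₀ (by norm_num) hn' 3)
      calc 12 * (d : ℝ) * n ≤ (n : ℝ) ^ 3 * n * n := by gcongr
        _ = (n : ℝ) ^ 5 := by ring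
    have h3 : (n : ℝ) ^ 5 = Real.exp (5 * Real.log n) := by
      rw [← Real.exp_log (pow_pos hn0 5), Real.log_pow]
      norm_num
    have h4 : (t : ℝ) ≤ n / d := by rwa [le_div_iff₀ hd0]
    calc (12 * (d : ℝ) * n) ^ t ≤ ((n : ℝ) ^ 5) ^ t := pow_le_pow_left₀ (by positivity) h1 t
      _ = Real.exp (t * (5 * Real.log n)) := by rw [h3, ← Real.exp_nat_mul]
      _ ≤ Real.exp (64 * ((n : ℝ) * Real.log n / d)) := by
        refine Real.exp_le_exp.2 ?_
        have h5 : (t : ℝ) * (5 * Real.log n) ≤ n / d * (64 * Real.log n) := by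
          gcongr
          norm_num
        refine h5.trans_eq ?_
        ring
  have hexp2 : (q : ℝ) ^ u ^ 2 ≤ Real.exp (64 * ((d : ℝ) ^ 2 * Real.log q)) := by
    have h1 : u ^ 2 ≤ 64 * d ^ 2 := by
      calc u ^ 2 ≤ (8 * d) ^ 2 := Nat.pow_le_pow_left hu 2
        _ = 64 * d ^ 2 := by ring
    refine (pow_le_pow_right₀ hq' h1).trans_eq ?_
    rw [← Real.exp_log (pow_pos hq0 _), Real.log_pow]
    push_cast
    congr 1
    ring
  rw [le_div_iff₀ hg', sub_eq_add_neg, Real.exp_add, Real.exp_neg, Real.exp_neg]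
  set A := Real.exp (64 * ((d : ℝ) ^ 2 * Real.log q))
  set B := Real.exp (64 * ((n : ℝ) * Real.log n / d))
  have hA : 0 < A := Real.exp_pos _
  have hB : 0 < B := Real.exp_pos _
  have h6 : (g : ℝ) ≤ c * (B * A) := hkey.trans (by gcongr)
  calc A⁻¹ * B⁻¹ * g ≤ A⁻¹ * B⁻¹ * (c * (B * A)) := by gcongr
    _ = c := by field_simp

end FiniteClassical

theorem proposition7p1 :
    ∃ C K : ℝ, ∃ N : ℕ, 0 < C ∧ 0 < K ∧
      ∀ (F : Type) [Field F] [Finite F] (n d : ℕ)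
        (Γ : FiniteClassical.ClassicalForm F (Fin n → F)),
        N ≤ n → 2 ≤ d → d ≤ n → C * (n : ℝ) < (Nat.card F : ℝ) ^ d →
        ∃ 𝒞 : Set (FiniteClassical.GCl Γ),
          (∀ g ∈ 𝒞, ∀ h : FiniteClassical.GCl Γ, h * g * h⁻¹ ∈ 𝒞) ∧
          (∀ α : Abelianization (FiniteClassical.GCl Γ),
            Real.exp (-(K * ((d : ℝ) ^ 2 * Real.log (Nat.card F)))
                - K * ((n : ℝ) * Real.log n / (d : ℝ)))
              ≤ (Nat.card {g : FiniteClassical.GCl Γ // g ∈ 𝒞 ∧ Abelianization.of g = α} : ℝ)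
                / (Nat.card (FiniteClassical.GCl Γ) : ℝ)) ∧
          (∀ g ∈ 𝒞,
            ((g ^ (FiniteClassical.kappa Γ * (Nat.card F ^ d - 1)) : FiniteClassical.GCl Γ) :
                (Fin n → F) ≃ₗ[F] (Fin n → F)) ∈ FiniteClassical.minimalDegreeSet Γ) := by
  refine ⟨12, 64, 2 ^ 13, by norm_num, by norm_num, fun F _ _ n d Γ hn hd hdn hC => ?_⟩
  have hC' : 12 * n < Nat.card F ^ d := by exact_mod_cast hC
  have hdim : Module.finrank F (Fin n → F) = n := Module.finrank_fin_fun F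
  -- `12 * 2 ^ 13` exceeds the bound `2 ^ 16` needed for the existence of enough eigenvalues.
  obtain ⟨t, u, ht, hu, hb⟩ := FiniteClassical.exists_fibreBound Γ (d := d)
    (r := Nat.card F ^ d / (6 * d)) hd (by omega) (by omega) (Nat.mul_div_le _ _)
  rw [hdim] at ht
  refine ⟨{g | ((g ^ (FiniteClassical.kappa Γ * (Nat.card F ^ d - 1)) : FiniteClassical.GCl Γ) :
    (Fin n → F) ≃ₗ[F] (Fin n → F)) ∈ FiniteClassical.minimalDegreeSet Γ}, fun g hg h => ?_,
    fun α => ?_, fun g hg => hg⟩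
  · rw [Set.mem_ofPred_eq, conj_pow]
    exact FiniteClassical.conj_mem_minimalDegreeSet hg h.2
  · have : Finite ((Fin n → F) ≃ₗ[F] (Fin n → F)) :=
      Finite.of_injective _ DFunLike.coe_injective
    have := hb α
    rw [hdim] at this
    exact FiniteClassical.exp_le_div_of_descFactorial_le Nat.card_pos (by omega) (by omega) hdn hC'
      ht hu Nat.card_pos this
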